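/- Let $k$ be a field of characteristic $0$. A differential graded Lie algebra (DGLA) over $k$ is a $\mathbb Z$-graded $k$-vector space $L=\bigoplus_{n\in\mathbb Z}L^n$ with a bilinear bracket of degree $0$ satisfying $[u,v]=-(-1)^{|u||v|}[v,u]$ and the graded Jacobi identity, and a linear map $d$ of degree $1$ with $d^2=0$ and $d[u,v]=[du,v]+(-1)^{|u|}[u,dv]$. Let $\hbar L[[\hbar]]$ be the DGLA whose degree $n$ elements are the formal series $\sum_{i\ge1}x_i\hbar^i$ with $x_i\in L^n$, with $d$ and $[\cdot,\cdot]$ extended $\hbar$-linearly. Put $$MC(\hbar L[[\hbar]])=\{s\in\hbar L^1[[\hbar]] : ds+\tfrac12[s,s]=0\},$$ let $\exp(\alpha)$, $\alpha\in\hbar L^0[[\hbar]]$, act on it by $$\exp(\alpha)\cdot l=l+\sum_{n\ge0}\frac{(\operatorname{ad}\alpha)^n}{(n+1)!}\bigl([\alpha,l]-d\alpha\bigr)$$ (which is $e^{\operatorname{ad}\alpha}(\theta+l)-\theta$ if $d=[\theta,\cdot]$), and let $\mathrm{Def}(L)$ be the quotient of $MC(\hbar L[[\hbar]])$ by this action of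 the gauge group $\exp(\hbar L^0[[\hbar]])$. An $L_\infty$ morphism $f:L\to L'$ of DGLAs is a family of multilinear, graded skew-symmetric maps $f_n:L^{\otimes n}\to L'$ ($n\ge1$) of degree $1-n$ such that for all $n\ge1$ and homogeneous $v_1,\dots,v_n\in L$ $$\begin{aligned}&d f_n(v_1,\dots,v_n)+\tfrac12\sum_{\substack{i+j=n\\ i,j\ge1}}\ \sum_{\sigma\in S_{(i,j)}}\kappa(\sigma)(-1)^{(j-1)\sum_{p\le i}(|v_{\sigma(p)}|-1)}\bigl[f_i(v_{\sigma(1)},\dots,v_{\sigma(i)}),f_j(v_{\sigma(i+1)},\dots,v_{\sigma(n)})\bigr]\\&=(-1)^{n-1}\sum_{\sigma\in S_{(1,n-1)}}\kappa(\sigma)f_n(dv_{\sigma(1)},v_{\sigma(2)},\dots,v_{\sigma(n)})+(-1)^n\sum_{\sigma\in S_{(2,n-2)}}\kappa(\sigma)f_{n-1}([v_{\sigma(1)},v_{\sigma(2)}],v_{\sigma(3)},\dots,v_{\sigma(n)}),\end{aligned}$$ where $S_{(i,j)}$ is the set of $(i,j)$-unshuffles, the last sum is absent for $n=1$, and $\kappa(\sigma)=\operatorname{sgn}(\sigma)\tau(\sigma)$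 with $\tau(\sigma)$ the Koszul sign, the product of $(-1)^{|v_a||v_b|}$ over all pairs $v_a,v_b$ whose order $\sigma$ reverses. Theorem. Let $L$ and $L'$ be DGLAs over $k$ and let $f:L\to L'$ be an $L_\infty$ morphism that is a weak equivalence, i.e. the chain map $f_1$ induces isomorphisms $H^n(L)\to H^n(L')$ for all $n$. Then $s\mapsto\sum_{n\ge1}\frac1{n!}f_n(s,\dots,s)$ (with $f_n$ extended $\hbar$-multilinearly) maps $MC(\hbar L[[\hbar]])$ to $MC(\hbar L'[[\hbar]])$ and induces a well-defined map $\mathrm{Def}(f):\mathrm{Def}(L)\to\mathrm{Def}(L')$, and $\mathrm{Def}(f)$ is a bijection. -/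

import Mathlib

open Finset

/-! ## Koszul signs and unshuffles -/

/-- The Koszul sign `τ(σ)` of a permutation of homogeneous elements of degrees `a 0, …, a (n-1)`:
`v 0 ∧ ⋯ ∧ v (n-1) = τ(σ) v (σ 0) ∧ ⋯ ∧ v (σ (n-1))`.  Every pair of factors whose order is
reversed contributes the sign `(-1)^(product of the two degrees)`. -/
def koszulSign {n : ℕ} (a : Fin n → ℤ) (σ : Equiv.Perm (Fin n)) : ℤˣ :=
  ∏ p : Fin n × Fin n with p.1 < p.2 ∧ σ p.2 < σ p.1, (a (σ p.1) * a (σ p.2)).negOnePow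

/-- The graded skew-symmetric Koszul sign `κ(σ) = sgn(σ) τ(σ)`. -/
def skewKoszulSign {n : ℕ} (a : Fin n → ℤ) (σ : Equiv.Perm (Fin n)) : ℤˣ :=
  Equiv.Perm.sign σ * koszulSign a σ

/-- The `(i, n - i)`-unshuffles: `σ` is increasing on the first `i` indices and increasing on the
remaining `n - i` indices. -/
def unshuffles (n i : ℕ) : Finset (Equiv.Perm (Fin n)) :=
  {σ | ∀ p q : Fin n, p < q → ((q : ℕ) < i ∨ i ≤ (p : ℕ)) → σ p < σ q}

/-! ## Differential graded Lie algebras -/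

/-- A differential graded Lie algebra structure on the `k`-vector space `V`: a `ℤ`-grading
`V = ⨁ n, gr n`, a graded Lie bracket of degree `0`, and a differential `d` of degree `1` which is a
derivation of the bracket. -/
structure DGLA (k : Type*) (V : Type*) [Field k] [AddCommGroup V] [Module k V] where
  /-- the homogeneous components -/
  gr : ℤ → Submodule k V
  isInternal : DirectSum.IsInternal gr
  /-- the bracket -/
  bracket : V →ₗ[k] V →ₗ[k] V
  /-- the differential -/
  d : V →ₗ[k] V
  bracket_mem : ∀ {m n : ℤ} {u v : V}, u ∈ gr m → v ∈ gr n → bracket u v ∈ gr (m + n)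
  skew : ∀ {m n : ℤ} {u v : V}, u ∈ gr m → v ∈ gr n →
    bracket u v = -((m * n).negOnePow • bracket v u)
  jacobi : ∀ {m n p : ℤ} {u v w : V}, u ∈ gr m → v ∈ gr n → w ∈ gr p →
    (m * p).negOnePow • bracket u (bracket v w) + (n * m).negOnePow • bracket v (bracket w u)
      + (p * n).negOnePow • bracket w (bracket u v) = 0
  d_mem : ∀ {m : ℤ} {u : V}, u ∈ gr m → d u ∈ gr (m + 1)
  d_d : ∀ u : V, d (d u) = 0
  leibniz : ∀ {m : ℤ} {u : V}, u ∈ gr m → ∀ v : V,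
    d (bracket u v) = bracket (d u) v + m.negOnePow • bracket u (d v)

namespace DGLA

variable {k V : Type*} [Field k] [AddCommGroup V] [Module k V] (L : DGLA k V)

/-! ### Cohomology -/

/-- The cocycles of degree `n`. -/
def cocycles (n : ℤ) : Submodule k V := LinearMap.ker L.d ⊓ L.gr n

/-- The coboundaries of degree `n`. -/
def coboundaries (n : ℤ) : Submodule k V := (L.gr (n - 1)).map L.d

/-- The cohomology `H^n(L)`: cocycles modulo coboundaries. -/
abbrev Cohomology (n : ℤ) : Type _ :=
  L.cocycles n ⧸ (L.coboundaries n).comap (L.cocycles n).subtype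

/-! ### The DGLA `ħL[[ħ]]`

A formal power series `∑ x_i ħ^i` with coefficients in `V` is given by its sequence of
coefficients `x : ℕ → V`. -/

/-- The degree `n` component of `ħL[[ħ]]`: the series `∑_{i ≥ 1} x_i ħ^i` with all `x_i ∈ L^n`. -/
def hSeries (n : ℤ) : Submodule k (ℕ → V) where
  carrier := {x | x 0 = 0 ∧ ∀ i, x i ∈ L.gr n}
  add_mem' := fun hx hy =>
    ⟨by simp [hx.1, hy.1], fun i => (L.gr n).add_mem (hx.2 i) (hy.2 i)⟩
  zero_mem' := ⟨rfl, fun _ => (L.gr n).zero_mem⟩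
  smul_mem' := fun c _ hx => ⟨by simp [hx.1], fun i => (L.gr n).smul_mem c (hx.2 i)⟩

/-- The differential of `L[[ħ]]`. -/
def hD (x : ℕ → V) : ℕ → V := fun m => L.d (x m)

/-- The bracket of `L[[ħ]]`. -/
def hBracket (x y : ℕ → V) : ℕ → V := fun m =>
  ∑ p ∈ antidiagonal m, L.bracket (x p.1) (y p.2)

/-- The set `MC(ħL[[ħ]])` of Maurer–Cartan elements of `ħL[[ħ]]`: the elements `s` of degree `1`
such that `ds + ½[s, s] = 0`. -/
def MC : Set (ℕ → V) :=
  {s | s ∈ L.hSeries 1 ∧ L.hD s + (2⁻¹ : k) • L.hBracket s s = 0}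

/-- The action of `exp(α)`, for `α ∈ ħL^0[[ħ]]`, on `l ∈ ħL^1[[ħ]]`:
`exp(α) · l = l + ∑_{n ≥ 0} (ad α)^n ([α, l] - dα) / (n + 1)!`.
If `d = [θ, -]` then this is `exp(ad α)(θ + l) - θ`.  The coefficient of `ħ^m` in
`(ad α)^n ([α, l] - dα)` vanishes for `n ≥ m`, see `hBracket_iterate_eq_zero`. -/
def gaugeAct (α l : ℕ → V) : ℕ → V := fun m =>
  l m + ∑ n ∈ range m,
    ((Nat.factorial (n + 1) : k))⁻¹ • (L.hBracket α)^[n] (L.hBracket α l - L.hD α) m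

theorem hBracket_iterate_eq_zero {α y : ℕ → V} (hα : α 0 = 0) (hy : y 0 = 0) (n : ℕ) :
    ∀ m ≤ n, (L.hBracket α)^[n] y m = 0 := by
  induction n with
  | zero => intro m hm; obtain rfl : m = 0 := by omega
            simpa using hy
  | succ n ih =>
    intro m hm
    rw [Function.iterate_succ_apply']
    refine Finset.sum_eq_zero fun p hp => ?_
    rw [HasAntidiagonal.mem_antidiagonal] at hp
    rcases Nat.eq_zero_or_pos p.1 with h | h
    · simp [h, hα]
    · rw [ih p.2 (by omega), map_zero]

/-- Two Maurer–Cartan elements are related if an element `exp(α)`, `α ∈ ħL^0[[ħ]]`, of the gauge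
group moves the first to the second. -/
def GaugeRel (s t : L.MC) : Prop :=
  ∃ α ∈ L.hSeries 0, (t : ℕ → V) = L.gaugeAct α s

/-- `Def(L)`: the Maurer–Cartan elements of `ħL[[ħ]]` modulo the gauge group `exp(ħL^0[[ħ]])`. -/
def Def : Type _ := Quot L.GaugeRel

end DGLA

/-! ## `L∞` morphisms between differential graded Lie algebras -/

/-- An `L∞` morphism `(f_n)_{n ≥ 1}` between DGLAs, both regarded as `L∞` algebras with
`l_1 = d`, `l_2 = [-, -]`, `l_n = 0` for `n ≥ 3`: graded skew-symmetric multilinear maps `f_n` of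
degree `1 - n` such that for all `n ≥ 1` and homogeneous `v_1, …, v_n`
```
  d f_n(v_1, …, v_n)
    + ½ ∑_{i+j=n} ∑_σ κ(σ) (-1)^e [f_i(v_σ(1), …, v_σ(i)), f_j(v_σ(i+1), …, v_σ(n))]
  = (-1)^(n-1) ∑_σ κ(σ) f_n(d v_σ(1), v_σ(2), …, v_σ(n))
    + (-1)^n ∑_σ κ(σ) f_{n-1}([v_σ(1), v_σ(2)], v_σ(3), …, v_σ(n))
```
with `e = (j - 1) ∑_{p ≤ i} (|v_σ(p)| - 1)`, where `i, j ≥ 1` and the three inner sums are over the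
unshuffles of type `(i, j)`, `(1, n - 1)` and `(2, n - 2)`.
Equivalently, the maps `F_n = (-1)^(∑ (n-i)(|v_i|-1)) f_n` are the Taylor coefficients of a morphism
from `S(L[1])` to `S(L'[1])` of differential graded coalgebras, for the codifferentials with Taylor
coefficients `Q_1(v) = dv` and `Q_2(v, w) = (-1)^(|v|-1) [v, w]`. -/
structure LInftyMorphism {k V V' : Type*} [Field k] [AddCommGroup V] [Module k V]
    [AddCommGroup V'] [Module k V'] (L : DGLA k V) (L' : DGLA k V') where
  /-- the component `f_n`; the family starts with `n = 1`, and `f_0` is set to `0` -/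
  f : ∀ n : ℕ, MultilinearMap k (fun _ : Fin n => V) V'
  f_zero : f 0 = 0
  degree : ∀ (n : ℕ) (a : Fin n → ℤ) (v : Fin n → V), (∀ i, v i ∈ L.gr (a i)) →
    f n v ∈ L'.gr (∑ i, a i + (1 - n))
  skew : ∀ (n : ℕ) (a : Fin n → ℤ) (v : Fin n → V), (∀ i, v i ∈ L.gr (a i)) →
    ∀ σ : Equiv.Perm (Fin n), f n (fun i => v (σ i)) = skewKoszulSign a σ • f n v
  /-- the relation for `n = 1` -/
  rel_one : ∀ v : V, L'.d (f 1 (fun _ => v)) = f 1 (fun _ => L.d v)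
  /-- the relation for `n = m + 2`, with block sizes `i + 1` and `m + 1 - i` for `0 ≤ i ≤ m` -/
  rel : ∀ (m : ℕ) (a : Fin (m + 2) → ℤ) (v : Fin (m + 2) → V), (∀ i, v i ∈ L.gr (a i)) →
    L'.d (f (m + 2) v)
      + (2⁻¹ : k) • ∑ i : Fin (m + 1), ∑ σ ∈ unshuffles (m + 2) (i + 1),
          (skewKoszulSign a σ *
            (((m - i : ℕ) : ℤ) *
              ∑ p : Fin (i + 1), (a (σ (p.castLE (by omega))) - 1)).negOnePow) •
          L'.bracket (f (i + 1) fun p => v (σ (p.castLE (by omega))))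
            (f (m + 1 - i) fun p => v (σ ⟨i + 1 + p, by omega⟩))
    = ((m : ℤ) + 1).negOnePow • ∑ σ ∈ unshuffles (m + 2) 1,
          skewKoszulSign a σ •
            f (m + 2) (Fin.cons (L.d (v (σ 0))) fun p : Fin (m + 1) => v (σ p.succ))
      + (m : ℤ).negOnePow • ∑ σ ∈ unshuffles (m + 2) 2,
          skewKoszulSign a σ •
            f (m + 1) (Fin.cons (L.bracket (v (σ 0)) (v (σ 1)))
              fun p : Fin m => v (σ p.succ.succ))

namespace LInftyMorphism

variable {k V V' : Type*} [Field k] [AddCommGroup V] [Module k V]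
    [AddCommGroup V'] [Module k V'] {L : DGLA k V} {L' : DGLA k V'} (F : LInftyMorphism L L')

/-- The linear part `f_1`. -/
def linearPart : V →ₗ[k] V' where
  toFun v := F.f 1 fun _ => v
  map_add' u v := by
    have h := (F.f 1).map_update_add (fun _ => 0) 0 u v
    simp only [Function.update_eq_const_of_subsingleton] at h
    exact h
  map_smul' c v := by
    have h := (F.f 1).map_update_smul (fun _ => 0) 0 c v
    simp only [Function.update_eq_const_of_subsingleton] at h
    exact h

theorem linearPart_mem {n : ℤ} {v : V} (hv : v ∈ L.gr n) : F.linearPart v ∈ L'.gr n := by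
  have h := F.degree 1 (fun _ => n) (fun _ => v) (fun _ => hv)
  simp only [univ_unique, sum_const, card_singleton, one_smul, Nat.cast_one, sub_self,
    add_zero] at h
  exact h

theorem linearPart_d (v : V) : F.linearPart (L.d v) = L'.d (F.linearPart v) :=
  (F.rel_one v).symm

theorem linearPart_cocycles {n : ℤ} : ∀ v ∈ L.cocycles n, F.linearPart v ∈ L'.cocycles n := by
  rintro v ⟨hd, hn⟩
  have hd' : L.d v = 0 := hd
  refine ⟨?_, F.linearPart_mem hn⟩
  change L'.d (F.linearPart v) = 0
  rw [← linearPart_d, hd', map_zero]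

theorem linearPart_coboundaries {n : ℤ} :
    ∀ v ∈ L.coboundaries n, F.linearPart v ∈ L'.coboundaries n := by
  rintro _ ⟨u, hu, rfl⟩
  exact ⟨F.linearPart u, F.linearPart_mem hu, (F.linearPart_d u).symm⟩

/-- The map `H^n(L) → H^n(L')` induced by `f_1`. -/
def cohomologyMap (n : ℤ) : L.Cohomology n →ₗ[k] L'.Cohomology n :=
  Submodule.mapQ _ _ (F.linearPart.restrict F.linearPart_cocycles)
    fun v hv => F.linearPart_coboundaries (v : V) hv

/-- `f` is a weak equivalence: the chain map `f_1` is a quasi-isomorphism. -/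
def IsWeakEquivalence : Prop := ∀ n : ℤ, Function.Bijective (F.cohomologyMap n)

/-- The `k[[ħ]]`-multilinear extension of `f_n` to formal power series. -/
def hExt (n : ℕ) (x : Fin n → ℕ → V) : ℕ → V' := fun m =>
  ∑ c ∈ Finset.Nat.antidiagonalTuple n m, F.f n fun p => x p (c p)

/-- The map `s ↦ ∑_{n ≥ 1} f_n(s, …, s) / n!` on `ħL^1[[ħ]]`.  As `s` has no constant term, the
coefficient of `ħ^m` in `f_n(s, …, s)` vanishes for `n > m`. -/
def mcMap (s : ℕ → V) : ℕ → V' := fun m =>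
  ∑ n ∈ Icc 1 m, ((Nat.factorial n : k))⁻¹ • F.hExt n (fun _ => s) m

end LInftyMorphism

/-! The bijection is proved one power of ħ at a time, with the cohomology of degrees 0, 1, 2
governing each step.

Surjectivity (`exists_lift_step`): suppose that `x` has vanishing curvature and `exp(α) · f(x)`
equals the Maurer–Cartan element `y`, both modulo ħ^M. The coefficient o of the curvature of `x` at
ħ^M is a cocycle by the Bianchi identity, and f_1 o = dw, where w is the difference of `exp(α) ·
f(x)` and `y` at ħ^M. Injectivity on H² gives o = du; then w - f_1 u is a cocycle, and surjectivity
on H¹ writes it as f_1 c + dv. Subtracting (u + c)ħ^M from `x` and adding vħ^M to `α` repairs both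
conditions.

Injectivity (`exists_gauge_step`): suppose that f(x) = exp(β) · f(y), where `x` and `y` agree and
`β` vanishes modulo ħ^M. The difference of `x` and `y` at ħ^M is a cocycle with f_1-image -dβ_M,
hence it is du by injectivity on H¹. Surjectivity on H⁰ gives f_1 u + β_M = f_1 c + dv. Acting on
`x` by exp((u - c)ħ^M) removes the difference and leaves dv as the coefficient of the new `β`. This
is removed by an element dρ + [z, ρ] of the stabilizer of z, the image of the new `x`. In both
arguments lower coefficients stay fixed, so the corrections converge coefficientwise.

Two facts about f are needed. By `curv_mcMap`, the curvature of f(s) depends linearly on that of s,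
with leading term f_1. By `dS_gaugeParam`, the derivative of f maps infinitesimal gauge
transformations to infinitesimal gauge transformations. Both come from the L∞ relations with
arguments (s, …, s) and (α, s, …, s).

No Baker–Campbell–Hausdorff formula is used. Gauge transformations are obtained from integral curves
of `t dy/dt = [b, y] - db` that are polynomial in t in each coefficient.
`DGLA.exists_gauge_transport` shows that the endpoints of such a curve are gauge equivalent and
keeps track of the leading coefficient of the transformation. Composition, inverses and
compatibility with f all follow by exhibiting suitable curves. -/

section PolynomialFunctions

/-! ### Vector-valued polynomial functions and the Euler operator t d/dt. -/

variable {k V W U : Type*} [Field k] [AddCommGroup V] [Module k V] [AddCommGroup W] [Module k W]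
  [AddCommGroup U] [Module k U]

/-- The polynomial function `t ↦ ∑ t^i c_i` with coefficients in a vector space. -/
noncomputable def polyEval (k : Type*) {V : Type*} [Field k] [AddCommGroup V] [Module k V] :
    (ℕ →₀ V) →ₗ[k] k → V :=
  LinearMap.pi fun t => Finsupp.lsum k fun i => (t ^ i) • LinearMap.id

theorem polyEval_apply (c : ℕ →₀ V) (t : k) : polyEval k c t = c.sum fun i v => t ^ i • v := rfl

@[simp]
theorem polyEval_single (i : ℕ) (v : V) (t : k) :
    polyEval k (Finsupp.single i v) t = t ^ i • v := by
  simp [polyEval_apply]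

theorem polyEval_zero_right (c : ℕ →₀ V) : polyEval k c 0 = c 0 := by
  induction c using Finsupp.induction_linear with
  | zero => simp
  | add c d hc hd => simp [hc, hd]
  | single i v =>
    rcases i with _ | i <;> simp

/-- Linear functionals separate the points of `V`, which reduces the claim to scalar polynomials
over an infinite field. -/
theorem polyEval_injective [Infinite k] : Function.Injective (polyEval k (V := V)) := by
  rw [← LinearMap.ker_eq_bot, LinearMap.ker_eq_bot']
  intro c hc
  ext i
  rw [Finsupp.zero_apply, ← Module.forall_dual_apply_eq_zero_iff k]
  intro φ
  have key : ∀ c : ℕ →₀ V, ∀ t : k,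
      (c.sum fun i v => Polynomial.monomial i (φ v)).eval t = φ (polyEval k c t) := by
    intro c t
    simp only [polyEval_apply, Finsupp.sum, map_sum, Polynomial.eval_finsetSum,
      Polynomial.eval_monomial, map_smul, smul_eq_mul]
    exact sum_congr rfl fun _ _ => mul_comm _ _
  have h0 : (c.sum fun i v => Polynomial.monomial i (φ v)) = 0 := by
    apply Polynomial.funext
    intro t
    rw [key, hc]
    simp
  have := congrArg (fun P => Polynomial.coeff P i) h0
  simp only [Finsupp.sum, Polynomial.finsetSum_coeff, Polynomial.coeff_monomial,
    Polynomial.coeff_zero] at this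
  rw [sum_ite_eq'] at this
  by_cases hi : i ∈ c.support
  · rwa [if_pos hi] at this
  · rw [Finsupp.notMem_support_iff.1 hi, map_zero]

/-- The Euler operator `t d/dt` on coefficients. -/
noncomputable def eulerCoeff (k : Type*) {V : Type*} [Field k] [AddCommGroup V] [Module k V] :
    (ℕ →₀ V) →ₗ[k] ℕ →₀ V :=
  Finsupp.lsum k fun i => (i : k) • Finsupp.lsingle i

@[simp]
theorem eulerCoeff_single (i : ℕ) (v : V) :
    eulerCoeff k (Finsupp.single i v) = Finsupp.single i ((i : k) • v) := by
  simp [eulerCoeff]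

theorem eulerCoeff_apply (c : ℕ →₀ V) (i : ℕ) : eulerCoeff k c i = (i : k) • c i := by
  induction c using Finsupp.induction_linear with
  | zero => simp
  | add c d hc hd => simp [hc, hd]
  | single j v =>
    rw [eulerCoeff_single]
    by_cases h : j = i
    · subst h; simp
    · simp [Finsupp.single_eq_of_ne' h]

/-- `q = t dp/dt` for the polynomial functions `p` and `q`. -/
def HasEuler (p q : k → V) : Prop :=
  ∃ c : ℕ →₀ V, polyEval k c = p ∧ polyEval k (eulerCoeff k c) = q

/-- `p` is a polynomial function. -/
def IsPolyFun (p : k → V) : Prop := ∃ c : ℕ →₀ V, polyEval k c = p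

theorem HasEuler.isPolyFun {p q : k → V} (h : HasEuler p q) : IsPolyFun p :=
  h.imp fun _ hc => hc.1

theorem HasEuler.isPolyFun_right {p q : k → V} (h : HasEuler p q) : IsPolyFun q :=
  let ⟨_, hc⟩ := h; ⟨_, hc.2⟩

theorem IsPolyFun.exists_hasEuler {p : k → V} (h : IsPolyFun p) : ∃ q, HasEuler p q :=
  let ⟨c, hc⟩ := h; ⟨_, c, hc, rfl⟩

theorem HasEuler.monomial (i : ℕ) (v : V) :
    HasEuler (fun t : k => t ^ i • v) fun t => t ^ i • ((i : k) • v) :=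
  ⟨Finsupp.single i v, by ext; simp, by ext; simp⟩

theorem HasEuler.const (v : V) : HasEuler (fun _ : k => v) fun _ => 0 := by
  simpa using HasEuler.monomial (k := k) 0 v

theorem HasEuler.id_smul (v : V) : HasEuler (fun t : k => t • v) fun t => t • v := by
  simpa using HasEuler.monomial (k := k) 1 v

theorem HasEuler.add {p q p' q' : k → V} (h : HasEuler p q) (h' : HasEuler p' q') :
    HasEuler (fun t => p t + p' t) fun t => q t + q' t := by
  obtain ⟨c, rfl, rfl⟩ := h
  obtain ⟨d, rfl, rfl⟩ := h'
  exact ⟨c + d, by simp; rfl, by simp; rfl⟩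

theorem HasEuler.map {p q : k → V} (h : HasEuler p q) (T : V →ₗ[k] W) :
    HasEuler (fun t => T (p t)) fun t => T (q t) := by
  obtain ⟨c, rfl, rfl⟩ := h
  induction c using Finsupp.induction_linear with
  | zero => simpa using HasEuler.const (k := k) (0 : W)
  | add c d hc hd => simpa using hc.add hd
  | single i v => simpa using HasEuler.monomial (k := k) i (T v)

theorem HasEuler.smul {p q : k → V} (h : HasEuler p q) (a : k) :
    HasEuler (fun t => a • p t) fun t => a • q t :=
  h.map (a • LinearMap.id)

theorem HasEuler.neg {p q : k → V} (h : HasEuler p q) :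
    HasEuler (fun t => -p t) fun t => -q t :=
  h.map (-LinearMap.id)

theorem HasEuler.sub {p q p' q' : k → V} (h : HasEuler p q) (h' : HasEuler p' q') :
    HasEuler (fun t => p t - p' t) fun t => q t - q' t := by
  simpa [sub_eq_add_neg] using h.add h'.neg

theorem HasEuler.sum {ι : Type*} {s : Finset ι} {p q : ι → k → V}
    (h : ∀ i ∈ s, HasEuler (p i) (q i)) :
    HasEuler (fun t => ∑ i ∈ s, p i t) fun t => ∑ i ∈ s, q i t := by
  classical
  induction s using Finset.induction_on with
  | empty => simpa using HasEuler.const (k := k) (0 : V)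
  | insert i s hi ih =>
    simp only [sum_insert hi]
    exact (h i (mem_insert_self i s)).add (ih fun j hj => h j (mem_insert_of_mem hj))

theorem HasEuler.map₂ {p q : k → V} {p' q' : k → W} (h : HasEuler p q) (h' : HasEuler p' q')
    (B : V →ₗ[k] W →ₗ[k] U) :
    HasEuler (fun t => B (p t) (p' t)) fun t => B (q t) (p' t) + B (p t) (q' t) := by
  obtain ⟨c, rfl, rfl⟩ := h
  obtain ⟨d, rfl, rfl⟩ := h'
  induction c using Finsupp.induction_linear with
  | zero => simpa using HasEuler.const (k := k) (0 : U)
  | add c c' hc hc' =>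
    convert hc.add hc' using 2
    · simp
    · simp; abel
  | single i v =>
    induction d using Finsupp.induction_linear with
    | zero => simpa using HasEuler.const (k := k) (0 : U)
    | add d d' hd hd' =>
      convert hd.add hd' using 2
      · simp
      · simp; abel
    | single j w =>
      convert HasEuler.monomial (k := k) (i + j) (B v w) using 2 with t t
      · simp [pow_add, smul_smul, mul_comm]
      · simp only [eulerCoeff_single, polyEval_single, map_smul, LinearMap.smul_apply, smul_smul,
          ← add_smul]
        congr 1
        push_cast
        ring

/-- The Leibniz rule for multilinear maps. -/
theorem HasEuler.multilinear {n : ℕ} (f : MultilinearMap k (fun _ : Fin n => V) W)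
    {p q : Fin n → k → V} (h : ∀ a, HasEuler (p a) (q a)) :
    HasEuler (fun t => f fun a => p a t)
      fun t => ∑ a, f (Function.update (fun b => p b t) a (q a t)) := by
  classical
  choose c hp hq using h
  have hp' : ∀ a t, p a t = ∑ i ∈ (c a).support, t ^ i • c a i := fun a t => by
    rw [← hp]; rfl
  have hq' : ∀ a t, q a t = ∑ i ∈ (c a).support, t ^ i • ((i : k) • c a i) := fun a t => by
    rw [← hq]
    rw [polyEval_apply]
    rw [Finsupp.sum_of_support_subset _ (s := (c a).support)]
    · exact sum_congr rfl fun i _ => by rw [eulerCoeff_apply]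
    · intro i hi
      rw [Finsupp.mem_support_iff, eulerCoeff_apply] at hi
      rw [Finsupp.mem_support_iff]
      intro h0
      simp [h0] at hi
    · simp
  -- Multilinear expansion into monomials indexed by exponent tuples `r`. On such a monomial the
  -- Euler operator is multiplication by `∑ r a`, and the update in slot `a` contributes the factor
  -- `r a`.
  have e1 : (fun t => f fun a => p a t) = fun t =>
      ∑ r ∈ Fintype.piFinset fun a => (c a).support, t ^ (∑ a, r a) • f fun a => c a (r a) := by
    funext t
    simp only [hp']
    rw [MultilinearMap.map_sum_finset]
    refine sum_congr rfl fun r _ => ?_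
    rw [MultilinearMap.map_smul_univ, prod_pow_eq_pow_sum]
  have e2 : ∀ t a, f (Function.update (fun b => p b t) a (q a t)) =
      ∑ r ∈ Fintype.piFinset fun a => (c a).support,
        t ^ (∑ a, r a) • ((r a : k) • f fun a => c a (r a)) := by
    intro t a
    have : Function.update (fun b => p b t) a (q a t) = fun b =>
        ∑ i ∈ (c b).support, (t ^ i * if b = a then (i : k) else 1) • c b i := by
      funext b
      by_cases hb : b = a
      · subst hb; simp [hq', smul_smul]
      · simp [hb, hp']
    rw [this, MultilinearMap.map_sum_finset]
    refine sum_congr rfl fun r _ => ?_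
    rw [MultilinearMap.map_smul_univ (m := fun a => c a (r a)), prod_mul_distrib,
      prod_pow_eq_pow_sum, smul_smul]
    simp
  rw [e1]
  simp only [e2]
  convert HasEuler.sum (k := k) (s := Fintype.piFinset fun a => (c a).support)
    (p := fun r t => t ^ (∑ a, r a) • f fun a => c a (r a))
    (fun r _ => HasEuler.monomial (∑ a, r a) (f fun a => c a (r a))) using 2 with t
  rw [sum_comm]
  refine sum_congr rfl fun r _ => ?_
  rw [← smul_sum, ← sum_smul]
  push_cast
  rfl

theorem HasEuler.congr {p q p' q' : k → V} (h : HasEuler p q) (hp : ∀ t, p' t = p t)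
    (hq : ∀ t, q' t = q t) : HasEuler p' q' := by
  obtain rfl : p' = p := funext hp
  obtain rfl : q' = q := funext hq
  exact h

variable [CharZero k]

/-- A polynomial function with vanishing derivative is constant. -/
theorem HasEuler.eq_const {p : k → V} (h : HasEuler p fun _ => 0) (t : k) : p t = p 0 := by
  obtain ⟨c, rfl, hc⟩ := h
  have h0 : eulerCoeff k c = 0 := polyEval_injective (k := k) (by rw [hc, map_zero]; rfl)
  have h1 : c = Finsupp.single 0 (c 0) := by
    ext i
    rcases eq_or_ne i 0 with rfl | hi
    · simp
    · have := DFunLike.congr_fun h0 i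
      rw [eulerCoeff_apply, Finsupp.zero_apply, smul_eq_zero] at this
      rw [Finsupp.single_eq_of_ne hi]
      exact this.resolve_left (by exact_mod_cast hi)
  rw [h1]
  simp

theorem HasEuler.unique {p p' q : k → V} (h : HasEuler p q) (h' : HasEuler p' q)
    (h0 : p 0 = p' 0) : p = p' := by
  funext t
  have := ((h.sub h').congr (fun _ => rfl) fun t => (sub_self (q t)).symm).eq_const t
  rw [h0, sub_self] at this
  exact sub_eq_zero.1 this

/-- Modulo `S` the derivative vanishes, so the path is constant there. -/
theorem HasEuler.mem_of_mem {p q : k → V} (h : HasEuler p q) (S : Submodule k V) (h0 : p 0 ∈ S)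
    (hq : ∀ t, q t ∈ S) (t : k) : p t ∈ S := by
  have := ((h.map S.mkQ).congr (fun _ => rfl) fun t =>
    ((Submodule.Quotient.mk_eq_zero S).2 (hq t)).symm).eq_const t
  rw [← Submodule.Quotient.mk_eq_zero, ← S.mkQ_apply, this, S.mkQ_apply,
    Submodule.Quotient.mk_eq_zero]
  exact h0

/-- The Euler operator multiplies the i-th coefficient by i, so it can be inverted exactly on
polynomials without constant term. The convention `0⁻¹ = 0` gives the primitive vanishing at 0. -/
theorem IsPolyFun.exists_antiderivative {q : k → V} (h : IsPolyFun q) (h0 : q 0 = 0) :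
    ∃ p, HasEuler p q ∧ p 0 = 0 := by
  obtain ⟨c, rfl⟩ := h
  rw [polyEval_zero_right] at h0
  let d : ℕ →₀ V := (Finsupp.lsum k fun i : ℕ => (i : k)⁻¹ • Finsupp.lsingle i : (ℕ →₀ V) →ₗ[k] ℕ →₀ V) c
  have hd : ∀ c : ℕ →₀ V, ∀ i, (Finsupp.lsum k fun i : ℕ => (i : k)⁻¹ • Finsupp.lsingle i : (ℕ →₀ V) →ₗ[k] ℕ →₀ V) c i
      = (i : k)⁻¹ • c i := by
    intro c i
    induction c using Finsupp.induction_linear with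
    | zero => simp
    | add c d hc hd => rw [map_add, Finsupp.add_apply, hc, hd, Finsupp.add_apply, smul_add]
    | single j v =>
      by_cases h : j = i
      · subst h; simp
      · simp [Finsupp.single_eq_of_ne' h]
  refine ⟨polyEval k d, ⟨d, rfl, ?_⟩, ?_⟩
  · congr 1
    ext i
    rw [eulerCoeff_apply, hd, smul_smul]
    rcases eq_or_ne i 0 with rfl | hi
    · simp [h0]
    · rw [mul_inv_cancel₀ (by exact_mod_cast hi), one_smul]
  · rw [polyEval_zero_right, hd]
    simp

end PolynomialFunctions

/-! ### Transfer of identities from vectors to formal series. -/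

section Representation

variable {k V W U : Type*} [Field k] [AddCommGroup V] [Module k V] [AddCommGroup W] [Module k W]
  [AddCommGroup U] [Module k U]

/-- The coefficients of degree `≤ N` of the polynomial function `p` are those of the series `x`. -/
def IsRep (N : ℕ) (p : k → V) (x : ℕ → V) : Prop :=
  ∃ c : ℕ →₀ V, polyEval k c = p ∧ ∀ i ≤ N, c i = x i

/-- The product of two series with respect to a bilinear map. -/
def cauchyProd (B : V →ₗ[k] W →ₗ[k] U) (x : ℕ → V) (y : ℕ → W) : ℕ → U := fun m =>
  ∑ p ∈ antidiagonal m, B (x p.1) (y p.2)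

/-- The extension of a multilinear map to series. -/
def seriesExt {n : ℕ} (f : MultilinearMap k (fun _ : Fin n => V) W) (x : Fin n → ℕ → V) : ℕ → W :=
  fun m => ∑ c ∈ Finset.Nat.antidiagonalTuple n m, f fun p => x p (c p)

variable {N : ℕ}

/-- The transfer principle: an identity in `V` is applied to truncated series evaluated at ħ = t for
every scalar t, and the coefficients of the resulting equal polynomial functions are compared. -/
theorem IsRep.eq_coeff [CharZero k] {p : k → V} {x y : ℕ → V} (hx : IsRep N p x)
    (hy : IsRep N p y) {i : ℕ} (hi : i ≤ N) : x i = y i := by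
  obtain ⟨c, rfl, hc⟩ := hx
  obtain ⟨d, hd, hd'⟩ := hy
  rw [← hc i hi, ← hd' i hi, polyEval_injective hd]

theorem isRep_truncation (N : ℕ) (x : ℕ → V) :
    IsRep N (fun t : k => ∑ i ∈ range (N + 1), t ^ i • x i) x := by
  refine ⟨∑ i ∈ range (N + 1), Finsupp.single i (x i), ?_, ?_⟩
  · ext t
    simp
  · intro i hi
    rw [Finsupp.finsetSum_apply]
    rw [sum_eq_single i]
    · simp
    · intro j _ hj
      exact Finsupp.single_eq_of_ne' hj
    · intro h
      exact absurd (mem_range.2 (by omega)) h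

theorem IsRep.add {p q : k → V} {x y : ℕ → V} (hx : IsRep N p x) (hy : IsRep N q y) :
    IsRep N (fun t => p t + q t) (x + y) := by
  obtain ⟨c, rfl, hc⟩ := hx
  obtain ⟨d, rfl, hd⟩ := hy
  exact ⟨c + d, by rw [map_add]; rfl, fun i hi => by simp [hc i hi, hd i hi]⟩

theorem IsRep.zero : IsRep N (fun _ : k => (0 : V)) 0 :=
  ⟨0, by rw [map_zero]; rfl, fun _ _ => rfl⟩

theorem IsRep.map {p : k → V} {x : ℕ → V} (hx : IsRep N p x) (T : V →ₗ[k] W) :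
    IsRep N (fun t => T (p t)) fun m => T (x m) := by
  obtain ⟨c, rfl, hc⟩ := hx
  refine ⟨c.mapRange T (map_zero T), ?_, fun i hi => by simp [hc i hi]⟩
  ext t
  rw [polyEval_apply, polyEval_apply, Finsupp.sum_mapRange_index (by simp), Finsupp.sum,
    Finsupp.sum, map_sum]
  simp

theorem IsRep.smul {p : k → V} {x : ℕ → V} (hx : IsRep N p x) (a : k) :
    IsRep N (fun t => a • p t) (a • x) :=
  hx.map (a • LinearMap.id)

theorem IsRep.sum {ι : Type*} {s : Finset ι} {p : ι → k → V} {x : ι → ℕ → V}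
    (h : ∀ i ∈ s, IsRep N (p i) (x i)) : IsRep N (fun t => ∑ i ∈ s, p i t) (∑ i ∈ s, x i) := by
  classical
  induction s using Finset.induction_on with
  | empty => simpa using IsRep.zero
  | insert i s hi ih =>
    simp only [sum_insert hi]
    exact (h i (mem_insert_self i s)).add (ih fun j hj => h j (mem_insert_of_mem hj))

theorem exists_cauchyProd_finsupp (B : V →ₗ[k] W →ₗ[k] U) (c : ℕ →₀ V) (d : ℕ →₀ W) :
    ∃ e : ℕ →₀ U, (∀ t, polyEval k e t = B (polyEval k c t) (polyEval k d t)) ∧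
      ∀ m, e m = cauchyProd B c d m := by
  induction c using Finsupp.induction_linear with
  | zero => exact ⟨0, by simp, by simp [cauchyProd]⟩
  | add c c' hc hc' =>
    obtain ⟨e, he, he'⟩ := hc
    obtain ⟨g, hg, hg'⟩ := hc'
    exact ⟨e + g, by simp [he, hg], by simp [he', hg', cauchyProd, sum_add_distrib]⟩
  | single i v =>
    induction d using Finsupp.induction_linear with
    | zero => exact ⟨0, by simp, by simp [cauchyProd]⟩
    | add c c' hc hc' =>
      obtain ⟨e, he, he'⟩ := hc
      obtain ⟨g, hg, hg'⟩ := hc'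
      exact ⟨e + g, by simp [he, hg], by simp [he', hg', cauchyProd, sum_add_distrib]⟩
    | single j w =>
      refine ⟨Finsupp.single (i + j) (B v w), fun t => ?_, fun m => ?_⟩
      · simp [pow_add, smul_smul, mul_comm]
      · by_cases h : i + j = m
        · rw [cauchyProd, sum_eq_single (i, j)]
          · simp [h]
          · rintro ⟨a, b⟩ hab hne
            by_cases ha : a = i
            · have hb : b ≠ j := fun hb => hne (by rw [ha, hb])
              simp [Finsupp.single_eq_of_ne hb]
            · simp [Finsupp.single_eq_of_ne ha]
          · intro h'
            exact absurd (HasAntidiagonal.mem_antidiagonal.2 h) h'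
        · rw [Finsupp.single_eq_of_ne' h, cauchyProd, sum_eq_zero]
          rintro ⟨a, b⟩ hab
          rw [HasAntidiagonal.mem_antidiagonal] at hab
          by_cases ha : a = i
          · have hb : b ≠ j := fun hb => h (by rw [← ha, ← hb]; exact hab)
            simp [Finsupp.single_eq_of_ne hb]
          · simp [Finsupp.single_eq_of_ne ha]

theorem IsRep.map₂ {p : k → V} {q : k → W} {x : ℕ → V} {y : ℕ → W} (hx : IsRep N p x)
    (hy : IsRep N q y) (B : V →ₗ[k] W →ₗ[k] U) :
    IsRep N (fun t => B (p t) (q t)) (cauchyProd B x y) := by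
  obtain ⟨c, rfl, hc⟩ := hx
  obtain ⟨d, rfl, hd⟩ := hy
  obtain ⟨e, he, he'⟩ := exists_cauchyProd_finsupp B c d
  refine ⟨e, funext he, fun m hm => ?_⟩
  rw [he']
  refine sum_congr rfl fun p hp => ?_
  rw [HasAntidiagonal.mem_antidiagonal] at hp
  rw [hc _ (by omega), hd _ (by omega)]

theorem le_of_mem_antidiagonalTuple {n m : ℕ} {c : Fin n → ℕ}
    (hc : c ∈ Finset.Nat.antidiagonalTuple n m) (a : Fin n) : c a ≤ m := by
  rw [Finset.Nat.mem_antidiagonalTuple] at hc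
  rw [← hc]
  exact single_le_sum (fun _ _ => Nat.zero_le _) (mem_univ a)

theorem IsRep.multilinear {n : ℕ} (f : MultilinearMap k (fun _ : Fin n => V) W)
    {p : Fin n → k → V} {x : Fin n → ℕ → V} (h : ∀ a, IsRep N (p a) (x a)) :
    IsRep N (fun t => f fun a => p a t) (seriesExt f x) := by
  classical
  choose c hp hc using h
  refine ⟨∑ r ∈ Fintype.piFinset fun a => (c a).support,
    Finsupp.single (∑ a, r a) (f fun a => c a (r a)), ?_, fun m hm => ?_⟩
  · ext t
    have hp' : ∀ a t, p a t = ∑ i ∈ (c a).support, t ^ i • c a i := fun a t => by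
      rw [← hp]; rfl
    simp only [hp', map_sum, Finset.sum_apply, polyEval_single]
    rw [MultilinearMap.map_sum_finset]
    refine sum_congr rfl fun r _ => ?_
    rw [MultilinearMap.map_smul_univ, prod_pow_eq_pow_sum]
  · rw [Finsupp.finsetSum_apply]
    have e1 : ∀ r ∈ Fintype.piFinset fun a => (c a).support,
        Finsupp.single (∑ a, r a) (f fun a => c a (r a)) m
          = if ∑ a, r a = m then f fun a => c a (r a) else 0 := by
      intro r _
      rw [Finsupp.single_apply]
    rw [sum_congr rfl e1, ← sum_filter]
    have e2 : seriesExt f x m = ∑ r ∈ Finset.Nat.antidiagonalTuple n m, f fun a => c a (r a) := by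
      refine sum_congr rfl fun r hr => ?_
      congr 1
      funext a
      rw [hc a _ ((le_of_mem_antidiagonalTuple hr a).trans hm)]
    rw [e2]
    refine sum_subset (fun r hr => ?_) fun r hr hr' => ?_
    · rw [mem_filter] at hr
      exact Finset.Nat.mem_antidiagonalTuple.2 hr.2
    · rw [mem_filter, not_and'] at hr'
      have := hr' (Finset.Nat.mem_antidiagonalTuple.1 hr)
      rw [Fintype.mem_piFinset, not_forall] at this
      obtain ⟨a, ha⟩ := this
      rw [Finsupp.notMem_support_iff] at ha
      exact f.map_coord_zero a ha

end Representation

/-- Truncated double series: the terms outside the triangle vanish, so it may be enlarged to a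
rectangle, over which sums factor. -/
theorem sum_antidiagonal_eq_sum_range {M : Type*} [AddCommMonoid M] (E : ℕ → ℕ → M) {m n n' : ℕ}
    (hn : m ≤ n) (hn' : m ≤ n') (hE : ∀ p q, m ≤ p + q → E p q = 0) :
    ∑ j ∈ range m, ∑ p ∈ antidiagonal j, E p.1 p.2 = ∑ p ∈ range n, ∑ q ∈ range n', E p q := by
  rw [← sum_product', ← sum_filter_of_ne (p := fun x : ℕ × ℕ => x.1 + x.2 < m)]
  · rw [← sum_fiberwise_of_maps_to (t := range m) (g := fun x : ℕ × ℕ => x.1 + x.2)]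
    · refine sum_congr rfl fun j hj => sum_congr ?_ fun _ _ => rfl
      ext ⟨p, q⟩
      simp only [HasAntidiagonal.mem_antidiagonal, mem_filter, mem_product, mem_range] at hj ⊢
      omega
    · intro x hx
      exact mem_range.2 (mem_filter.1 hx).2
  · intro x _ hx
    by_contra h
    exact hx (hE _ _ (not_lt.1 h))

/-! ### Orders of vanishing of products of series. -/

section CauchyProduct

variable {k V W U : Type*} [Field k] [AddCommGroup V] [Module k V] [AddCommGroup W] [Module k W]
  [AddCommGroup U] [Module k U] (B : V →ₗ[k] W →ₗ[k] U)

theorem cauchyProd_eq_zero {x : ℕ → V} {y : ℕ → W} {a b : ℕ} (hx : ∀ j < a, x j = 0)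
    (hy : ∀ j < b, y j = 0) {m : ℕ} (hm : m < a + b) : cauchyProd B x y m = 0 := by
  refine sum_eq_zero fun p hp => ?_
  rw [HasAntidiagonal.mem_antidiagonal] at hp
  rcases lt_or_ge p.1 a with h | h
  · rw [hx _ h, map_zero, LinearMap.zero_apply]
  · rw [hy p.2 (by omega), map_zero]

/-- In the absence of constant terms, the coefficient of ħ^m involves only coefficients of index
below m. All inductions on the order in ħ rest on this. -/
theorem cauchyProd_congr {x x' : ℕ → V} {y y' : ℕ → W} (hx0 : x 0 = 0) (hx0' : x' 0 = 0)
    (hy0 : y 0 = 0) (hy0' : y' 0 = 0) {m : ℕ} (hx : ∀ j < m, x j = x' j)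
    (hy : ∀ j < m, y j = y' j) {j : ℕ} (hj : j ≤ m) :
    cauchyProd B x y j = cauchyProd B x' y' j := by
  refine sum_congr rfl fun p hp => ?_
  rw [HasAntidiagonal.mem_antidiagonal] at hp
  rcases Nat.eq_zero_or_pos p.1 with h | h
  · rw [h, hx0, hx0', map_zero, LinearMap.zero_apply, LinearMap.zero_apply]
  rcases Nat.eq_zero_or_pos p.2 with h' | h'
  · rw [h', hy0, hy0', map_zero, map_zero]
  rw [hx _ (by omega), hy _ (by omega)]

end CauchyProduct

theorem IsRep.units_smul {k V : Type*} [Field k] [AddCommGroup V] [Module k V] {N : ℕ} {p : k → V}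
    {x : ℕ → V} (hx : IsRep N p x) (e : ℤˣ) : IsRep N (fun t => e • p t) (e • x) := by
  rcases Int.units_eq_one_or e with rfl | rfl
  · simpa using hx
  · convert hx.smul (-1 : k) using 2 <;> simp

/-! ### The Lie algebra of series and its curvature. -/

namespace DGLA

variable {k V : Type*} [Field k] [AddCommGroup V] [Module k V] (L : DGLA k V)

/-- The bracket of series, as a bilinear map. -/
def ad : (ℕ → V) →ₗ[k] (ℕ → V) →ₗ[k] ℕ → V :=
  LinearMap.mk₂ k L.hBracket
    (fun x x' y => by ext m; simp [hBracket, sum_add_distrib])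
    (fun c x y => by ext m; simp [hBracket, smul_sum])
    (fun x y y' => by ext m; simp [hBracket, sum_add_distrib])
    (fun c x y => by ext m; simp [hBracket, smul_sum])

theorem ad_def (x y : ℕ → V) : L.ad x y = cauchyProd L.bracket x y := rfl

theorem hBracket_eq (x y : ℕ → V) : L.hBracket x y = L.ad x y := rfl

/-- The differential of series, as a linear map. -/
def dS : (ℕ → V) →ₗ[k] ℕ → V where
  toFun := L.hD
  map_add' x y := by ext m; simp [hD]
  map_smul' c x := by ext m; simp [hD]

@[simp]
theorem dS_apply (x : ℕ → V) (m : ℕ) : L.dS x m = L.d (x m) := rfl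

theorem hD_eq (x : ℕ → V) : L.hD x = L.dS x := rfl

variable {L}

theorem ad_mem {m n : ℤ} {x y : ℕ → V} (hx : x ∈ L.hSeries m) (hy : y ∈ L.hSeries n) :
    L.ad x y ∈ L.hSeries (m + n) :=
  ⟨by simp [ad_def, cauchyProd, hx.1],
    fun j => (L.gr _).sum_mem (t := antidiagonal j) (f := fun p => L.bracket (x p.1) (y p.2))
      fun p _ => L.bracket_mem (hx.2 _) (hy.2 _)⟩

theorem dS_mem {m : ℤ} {x : ℕ → V} (hx : x ∈ L.hSeries m) : L.dS x ∈ L.hSeries (m + 1) :=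
  ⟨by simp [hx.1], fun i => L.d_mem (hx.2 i)⟩

theorem dS_dS (x : ℕ → V) : L.dS (L.dS x) = 0 := by
  ext m; simp [L.d_d]

theorem ad_skew {m n : ℤ} {x y : ℕ → V} (hx : x ∈ L.hSeries m) (hy : y ∈ L.hSeries n) :
    L.ad x y = -((m * n).negOnePow • L.ad y x) := by
  ext j
  rw [Pi.neg_apply, Pi.smul_apply, ad_def, ad_def, cauchyProd, cauchyProd,
    ← Finset.Nat.sum_antidiagonal_swap, smul_sum, ← sum_neg_distrib]
  exact sum_congr rfl fun p _ => L.skew (hx.2 _) (hy.2 _)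

theorem dS_ad {m : ℤ} {x : ℕ → V} (hx : x ∈ L.hSeries m) (y : ℕ → V) :
    L.dS (L.ad x y) = L.ad (L.dS x) y + m.negOnePow • L.ad x (L.dS y) := by
  ext j
  simp only [dS_apply, ad_def, cauchyProd, map_sum, Pi.add_apply, Pi.smul_apply, smul_sum,
    ← sum_add_distrib]
  exact sum_congr rfl fun p _ => L.leibniz (hx.2 _) _

theorem truncation_mem {n : ℤ} {x : ℕ → V} (hx : x ∈ L.hSeries n) (N : ℕ) (t : k) :
    ∑ i ∈ range (N + 1), t ^ i • x i ∈ L.gr n :=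
  (L.gr n).sum_mem fun i _ => (L.gr n).smul_mem _ (hx.2 i)

theorem ad_jacobi [CharZero k] {m n p : ℤ} {u v w : ℕ → V} (hu : u ∈ L.hSeries m) (hv : v ∈ L.hSeries n)
    (hw : w ∈ L.hSeries p) :
    (m * p).negOnePow • L.ad u (L.ad v w) + (n * m).negOnePow • L.ad v (L.ad w u)
      + (p * n).negOnePow • L.ad w (L.ad u v) = 0 := by
  ext N
  have ru := isRep_truncation (k := k) N u
  have rv := isRep_truncation (k := k) N v
  have rw' := isRep_truncation (k := k) N w
  have := (((ru.map₂ (rv.map₂ rw' L.bracket) L.bracket).units_smul (m * p).negOnePow).add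
    ((rv.map₂ (rw'.map₂ ru L.bracket) L.bracket).units_smul (n * m).negOnePow)).add
    ((rw'.map₂ (ru.map₂ rv L.bracket) L.bracket).units_smul (p * n).negOnePow)
  refine IsRep.eq_coeff this ?_ le_rfl
  convert IsRep.zero (k := k) using 2
  exact L.jacobi (truncation_mem hu N _) (truncation_mem hv N _) (truncation_mem hw N _)

/-- This is the Jacobi identity in the form that bracketing with a degree 0 element is a derivation.
-/
theorem ad_ad_zero [CharZero k] {n p : ℤ} {a v w : ℕ → V} (ha : a ∈ L.hSeries 0) (hv : v ∈ L.hSeries n)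
    (hw : w ∈ L.hSeries p) : L.ad a (L.ad v w) = L.ad (L.ad a v) w + L.ad v (L.ad a w) := by
  have h := ad_jacobi ha hv hw
  have h1 : L.ad w a = -L.ad a w := by
    simpa using ad_skew hw ha
  have h2 := ad_skew hw (ad_mem ha hv)
  rw [h1, h2] at h
  simp only [zero_mul, mul_zero, Int.negOnePow_zero, one_smul, map_neg, zero_add, smul_neg] at h
  rw [← sub_eq_zero, ← h]
  rcases Int.units_eq_one_or (p * n).negOnePow with e | e
  · rw [e]; simp only [one_smul]; abel
  · rw [e]; simp only [Units.neg_smul, one_smul]; abel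

theorem ad_comm_one {x y : ℕ → V} (hx : x ∈ L.hSeries 1) (hy : y ∈ L.hSeries 1) :
    L.ad x y = L.ad y x := by
  simpa using ad_skew hx hy

theorem ad_anticomm_zero {n : ℤ} {x y : ℕ → V} (hx : x ∈ L.hSeries n) (hy : y ∈ L.hSeries 0) :
    L.ad x y = -L.ad y x := by
  simpa using ad_skew hx hy

/-- For odd `x` the three Jacobi terms coincide, so three times the bracket vanishes. -/
theorem ad_self_self [CharZero k] {x : ℕ → V} (hx : x ∈ L.hSeries 1) : L.ad (L.ad x x) x = 0 := by
  have h := ad_jacobi hx hx hx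
  have h3 : (3 : k) • L.ad x (L.ad x x) = 0 := by
    rw [← neg_eq_zero, ← h]
    simp only [mul_one, Int.negOnePow_one, Units.neg_smul, one_smul]
    module
  have h4 : L.ad x (L.ad x x) = 0 := (smul_eq_zero.1 h3).resolve_left (by norm_num)
  have := ad_skew (ad_mem hx hx) hx
  rw [this, h4]
  simp

variable (L)

/-- The curvature `dx + ½[x, x]`. -/
def curv (x : ℕ → V) : ℕ → V := L.dS x + (2⁻¹ : k) • L.ad x x

variable {L}

theorem curv_mem {x : ℕ → V} (hx : x ∈ L.hSeries 1) : L.curv x ∈ L.hSeries 2 :=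
  (L.hSeries 2).add_mem (dS_mem hx) ((L.hSeries 2).smul_mem _ (ad_mem hx hx))

/-- The Bianchi identity. -/
theorem dS_curv [CharZero k] {x : ℕ → V} (hx : x ∈ L.hSeries 1) : L.dS (L.curv x) = L.ad (L.curv x) x := by
  have h1 : L.dS (L.ad x x) = (2 : k) • L.ad (L.dS x) x := by
    rw [dS_ad hx]
    have : L.ad x (L.dS x) = -L.ad (L.dS x) x := by
      have := ad_skew hx (dS_mem hx)
      simpa [Int.negOnePow_even 2 even_two] using this
    rw [this, Int.negOnePow_one]
    simp [two_smul]
  rw [curv, map_add, dS_dS, map_smul, h1, map_add, map_smul, LinearMap.add_apply,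
    LinearMap.smul_apply, ad_self_self hx, smul_smul]
  simp

/-- The quadratic part of the curvature sees only coefficients of index below m, so only the linear
part `d` detects a change at index m. -/
theorem curv_congr {x y : ℕ → V} (hx : x 0 = 0) (hy : y 0 = 0) {m : ℕ}
    (h : ∀ j < m, x j = y j) : L.curv x m - L.curv y m = L.d (x m - y m) := by
  have : L.ad x x m = L.ad y y m := cauchyProd_congr L.bracket hx hy hx hy h h le_rfl
  simp only [curv, Pi.add_apply, Pi.smul_apply, this, dS_apply, map_sub]
  abel

end DGLA

/-- A sequence may be constructed by choosing each term subject to a condition on the earlier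
ones. -/
theorem exists_seq_of_step {X : Type*} [Inhabited X] (R : ℕ → (ℕ → X) → X → Prop)
    (hR : ∀ m x x' y, (∀ j < m, x j = x' j) → R m x y → R m x' y)
    (step : ∀ m x, (∀ j < m, R j x (x j)) → ∃ y, R m x y) : ∃ x, ∀ m, R m x (x m) := by
  classical
  have step' : ∀ m x, ∃ y, (∀ j < m, R j x (x j)) → R m x y := by
    intro m x
    by_cases h : ∀ j < m, R j x (x j)
    · exact (step m x h).imp fun _ hy _ => hy
    · exact ⟨default, fun h' => absurd h' h⟩
  choose φ hφ using step'
  let s : ℕ → ℕ → X := fun m => Nat.rec (fun _ => default) (fun m x => Function.update x m (φ m x)) m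
  have hs : ∀ m, s (m + 1) = Function.update (s m) m (φ m (s m)) := fun m => rfl
  have stable : ∀ j n, s (j + 1 + n) j = s (j + 1) j := by
    intro j n
    induction n with
    | zero => rfl
    | succ n ih =>
      rw [← ih, ← add_assoc, hs, Function.update_of_ne (by omega)]
  have stable' : ∀ m, ∀ j < m, s m j = s (j + 1) j := by
    intro m j hj
    obtain ⟨n, rfl⟩ := Nat.exists_eq_add_of_le hj
    exact stable j n
  refine ⟨fun m => s (m + 1) m, fun m => ?_⟩
  have key : ∀ m, ∀ j < m, R j (s m) (s m j) := by
    intro m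
    induction m with
    | zero => intro j hj; omega
    | succ m ih =>
      intro j hj
      have hag : ∀ i < m, s m i = s (m + 1) i := fun i hi => by
        rw [hs, Function.update_of_ne (by omega)]
      rcases Nat.lt_succ_iff_lt_or_eq.1 hj with h | rfl
      · rw [← hag j h]
        exact hR j _ _ _ (fun i hi => hag i (by omega)) (ih j h)
      · have : s (j + 1) j = φ j (s j) := by rw [hs, Function.update_self]
        rw [this]
        exact hR j _ _ _ hag (hφ j (s j) ih)
  exact hR m _ _ _ (fun j hj => stable' (m + 1) j (by omega)) (key (m + 1) m (by omega))

/-! ### Paths of series with coefficients polynomial in t. -/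

section PolynomialPaths

variable {k V W U : Type*} [Field k] [AddCommGroup V] [Module k V] [AddCommGroup W] [Module k W]
  [AddCommGroup U] [Module k U]

theorem HasEuler.apply_zero {p q : k → V} (h : HasEuler p q) : q 0 = 0 := by
  obtain ⟨c, -, rfl⟩ := h
  rw [polyEval_zero_right, eulerCoeff_apply]
  simp

theorem IsPolyFun.map₂ {p : k → V} {q : k → W} (hp : IsPolyFun p) (hq : IsPolyFun q)
    (B : V →ₗ[k] W →ₗ[k] U) : IsPolyFun fun t => B (p t) (q t) :=
  let ⟨_, h⟩ := hp.exists_hasEuler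
  let ⟨_, h'⟩ := hq.exists_hasEuler
  (h.map₂ h' B).isPolyFun

theorem IsPolyFun.smul {p : k → V} (hp : IsPolyFun p) (a : k) : IsPolyFun fun t => a • p t :=
  let ⟨_, h⟩ := hp.exists_hasEuler
  (h.smul a).isPolyFun

theorem IsPolyFun.sub {p q : k → V} (hp : IsPolyFun p) (hq : IsPolyFun q) :
    IsPolyFun fun t => p t - q t :=
  let ⟨_, h⟩ := hp.exists_hasEuler
  let ⟨_, h'⟩ := hq.exists_hasEuler
  (h.sub h').isPolyFun

theorem IsPolyFun.sum {ι : Type*} {s : Finset ι} {p : ι → k → V} (h : ∀ i ∈ s, IsPolyFun (p i)) :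
    IsPolyFun fun t => ∑ i ∈ s, p i t := by
  have h' : ∀ i, ∃ q, i ∈ s → HasEuler (p i) q := by
    intro i
    by_cases hi : i ∈ s
    · exact (h i hi).exists_hasEuler.imp fun _ hq _ => hq
    · exact ⟨0, fun h => absurd h hi⟩
  choose q hq using h'
  exact (HasEuler.sum hq).isPolyFun

theorem IsPolyFun.zero : IsPolyFun fun _ : k => (0 : V) :=
  (HasEuler.const 0).isPolyFun

/-- `q = t dp/dt` for paths of series, coefficient by coefficient. -/
def HasEulerS (p q : k → ℕ → V) : Prop := ∀ m, HasEuler (fun t => p t m) fun t => q t m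

theorem HasEulerS.add {p q p' q' : k → ℕ → V} (h : HasEulerS p q) (h' : HasEulerS p' q') :
    HasEulerS (fun t => p t + p' t) fun t => q t + q' t := fun m => (h m).add (h' m)

theorem HasEulerS.sub {p q p' q' : k → ℕ → V} (h : HasEulerS p q) (h' : HasEulerS p' q') :
    HasEulerS (fun t => p t - p' t) fun t => q t - q' t := fun m => (h m).sub (h' m)

theorem HasEulerS.smul {p q : k → ℕ → V} (h : HasEulerS p q) (a : k) :
    HasEulerS (fun t => a • p t) fun t => a • q t := fun m => (h m).smul a

theorem HasEulerS.const (x : ℕ → V) : HasEulerS (fun _ : k => x) fun _ => 0 :=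
  fun m => HasEuler.const (x m)

theorem HasEulerS.id_smul (x : ℕ → V) : HasEulerS (fun t : k => t • x) fun t => t • x :=
  fun m => HasEuler.id_smul (x m)

theorem HasEulerS.cauchyProd {p q : k → ℕ → V} {p' q' : k → ℕ → W} (h : HasEulerS p q)
    (h' : HasEulerS p' q') (B : V →ₗ[k] W →ₗ[k] U) :
    HasEulerS (fun t => cauchyProd B (p t) (p' t))
      fun t => cauchyProd B (q t) (p' t) + cauchyProd B (p t) (q' t) := by
  intro m
  refine (HasEuler.sum fun c _ => (h c.1).map₂ (h' c.2) B).congr (fun t => rfl) fun t => ?_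
  rw [sum_add_distrib]
  rfl

end PolynomialPaths

/-! ### The terms of the gauge action and of the differential of the exponential map. -/

namespace DGLA

variable {k V : Type*} [Field k] [AddCommGroup V] [Module k V] {L : DGLA k V}

theorem HasEulerS_ad {p q p' q' : k → ℕ → V} (h : HasEulerS p q) (h' : HasEulerS p' q') :
    HasEulerS (fun t => L.ad (p t) (p' t)) fun t => L.ad (q t) (p' t) + L.ad (p t) (q' t) :=
  h.cauchyProd h' L.bracket

theorem HasEulerS_dS {p q : k → ℕ → V} (h : HasEulerS p q) :
    HasEulerS (fun t => L.dS (p t)) fun t => L.dS (q t) := fun m => (h m).map L.d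

variable (L)

/-- The affine action of `α` on the components of `exp(α) · x`: for `n = 0` it is
`y ↦ [α, y] - dα`, for `n > 0` it is `y ↦ [α, y]`. -/
def affineAd (n : ℕ) (α y : ℕ → V) : ℕ → V := L.ad α y - if n = 0 then L.dS α else 0

/-- The terms of the series defining `exp(α) · x`. -/
def gaugeTerm (α x : ℕ → V) : ℕ → ℕ → V
  | 0 => x
  | n + 1 => ((n : k) + 1)⁻¹ • L.affineAd n α (gaugeTerm α x n)

/-- The terms `(ad α)^p a / (p + 1)!` of the differential of the exponential map. -/
def dexpTerm (α a : ℕ → V) : ℕ → ℕ → V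
  | 0 => a
  | p + 1 => ((p : k) + 2)⁻¹ • L.ad α (dexpTerm α a p)

/-- The differential `∑ (ad α)^p a / (p + 1)!` of the exponential map. -/
def dexp (α a : ℕ → V) : ℕ → V := fun m => ∑ p ∈ range m, L.dexpTerm α a p m

variable {L}

theorem affineAd_mem (n : ℕ) {α y : ℕ → V} (hα : α ∈ L.hSeries 0) (hy : y ∈ L.hSeries 1) :
    L.affineAd n α y ∈ L.hSeries 1 := by
  refine (L.hSeries 1).sub_mem (by simpa using ad_mem hα hy) ?_
  split_ifs
  · simpa using dS_mem hα
  · exact (L.hSeries 1).zero_mem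

theorem gaugeTerm_mem {α x : ℕ → V} (hα : α ∈ L.hSeries 0) (hx : x ∈ L.hSeries 1) (n : ℕ) :
    L.gaugeTerm α x n ∈ L.hSeries 1 := by
  induction n with
  | zero => exact hx
  | succ n ih => exact (L.hSeries 1).smul_mem _ (affineAd_mem n hα ih)

theorem dexpTerm_mem {α a : ℕ → V} (hα : α ∈ L.hSeries 0) (ha : a ∈ L.hSeries 0) (p : ℕ) :
    L.dexpTerm α a p ∈ L.hSeries 0 := by
  induction p with
  | zero => exact ha
  | succ p ih => exact (L.hSeries 0).smul_mem _ (by simpa using ad_mem hα ih)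

theorem affineAd_eq_zero {α y : ℕ → V} {n a b : ℕ} (hα : ∀ j < a, α j = 0) (hy : ∀ j < b, y j = 0)
    {m : ℕ} (hm : m < a + b) (hn : n ≠ 0 ∨ m < a) : L.affineAd n α y m = 0 := by
  rw [affineAd, Pi.sub_apply, ad_def, cauchyProd_eq_zero L.bracket hα hy hm]
  split_ifs with h
  · rw [dS_apply, hα m (hn.resolve_left (not_not.2 h)), map_zero, sub_zero]
  · simp

/-- Each step of the recursion brings in another factor `α`, which raises the order in ħ by at least
one. -/
theorem gaugeTerm_eq_zero {α x : ℕ → V} (hα : α 0 = 0) {n m : ℕ} (hm : m < n) :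
    L.gaugeTerm α x n m = 0 := by
  induction n generalizing m with
  | zero => omega
  | succ n ih =>
    rw [gaugeTerm, Pi.smul_apply, affineAd_eq_zero (a := 1) (b := n) (by simpa using hα)
      (fun j hj => ih hj) (by omega) (by omega), smul_zero]

theorem dexpTerm_eq_zero {α a : ℕ → V} (hα : α 0 = 0) {M : ℕ} (ha : ∀ j < M, a j = 0) {p m : ℕ}
    (hm : m < M + p) : L.dexpTerm α a p m = 0 := by
  induction p generalizing m with
  | zero => exact ha m hm
  | succ p ih =>
    rw [dexpTerm, Pi.smul_apply, ad_def, cauchyProd_eq_zero (a := 1) (b := M + p) L.bracket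
      (by simpa using hα) (fun j hj => ih hj) (by omega), smul_zero]

theorem gaugeTerm_succ_eq (α x : ℕ → V) (n : ℕ) :
    L.gaugeTerm α x (n + 1) =
      ((Nat.factorial (n + 1) : k))⁻¹ • (L.hBracket α)^[n] (L.hBracket α x - L.hD α) := by
  induction n with
  | zero => simp [gaugeTerm, affineAd, hBracket_eq, hD_eq]
  | succ n ih =>
    rw [gaugeTerm, ih, Function.iterate_succ_apply', affineAd, if_neg n.succ_ne_zero, sub_zero,
      map_smul, smul_smul, hBracket_eq, Nat.factorial_succ (n + 1)]
    congr 1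
    push_cast
    rw [mul_inv]

theorem gaugeAct_eq_sum {α x : ℕ → V} (hα : α 0 = 0) {m N : ℕ} (hN : m ≤ N) :
    L.gaugeAct α x m = ∑ n ∈ range (N + 1), L.gaugeTerm α x n m := by
  rw [sum_range_succ', gaugeAct, add_comm]
  congr 1
  rw [← sum_subset (range_subset_range.2 hN)]
  · exact sum_congr rfl fun n _ => by rw [gaugeTerm_succ_eq]; rfl
  · intro n _ hn
    exact gaugeTerm_eq_zero hα (by simpa using hn)

theorem gaugeAct_mem {α x : ℕ → V} (hα : α ∈ L.hSeries 0) (hx : x ∈ L.hSeries 1) :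
    L.gaugeAct α x ∈ L.hSeries 1 := by
  constructor
  · simp [gaugeAct, hx.1]
  · intro m
    rw [gaugeAct_eq_sum hα.1 le_rfl]
    exact (L.gr 1).sum_mem fun n _ => (gaugeTerm_mem hα hx n).2 m

theorem gaugeAct_zero (x : ℕ → V) : L.gaugeAct 0 x = x := by
  have h0 : ∀ n, (L.hBracket 0)^[n] 0 = (0 : ℕ → V) := by
    intro n
    induction n with
    | zero => rfl
    | succ n ih => rw [Function.iterate_succ_apply', ih, hBracket_eq, map_zero]
  have h1 : L.hBracket 0 x - L.hD 0 = 0 := by rw [hBracket_eq, hD_eq]; simp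
  ext m
  simp [gaugeAct, h1, h0]

theorem gaugeTerm_zero_coeff {α x : ℕ → V} (hα : α 0 = 0) (hx : x 0 = 0) (n : ℕ) :
    L.gaugeTerm α x n 0 = 0 := by
  rcases n with _ | n
  · exact hx
  · exact gaugeTerm_eq_zero hα n.succ_pos

theorem affineAd_congr (n : ℕ) {α α' x x' : ℕ → V} (hα : α 0 = 0) (hα' : α' 0 = 0) (hx : x 0 = 0)
    (hx' : x' 0 = 0) {m : ℕ} (hαα' : ∀ j < m, α j = α' j) (hxx' : ∀ j < m, x j = x' j)
    {j : ℕ} (hj : j ≤ m) :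
    L.affineAd n α x j = L.affineAd n α' x' j - if n = 0 then L.d (α j - α' j) else 0 := by
  rw [affineAd, affineAd, Pi.sub_apply, Pi.sub_apply, ad_def, ad_def,
    cauchyProd_congr L.bracket hα hα' hx hx' hαα' hxx' hj]
  split_ifs
  · simp
  · simp

/-- Perturbing `α` and `x` from order m on affects the coefficient m only through the linear terms x
- dα; every other term is a bracket of series without constant term. -/
theorem gaugeAct_congr {α α' x x' : ℕ → V} (hα : α 0 = 0) (hα' : α' 0 = 0) (hx : x 0 = 0)
    (hx' : x' 0 = 0) {m : ℕ} (hαα' : ∀ j < m, α j = α' j) (hxx' : ∀ j < m, x j = x' j) :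
    L.gaugeAct α x m = L.gaugeAct α' x' m + (x m - x' m) - L.d (α m - α' m) := by
  have key : ∀ n, ∀ j < m, L.gaugeTerm α x n j = L.gaugeTerm α' x' n j := by
    intro n
    induction n with
    | zero => exact hxx'
    | succ n ih =>
      intro j hj
      rw [gaugeTerm, gaugeTerm, Pi.smul_apply, Pi.smul_apply, affineAd_congr n hα hα'
        (gaugeTerm_zero_coeff hα hx n) (gaugeTerm_zero_coeff hα' hx' n) hαα' ih hj.le,
        hαα' j hj]
      simp
  have key' : ∀ n, L.gaugeTerm α x (n + 1) m = L.gaugeTerm α' x' (n + 1) m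
      - if n = 0 then L.d (α m - α' m) else 0 := by
    intro n
    rw [gaugeTerm, gaugeTerm, Pi.smul_apply, Pi.smul_apply, affineAd_congr n hα hα'
        (gaugeTerm_zero_coeff hα hx n) (gaugeTerm_zero_coeff hα' hx' n) hαα' (key n) le_rfl]
    split_ifs with h
    · simp [h]
    · simp
  rw [gaugeAct_eq_sum hα m.le_succ, gaugeAct_eq_sum hα' m.le_succ, sum_range_succ',
    sum_range_succ' _ (m + 1)]
  simp only [key', sum_sub_distrib]
  simp only [gaugeTerm, sum_ite_eq', mem_range, Nat.succ_pos, if_true]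
  abel

theorem gaugeAct_congr_lt {α α' x x' : ℕ → V} (hα : α 0 = 0) (hα' : α' 0 = 0) (hx : x 0 = 0)
    (hx' : x' 0 = 0) {m : ℕ} (hαα' : ∀ j < m, α j = α' j) (hxx' : ∀ j < m, x j = x' j)
    {j : ℕ} (hj : j < m) : L.gaugeAct α x j = L.gaugeAct α' x' j := by
  rw [gaugeAct_congr hα hα' hx hx' (m := j) (fun i hi => hαα' i (hi.trans hj))
    (fun i hi => hxx' i (hi.trans hj)), hαα' j hj, hxx' j hj]
  simp

theorem dexpTerm_zero_right (α : ℕ → V) (p : ℕ) : L.dexpTerm α 0 p = 0 := by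
  induction p with
  | zero => rfl
  | succ p ih => rw [dexpTerm, ih, map_zero, smul_zero]

theorem ad_self [CharZero k] {α : ℕ → V} (hα : α ∈ L.hSeries 0) : L.ad α α = 0 := by
  have h : L.ad α α = -L.ad α α := ad_anticomm_zero hα hα
  have h2 : (2 : k) • L.ad α α = 0 := by
    rw [two_smul]
    nth_rewrite 1 [h]
    exact neg_add_cancel _
  exact (smul_eq_zero.1 h2).resolve_left two_ne_zero

theorem dexpTerm_of_ad_eq_zero {α a : ℕ → V} (h : L.ad α a = 0) (p : ℕ) :
    L.dexpTerm α a (p + 1) = 0 := by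
  induction p with
  | zero => rw [dexpTerm, dexpTerm, h, smul_zero]
  | succ p ih => rw [dexpTerm, ih, map_zero, smul_zero]

/-- Each coefficient of the terms after the first involves only strictly lower coefficients. This
makes `dexp α a = b` recursively solvable for `a`. -/
theorem dexpTerm_congr {α α' a a' : ℕ → V} (hα : α 0 = 0) (hα' : α' 0 = 0) (ha : a 0 = 0)
    (ha' : a' 0 = 0) {m : ℕ} (hαα' : ∀ j < m, α j = α' j) (haa' : ∀ j < m, a j = a' j) (p : ℕ) :
    (∀ j < m, L.dexpTerm α a p j = L.dexpTerm α' a' p j) ∧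
      L.dexpTerm α a (p + 1) m = L.dexpTerm α' a' (p + 1) m := by
  have h0 : ∀ {α a : ℕ → V}, α 0 = 0 → a 0 = 0 → ∀ p, L.dexpTerm α a p 0 = 0 :=
    fun hα ha p => dexpTerm_eq_zero hα (M := 1) (by simpa using ha) (by omega)
  have key : ∀ p, (∀ j < m, L.dexpTerm α a p j = L.dexpTerm α' a' p j) → ∀ j ≤ m,
      L.dexpTerm α a (p + 1) j = L.dexpTerm α' a' (p + 1) j := by
    intro p hp j hj
    rw [dexpTerm, dexpTerm, Pi.smul_apply, Pi.smul_apply, ad_def, ad_def,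
      cauchyProd_congr L.bracket hα hα' (h0 hα ha p) (h0 hα' ha' p) hαα' hp hj]
  have key' : ∀ p, ∀ j < m, L.dexpTerm α a p j = L.dexpTerm α' a' p j := by
    intro p
    induction p with
    | zero => exact haa'
    | succ p ih => exact fun j hj => key p ih j hj.le
  exact ⟨key' p, key p (key' p) m le_rfl⟩

/-! ### The differential of the exponential map -/

/-- Both `[α, -]` and `d` are derivations; for `n = 0` the expansion of d[α, c] supplies the
inhomogeneous terms. -/
theorem ad_affineAd [CharZero k] (n : ℕ) {α c y : ℕ → V} (hα : α ∈ L.hSeries 0)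
    (hc : c ∈ L.hSeries 0) (hy : y ∈ L.hSeries 1) :
    L.ad α (L.affineAd n c y) = L.affineAd n (L.ad α c) y + L.ad c (L.affineAd n α y) := by
  have h := ad_ad_zero hα hc hy
  simp only [affineAd, map_sub]
  split_ifs
  · have h1 := dS_ad hα c
    have h2 : L.ad (L.dS α) c = -L.ad c (L.dS α) := ad_anticomm_zero (dS_mem hα) hc
    rw [h, h1, h2]
    simp only [Int.negOnePow_zero, one_smul]
    abel
  · simp [h]

theorem affineAd_smul_left (n : ℕ) (a : k) (α y : ℕ → V) :
    L.affineAd n (a • α) y = a • L.affineAd n α y := by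
  simp only [affineAd, map_smul, LinearMap.smul_apply, smul_sub]
  split_ifs <;> simp

/-- The Leibniz rule differentiates one of the nested factors `α`. Commuting the outer factors past
it with `ad_affineAd` collects the result into terms of `dexp` acting on terms of the gauge series.
-/
theorem hasEulerS_gaugeTerm [CharZero k] {α a : k → ℕ → V} (h : HasEulerS α a)
    (hα : ∀ t, α t ∈ L.hSeries 0) (ha : ∀ t, a t ∈ L.hSeries 0) {x : ℕ → V}
    (hx : x ∈ L.hSeries 1) (n : ℕ) :
    HasEulerS (fun t => L.gaugeTerm (α t) x (n + 1)) fun t => ∑ p ∈ antidiagonal n,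
      L.affineAd p.2 (L.dexpTerm (α t) (a t) p.1) (L.gaugeTerm (α t) x p.2) := by
  induction n with
  | zero =>
    have h1 := (HasEulerS_ad (L := L) h (HasEulerS.const x)).sub (HasEulerS_dS (L := L) h)
    simpa [gaugeTerm, affineAd, dexpTerm] using h1
  | succ n ih =>
    have h1 := (HasEulerS_ad (L := L) h ih).smul (((n + 1 : ℕ) : k) + 1)⁻¹
    convert h1 using 2 with t t
    · simp [gaugeTerm, affineAd]
    · have hne : (((n + 1 : ℕ) : k) + 1) ≠ 0 := by exact_mod_cast (n + 1).succ_ne_zero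
      rw [eq_inv_smul_iff₀ hne]
      set E : ℕ → ℕ → ℕ → V := fun p q =>
        L.affineAd q (L.dexpTerm (α t) (a t) p) (L.gaugeTerm (α t) x q) with hE
      -- The weights p + 2 and q + 1 undo the denominators in the recursions for `dexpTerm` and
      -- `gaugeTerm`.
      have e0 : ∀ p q, L.ad (α t) (E p q) = ((p : k) + 2) • E (p + 1) q
          + ((q : k) + 1) • E p (q + 1) := by
        intro p q
        have hp : (p : k) + 2 ≠ 0 := by exact_mod_cast (p + 1).succ_ne_zero
        have hq : (q : k) + 1 ≠ 0 := by exact_mod_cast q.succ_ne_zero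
        simp only [hE]
        rw [ad_affineAd q (hα t) (dexpTerm_mem (hα t) (ha t) p) (gaugeTerm_mem (hα t) hx q),
          dexpTerm, affineAd_smul_left, smul_inv_smul₀ hp]
        congr 1
        rw [gaugeTerm]
        conv_rhs => rw [affineAd, if_neg q.succ_ne_zero, sub_zero, map_smul, smul_inv_smul₀ hq]
      have e1 : L.ad (a t) (L.gaugeTerm (α t) x (n + 1)) = E 0 (n + 1) := by
        simp [hE, affineAd, dexpTerm]
      -- On the antidiagonal p + q = n + 1, the factor n + 2 splits as (p + 1) + q; the two sums
      -- match the two terms of `e0` after index shifts.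
      have e2 : (((n + 1 : ℕ) : k) + 1) • ∑ p ∈ antidiagonal (n + 1), E p.1 p.2
          = ∑ p ∈ antidiagonal (n + 1), ((p.1 : k) + 1) • E p.1 p.2
            + ∑ p ∈ antidiagonal (n + 1), (p.2 : k) • E p.1 p.2 := by
        rw [smul_sum, ← sum_add_distrib]
        refine sum_congr rfl fun p hp => ?_
        rw [HasAntidiagonal.mem_antidiagonal] at hp
        rw [← add_smul, ← hp]
        congr 1
        push_cast
        ring
      rw [e1, map_sum]
      rw [sum_congr rfl fun p (_ : p ∈ antidiagonal n) => e0 p.1 p.2]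
      change (((n + 1 : ℕ) : k) + 1) • ∑ p ∈ antidiagonal (n + 1), E p.1 p.2 = _
      rw [e2, Finset.Nat.sum_antidiagonal_succ, Finset.Nat.sum_antidiagonal_succ'
        (f := fun p => (p.2 : k) • E p.1 p.2), sum_add_distrib]
      simp only [Nat.cast_zero, zero_add, one_smul, zero_smul, Nat.cast_add, Nat.cast_one,
        add_assoc, one_add_one_eq_two]

end DGLA

/-! ### Integral curves of the infinitesimal gauge action. -/

namespace DGLA

variable {k V : Type*} [Field k] [AddCommGroup V] [Module k V] {L : DGLA k V}

theorem dexp_eq_sum {α a : ℕ → V} (hα : α 0 = 0) (ha : a 0 = 0) {j m : ℕ} (hj : j ≤ m) :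
    L.dexp α a j = ∑ p ∈ range m, L.dexpTerm α a p j := by
  refine sum_subset (range_subset_range.2 hj) fun p _ hp => ?_
  exact dexpTerm_eq_zero hα (M := 1) (by simpa using ha) (by simp at hp; omega)

theorem dexp_eq_add {α a : ℕ → V} (hα : α 0 = 0) (ha : a 0 = 0) (m : ℕ) :
    L.dexp α a m = a m + ∑ p ∈ range m, L.dexpTerm α a (p + 1) m := by
  rw [dexp_eq_sum hα ha m.le_succ, sum_range_succ', add_comm]
  rfl

variable (L) in
/-- The path `y` of series is an integral curve of the infinitesimal gauge action of the path `b`: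
`t dy/dt = [b, y] - db`. -/
def IsGaugePath (b y : k → ℕ → V) : Prop :=
  HasEulerS y fun t => L.ad (b t) (y t) - L.dS (b t)

/-- The derivative of `exp(α(t)) · x`. -/
theorem isGaugePath_gaugeAct [CharZero k] {α a b : k → ℕ → V} (h : HasEulerS α a)
    (hα : ∀ t, α t ∈ L.hSeries 0) (ha : ∀ t, a t ∈ L.hSeries 0)
    (hb : ∀ t, L.dexp (α t) (a t) = b t) {x : ℕ → V} (hx : x ∈ L.hSeries 1) :
    L.IsGaugePath b fun t => L.gaugeAct (α t) x := by
  intro m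
  have h1 : HasEuler (fun t => ∑ n ∈ range m, L.gaugeTerm (α t) x (n + 1) m + x m) fun t =>
      (∑ n ∈ range m, (∑ p ∈ antidiagonal n, L.affineAd p.2 (L.dexpTerm (α t) (a t) p.1)
        (L.gaugeTerm (α t) x p.2)) m) + 0 :=
    (HasEuler.sum fun n _ => hasEulerS_gaugeTerm h hα ha hx n m).add (HasEuler.const (x m))
  refine h1.congr (fun t => ?_) fun t => ?_
  · exact (gaugeAct_eq_sum (hα t).1 le_rfl).trans (sum_range_succ' _ _)
  · rw [add_zero]
    simp only [Finset.sum_apply]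
    set E : ℕ → ℕ → ℕ → V := fun p q =>
        L.affineAd q (L.dexpTerm (α t) (a t) p) (L.gaugeTerm (α t) x q) with hE
    have hc : ∀ p, ∀ j < p + 1, L.dexpTerm (α t) (a t) p j = 0 := fun p j hj =>
      dexpTerm_eq_zero (hα t).1 (M := 1) (by simpa using (ha t).1) (by omega)
    -- `E p q` has order at least p + q + 1, so the triangular sum is rectangular at ħ^m.
    have e1 := sum_antidiagonal_eq_sum_range (fun p q => E p q m) (m := m) (n := m) (n' := m + 1)
      le_rfl m.le_succ (fun p q hpq => affineAd_eq_zero (a := p + 1) (b := q) (hc p)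
        (fun j hj => gaugeTerm_eq_zero (hα t).1 hj) (by omega) (by omega))
    change _ = ∑ j ∈ range m, ∑ p ∈ antidiagonal j, E p.1 p.2 m
    rw [e1]
    -- Only `q = 0` carries the inhomogeneous term of the affine action.
    have e2 : ∀ p, ∑ q ∈ range (m + 1), E p q m =
        L.ad (L.dexpTerm (α t) (a t) p) (∑ q ∈ range (m + 1), L.gaugeTerm (α t) x q) m
          - L.d (L.dexpTerm (α t) (a t) p m) := by
      intro p
      rw [map_sum, Finset.sum_apply, sum_range_succ', sum_range_succ' _ m, add_sub_assoc]
      simp [hE, affineAd]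
    simp only [e2, sum_sub_distrib]
    rw [← map_sum, ← dexp_eq_sum (hα t).1 (ha t).1 le_rfl, hb, ← Finset.sum_apply,
      ← LinearMap.sum_apply, ← map_sum]
    change L.ad (b t) (L.gaugeAct (α t) x) m - L.d (b t m) = _
    congr 1
    rw [ad_def, ad_def]
    refine sum_congr rfl fun p hp => ?_
    rw [HasAntidiagonal.mem_antidiagonal] at hp
    have hp1 : p.1 ≤ m := by omega
    have hp2 : p.2 ≤ m := by omega
    rw [← hb, dexp_eq_sum (hα t).1 (ha t).1 hp1, gaugeAct_eq_sum (hα t).1 hp2]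
    simp only [Finset.sum_apply]

/-- As `[α, α] = 0`, only the first term of `dexp` survives along the ray t ↦ tα. -/
theorem isGaugePath_exp [CharZero k] {α x : ℕ → V} (hα : α ∈ L.hSeries 0) (hx : x ∈ L.hSeries 1) :
    L.IsGaugePath (fun t => t • α) fun t => L.gaugeAct (t • α) x := by
  have hm : ∀ t : k, t • α ∈ L.hSeries 0 := fun t => (L.hSeries 0).smul_mem t hα
  refine isGaugePath_gaugeAct (HasEulerS.id_smul α) hm hm (fun t => ?_) hx
  ext m
  rw [dexp_eq_add (hm t).1 (hm t).1]
  simp [dexpTerm_of_ad_eq_zero (ad_self (hm t))]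

/-- Uniqueness for linear differential equations `t du/dt = [b, u]`. -/
theorem eq_const_of_hasEulerS_ad [CharZero k] {b u : k → ℕ → V} (h : HasEulerS u fun t => L.ad (b t) (u t))
    (hb : ∀ t, b t 0 = 0) {m : ℕ} (h0 : ∀ j < m, u 0 j = 0) (t : k) :
    (∀ j < m, u t j = 0) ∧ u t m = u 0 m := by
  -- Since `b` has no constant term, the first possibly nonzero coefficient of `u` has derivative
  -- zero.
  have step : ∀ m, (∀ t, ∀ j < m, u t j = 0) → ∀ t, u t m = u 0 m := by
    intro m hm t
    exact ((h m).congr (fun _ => rfl) fun t => (cauchyProd_eq_zero (a := 1) (b := m) L.bracket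
      (by simpa using hb t) (hm t) (by omega)).symm).eq_const t
  have key : ∀ j ≤ m, ∀ t, ∀ i < j, u t i = 0 := by
    intro j
    induction j with
    | zero => intro _ t i hi; omega
    | succ j ih =>
      intro hj t i hi
      rcases Nat.lt_succ_iff_lt_or_eq.1 hi with h' | rfl
      · exact ih (by omega) t i h'
      · rw [step i (ih (by omega)) t, h0 i (by omega)]
  exact ⟨key m le_rfl t, step m (key m le_rfl) t⟩

/-- The equation is affine in `y`, so the difference of two solutions satisfies the homogeneous
equation with initial value 0. -/
theorem IsGaugePath.unique [CharZero k] {b y z : k → ℕ → V} (hy : L.IsGaugePath b y) (hz : L.IsGaugePath b z)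
    (hb : ∀ t, b t 0 = 0) (h0 : y 0 = z 0) : y = z := by
  have h : HasEulerS (fun t => y t - z t) fun t => L.ad (b t) (y t - z t) := by
    have h1 := HasEulerS.sub hy hz
    simpa only [map_sub, sub_sub_sub_cancel_right] using h1
  ext t m
  have := (eq_const_of_hasEulerS_ad h hb (m := m) (fun j _ => by simp [h0]) t).2
  simp only [h0, sub_self, Pi.sub_apply] at this
  exact sub_eq_zero.1 this

theorem isPolyFun_dexpTerm {α a : k → ℕ → V} (hα : ∀ m, IsPolyFun fun t => α t m)
    (ha : ∀ m, IsPolyFun fun t => a t m) (p m : ℕ) :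
    IsPolyFun fun t => L.dexpTerm (α t) (a t) p m := by
  induction p generalizing m with
  | zero => exact ha m
  | succ p ih =>
    exact IsPolyFun.smul (IsPolyFun.sum (s := antidiagonal m)
      (p := fun c t => L.bracket (α t c.1) (L.dexpTerm (α t) (a t) p c.2))
      fun c _ => (hα c.1).map₂ (ih c.2) L.bracket) _

/-- Every path `b` in the Lie algebra is the logarithmic derivative of a path `exp(α(t))`. -/
theorem exists_dexp_eq [CharZero k] {b : k → ℕ → V} (hb : ∀ t, b t ∈ L.hSeries 0) (hb0 : b 0 = 0)
    (hp : ∀ m, IsPolyFun fun t => b t m) {α₀ : ℕ → V} (hα₀ : α₀ ∈ L.hSeries 0) :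
    ∃ α a : k → ℕ → V, HasEulerS α a ∧ α 0 = α₀ ∧ (∀ t, α t ∈ L.hSeries 0) ∧
      (∀ t, a t ∈ L.hSeries 0) ∧ ∀ t, L.dexp (α t) (a t) = b t := by
  -- Truncation below index m, so that the condition `R m` refers only to terms already chosen.
  let lo : ℕ → (ℕ → k → V) → k → ℕ → V := fun m x t j => if j < m then x j t else 0
  let R : ℕ → (ℕ → (k → V) × (k → V)) → (k → V) × (k → V) → Prop := fun m x y =>
    HasEuler y.1 y.2 ∧ y.1 0 = α₀ m ∧ (∀ t, y.1 t ∈ L.gr 0) ∧ (∀ t, y.2 t ∈ L.gr 0) ∧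
      y.2 = fun t => b t m - ∑ p ∈ range m,
        L.dexpTerm (lo m (fun j => (x j).1) t) (lo m (fun j => (x j).2) t) (p + 1) m
  have : Inhabited ((k → V) × (k → V)) := ⟨0⟩
  obtain ⟨x, hx⟩ := exists_seq_of_step R (by
    intro m x x' y hxx' h
    have e : ∀ t, lo m (fun j => (x j).1) t = lo m (fun j => (x' j).1) t ∧
        lo m (fun j => (x j).2) t = lo m (fun j => (x' j).2) t := by
      intro t
      constructor
      all_goals
        ext j
        simp only [lo]
        split_ifs with hj
        · rw [hxx' j hj]
        · rfl
    obtain ⟨h1, h2, h3, h4, h5⟩ := h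
    refine ⟨h1, h2, h3, h4, ?_⟩
    rw [h5]
    funext t
    rw [(e t).1, (e t).2]) (by
    intro m x hx
    set A : k → ℕ → V := lo m fun j => (x j).1 with hA
    set C : k → ℕ → V := lo m fun j => (x j).2 with hC
    have hA0 : ∀ t, A t 0 = 0 := by
      intro t
      simp only [hA, lo]
      split_ifs with h
      · obtain ⟨h1, h2, -, -, h5⟩ := hx 0 h
        have : (x 0).2 = fun _ => 0 := by
          rw [h5]
          funext t
          simp [(hb t).1]
        rw [this] at h1
        rw [h1.eq_const t, h2, hα₀.1]
      · rfl
    have hC0 : ∀ t, C t 0 = 0 := by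
      intro t
      simp only [hC, lo]
      split_ifs with h
      · obtain ⟨-, -, -, -, h5⟩ := hx 0 h
        rw [h5]
        simp [(hb t).1]
      · rfl
    have hAm : ∀ t, A t ∈ L.hSeries 0 := fun t => ⟨hA0 t, fun j => by
      simp only [hA, lo]
      split_ifs with h
      · exact (hx j h).2.2.1 t
      · exact (L.gr 0).zero_mem⟩
    have hCm : ∀ t, C t ∈ L.hSeries 0 := fun t => ⟨hC0 t, fun j => by
      simp only [hC, lo]
      split_ifs with h
      · exact (hx j h).2.2.2.1 t
      · exact (L.gr 0).zero_mem⟩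
    have hAp : ∀ j, IsPolyFun fun t => A t j := by
      intro j
      simp only [hA, lo]
      split_ifs with h
      · exact (hx j h).1.isPolyFun
      · exact IsPolyFun.zero
    have hCp : ∀ j, IsPolyFun fun t => C t j := by
      intro j
      simp only [hC, lo]
      split_ifs with h
      · exact (hx j h).1.isPolyFun_right
      · exact IsPolyFun.zero
    have hC00 : C 0 = 0 := by
      ext j
      simp only [hC, lo]
      split_ifs with h
      · exact (hx j h).1.apply_zero
      · rfl
    -- The coefficient m of `dexp α a` is a_m plus an expression in lower coefficients, so the
    -- equation determines a_m. Then α_m is a primitive of a_m, which exists because a_m vanishes at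
    -- t = 0.
    let q : k → V := fun t => b t m - ∑ p ∈ range m, L.dexpTerm (A t) (C t) (p + 1) m
    have hqp : IsPolyFun q := (hp m).sub (IsPolyFun.sum fun p _ => isPolyFun_dexpTerm hAp hCp _ _)
    have hq0 : q 0 = 0 := by
      simp [q, hb0, hC00, dexpTerm_zero_right]
    have hqm : ∀ t, q t ∈ L.gr 0 := fun t => (L.gr 0).sub_mem ((hb t).2 m)
      ((L.gr 0).sum_mem fun p _ => (dexpTerm_mem (hAm t) (hCm t) _).2 m)
    obtain ⟨P, hP, hP0⟩ := hqp.exists_antiderivative hq0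
    have hP' : HasEuler (fun t => P t + α₀ m) q :=
      (hP.add (HasEuler.const (α₀ m))).congr (fun _ => rfl) fun t => (add_zero _).symm
    refine ⟨(fun t => P t + α₀ m, q), hP', by simp [hP0], ?_, hqm, rfl⟩
    exact hP'.mem_of_mem _ (by simpa [hP0] using hα₀.2 m) hqm)
  refine ⟨fun t j => (x j).1 t, fun t j => (x j).2 t, fun m => (hx m).1, ?_, ?_⟩
  · ext m
    exact (hx m).2.1
  have ha0 : ∀ t, (x 0).2 t = 0 := fun t => by rw [(hx 0).2.2.2.2]; simp [(hb t).1]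
  have hα0 : ∀ t, (x 0).1 t = 0 := fun t => by
    rw [((hx 0).1.congr (fun _ => rfl) fun t => (ha0 t).symm).eq_const t, (hx 0).2.1, hα₀.1]
  refine ⟨fun t => ⟨hα0 t, fun j => (hx j).2.2.1 t⟩, fun t => ⟨ha0 t, fun j => (hx j).2.2.2.1 t⟩,
    fun t => ?_⟩
  ext m
  rw [dexp_eq_add (hα0 t) (ha0 t)]
  beta_reduce
  rw [congrFun (hx m).2.2.2.2 t, sub_add, sub_eq_self, sub_eq_zero]
  refine sum_congr rfl fun p _ => (dexpTerm_congr ?_ ?_ ?_ ?_ ?_ ?_ p).2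
  · simp only [lo]; split_ifs; exacts [hα0 t, rfl]
  · exact hα0 t
  · simp only [lo]; split_ifs; exacts [ha0 t, rfl]
  · exact ha0 t
  · intro j hj; exact if_pos hj
  · intro j hj; exact if_pos hj

/-- Endpoints of integral curves of the infinitesimal gauge action differ by a gauge
transformation. -/
theorem exists_gauge_transport [CharZero k] {b : k → ℕ → V} (hb : ∀ t, b t ∈ L.hSeries 0) (hb0 : b 0 = 0)
    (hp : ∀ m, IsPolyFun fun t => b t m) {α₀ : ℕ → V} (hα₀ : α₀ ∈ L.hSeries 0) :
    ∃ α₁ ∈ L.hSeries 0,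
      (∀ (y : k → ℕ → V) (x : ℕ → V), L.IsGaugePath b y → x ∈ L.hSeries 1 →
        y 0 = L.gaugeAct α₀ x → y 1 = L.gaugeAct α₁ x) ∧
      ∀ (m : ℕ) (c : V), (∀ j < m, ∀ t, b t j = 0) → (∀ t, b t m = t • c) →
        (∀ j < m, α₁ j = α₀ j) ∧ α₁ m = α₀ m + c := by
  obtain ⟨α, a, h, h0, hα, ha, hab⟩ := exists_dexp_eq hb hb0 hp hα₀
  -- The endpoint of `α` was built from `b` and `α₀` alone, so the same `α₁` serves every integral
  -- curve.
  refine ⟨α 1, hα 1, fun y x hy hx hyx => ?_, fun m c hm hc => ?_⟩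
  · rw [hy.unique (isGaugePath_gaugeAct h hα ha hab hx) (fun t => (hb t).1) (by rw [hyx, h0])]
  · have hD : ∀ t j, b t j = a t j + ∑ p ∈ range j, L.dexpTerm (α t) (a t) (p + 1) j :=
      fun t j => by rw [← hab, dexp_eq_add (hα t).1 (ha t).1]
    -- The corrections in `dexp` have higher order than `a`, so `a` and `b` have the same leading
    -- coefficient.
    have key : ∀ j ≤ m, ∀ t, (∀ i < j, a t i = 0) → b t j = a t j := by
      intro j hj t h
      rw [hD, sum_eq_zero, add_zero]
      intro p _
      exact dexpTerm_eq_zero (hα t).1 h (by omega)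
    have ha0 : ∀ j ≤ m, ∀ t, ∀ i < j, a t i = 0 := by
      intro j
      induction j with
      | zero => intro _ t i hi; omega
      | succ j ih =>
        intro hj t i hi
        rcases Nat.lt_succ_iff_lt_or_eq.1 hi with h' | rfl
        · exact ih (by omega) t i h'
        · rw [← key i (by omega) t (ih (by omega) t), hm i (by omega)]
    constructor
    · intro j hj
      rw [← h0]
      exact ((h j).congr (fun _ => rfl) fun t => (ha0 m le_rfl t j hj).symm).eq_const 1
    · have h1 := HasEuler.unique ((h m).congr (fun _ => rfl) fun t =>
        show t • c = a t m by rw [← hc, key m le_rfl t (ha0 m le_rfl t)])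
        (((HasEuler.const (α₀ m)).add (HasEuler.id_smul c)).congr (fun _ => rfl)
          fun t => (zero_add (t • c)).symm) (by simp [h0])
      have := congrFun h1 1
      simpa using this

/-! ### The curvature along integral curves -/

/-- The curvature is gauge covariant: in its derivative the terms containing `db` cancel and the
derivation rule assembles the rest. -/
theorem IsGaugePath.hasEulerS_curv [CharZero k] {b y : k → ℕ → V} (h : L.IsGaugePath b y)
    (hb : ∀ t, b t ∈ L.hSeries 0) (hy : ∀ t, y t ∈ L.hSeries 1) :
    HasEulerS (fun t => L.curv (y t)) fun t => L.ad (b t) (L.curv (y t)) := by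
  have h1 := (HasEulerS_dS (L := L) h).add ((HasEulerS_ad (L := L) h h).smul (2⁻¹ : k))
  have e : (fun t => L.ad (b t) (L.curv (y t))) = fun t =>
      L.dS (L.ad (b t) (y t) - L.dS (b t)) + (2⁻¹ : k) • (L.ad (L.ad (b t) (y t) - L.dS (b t)) (y t)
        + L.ad (y t) (L.ad (b t) (y t) - L.dS (b t))) := by
    funext t
    have hby : L.ad (b t) (y t) ∈ L.hSeries 1 := by simpa using ad_mem (hb t) (hy t)
    have hdb : L.dS (b t) ∈ L.hSeries 1 := by simpa using dS_mem (hb t)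
    rw [ad_comm_one (hy t) ((L.hSeries 1).sub_mem hby hdb), ← two_smul k, inv_smul_smul₀ two_ne_zero,
      curv, map_add, map_smul, ad_ad_zero (hb t) (hy t) (hy t), ad_comm_one (hy t) hby,
      ← two_smul k, inv_smul_smul₀ two_ne_zero, map_sub, dS_dS, dS_ad (hb t)]
    simp
    abel
  rw [e]
  exact h1

theorem curv_gaugeAct [CharZero k] {α x : ℕ → V} (hα : α ∈ L.hSeries 0) (hx : x ∈ L.hSeries 1) {m : ℕ}
    (h : ∀ j < m, L.curv x j = 0) :
    (∀ j < m, L.curv (L.gaugeAct α x) j = 0) ∧ L.curv (L.gaugeAct α x) m = L.curv x m := by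
  have hm : ∀ t : k, t • α ∈ L.hSeries 0 := fun t => (L.hSeries 0).smul_mem t hα
  have h1 := (isGaugePath_exp hα hx).hasEulerS_curv hm fun t => gaugeAct_mem (hm t) hx
  have h2 := eq_const_of_hasEulerS_ad h1 (fun t => (hm t).1) (m := m)
    (by simpa [gaugeAct_zero] using h) 1
  simpa [gaugeAct_zero] using h2

theorem gaugeAct_mem_MC [CharZero k] {α x : ℕ → V} (hα : α ∈ L.hSeries 0) (hx : x ∈ L.MC) :
    L.gaugeAct α x ∈ L.MC := by
  refine ⟨gaugeAct_mem hα hx.1, ?_⟩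
  ext m
  have h : L.curv x = 0 := hx.2
  have := (curv_gaugeAct hα hx.1 (m := m) (by simp [h])).2
  rw [h] at this
  exact this

/-! ### Gauge equivalence is an equivalence relation -/

theorem isPolyFun_smul (α : ℕ → V) (m : ℕ) : IsPolyFun fun t : k => (t • α) m :=
  (HasEuler.id_smul (α m)).isPolyFun

/-- This replaces the Baker–Campbell–Hausdorff product: t ↦ exp(tα) · (exp(β) · x) is an integral
curve starting at exp(β) · x. The last clause makes iterated corrections converge coefficientwise.
-/
theorem exists_gaugeAct_gaugeAct [CharZero k] {α β : ℕ → V} (hα : α ∈ L.hSeries 0) (hβ : β ∈ L.hSeries 0) :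
    ∃ γ ∈ L.hSeries 0, (∀ x ∈ L.hSeries 1, L.gaugeAct α (L.gaugeAct β x) = L.gaugeAct γ x) ∧
      ∀ m, (∀ j < m, α j = 0) → ∀ j < m, γ j = β j := by
  obtain ⟨γ, hγ, h1, h2⟩ := exists_gauge_transport (L := L) (b := fun t => t • α)
    (fun t => (L.hSeries 0).smul_mem t hα) (zero_smul k α) (isPolyFun_smul α) hβ
  refine ⟨γ, hγ, fun x hx => ?_, fun m hm => ?_⟩
  · have := h1 _ x (isGaugePath_exp hα (gaugeAct_mem hβ hx)) hx (by simp [gaugeAct_zero])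
    simpa using this
  · exact (h2 m (α m) (fun j hj t => by simp [hm j hj]) fun t => rfl).1

/-- The curves exp(-tα) · (exp(α) · x) and exp((1 - t)α) · x have the same generator and starting
point; they are compared at t = 1. -/
theorem exists_gaugeAct_symm [CharZero k] {α x : ℕ → V} (hα : α ∈ L.hSeries 0) (hx : x ∈ L.hSeries 1) :
    ∃ β ∈ L.hSeries 0, x = L.gaugeAct β (L.gaugeAct α x) := by
  have hn := (L.hSeries 0).neg_mem hα
  refine ⟨-α, hn, ?_⟩
  have hm : ∀ t : k, t • -α ∈ L.hSeries 0 := fun t => (L.hSeries 0).smul_mem t hn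
  have h1 := isGaugePath_exp hn (gaugeAct_mem hα hx)
  have h2 : L.IsGaugePath (fun t => t • -α) fun t => L.gaugeAct (α + t • -α) x := by
    have he : HasEulerS (fun t : k => α + t • -α) fun t => t • -α := by
      simpa using (HasEulerS.const (k := k) α).add (HasEulerS.id_smul (-α))
    have hα' : ∀ t : k, α + t • -α ∈ L.hSeries 0 := fun t => (L.hSeries 0).add_mem hα (hm t)
    refine isGaugePath_gaugeAct he hα' hm (fun t => ?_) hx
    ext m
    rw [dexp_eq_add (hα' t).1 (hm t).1]
    simp [dexpTerm_of_ad_eq_zero (L := L) (α := α + -(t • α)) (a := -(t • α))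
      (by simp [ad_self hα])]
  have := congrFun (h1.unique h2 (fun t => (hm t).1) (by simp [gaugeAct_zero])) 1
  simpa [gaugeAct_zero] using this.symm

theorem gaugeRel_equivalence [CharZero k] : Equivalence L.GaugeRel := by
  refine ⟨fun s => ⟨0, (L.hSeries 0).zero_mem, (gaugeAct_zero _).symm⟩, ?_, ?_⟩
  · rintro s t ⟨α, hα, h⟩
    obtain ⟨β, hβ, h'⟩ := exists_gaugeAct_symm hα s.2.1
    exact ⟨β, hβ, by rw [h, ← h']⟩
  · rintro s t u ⟨α, hα, h⟩ ⟨β, hβ, h'⟩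
    obtain ⟨γ, hγ, hc, -⟩ := exists_gaugeAct_gaugeAct hβ hα
    exact ⟨γ, hγ, by rw [h', h, hc s s.2.1]⟩

end DGLA

/-! ### Counting unshuffles -/

/-- An unshuffle is determined by the image of its first block, since both blocks are listed in
increasing order. -/
theorem card_unshuffles_subset {n i : ℕ} (h : i ≤ n) (T : Finset (Fin n)) :
    #{σ ∈ unshuffles n i | ∀ p : Fin n, (p : ℕ) < i → σ p ∈ T} = (#T).choose i := by
  obtain ⟨j, rfl⟩ := Nat.exists_eq_add_of_le h
  rw [← card_powersetCard]
  have himg : ∀ σ : Equiv.Perm (Fin (i + j)),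
      #(univ.image fun p : Fin i => σ (Fin.castAdd j p)) = i := fun σ => by
    rw [card_image_of_injective (f := fun p : Fin i => σ (Fin.castAdd j p)) _
      (σ.injective.comp (Fin.castAdd_injective i j)), card_univ, Fintype.card_fin]
  have hmono : ∀ σ ∈ unshuffles (i + j) i, (StrictMono fun p : Fin i => σ (Fin.castAdd j p)) ∧
      StrictMono fun p : Fin j => σ (Fin.natAdd i p) := by
    intro σ hσ
    simp only [unshuffles, mem_filter, mem_univ, true_and] at hσ
    refine ⟨fun p q hpq => hσ _ _ (Fin.lt_def.2 (Fin.lt_def.1 hpq)) (Or.inl (by simp)),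
      fun p q hpq => hσ _ _ (by simpa using hpq) (Or.inr (by simp))⟩
  refine card_bij (fun σ _ => univ.image fun p : Fin i => σ (Fin.castAdd j p)) ?_ ?_ ?_
  · intro σ hσ
    rw [mem_powersetCard]
    refine ⟨fun x hx => ?_, himg σ⟩
    obtain ⟨p, -, rfl⟩ := mem_image.1 hx
    exact (mem_filter.1 hσ).2 _ (by simp)
  · intro σ hσ τ hτ hστ
    have hσ' := hmono σ (mem_filter.1 hσ).1
    have hτ' := hmono τ (mem_filter.1 hτ).1
    set S := univ.image fun p : Fin i => σ (Fin.castAdd j p) with hS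
    have hSc : #Sᶜ = j := by
      rw [card_compl, himg σ, Fintype.card_fin]
      omega
    have e1 : (fun p : Fin i => σ (Fin.castAdd j p)) = S.orderEmbOfFin (himg σ) :=
      orderEmbOfFin_unique _ (fun p => mem_image_of_mem _ (mem_univ p)) hσ'.1
    have e2 : (fun p : Fin i => τ (Fin.castAdd j p)) = S.orderEmbOfFin (himg σ) :=
      orderEmbOfFin_unique _ (fun p => hστ ▸ mem_image_of_mem _ (mem_univ p)) hτ'.1
    have hc : ∀ ρ : Equiv.Perm (Fin (i + j)), S = univ.image (fun p : Fin i => ρ (Fin.castAdd j p)) →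
        ∀ p : Fin j, ρ (Fin.natAdd i p) ∈ Sᶜ := by
      intro ρ hρ p
      rw [mem_compl, hρ]
      intro hmem
      obtain ⟨q, -, hq⟩ := mem_image.1 hmem
      have := congrArg Fin.val (ρ.injective hq)
      simp at this
      omega
    have e3 : (fun p : Fin j => σ (Fin.natAdd i p)) = Sᶜ.orderEmbOfFin hSc :=
      orderEmbOfFin_unique _ (hc σ rfl) hσ'.2
    have e4 : (fun p : Fin j => τ (Fin.natAdd i p)) = Sᶜ.orderEmbOfFin hSc :=
      orderEmbOfFin_unique _ (hc τ hστ) hτ'.2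
    ext1 p
    induction p using Fin.addCases with
    | left p => exact congrFun (e1.trans e2.symm) p
    | right p => exact congrFun (e3.trans e4.symm) p
  · intro S hS
    rw [mem_powersetCard] at hS
    have hSc : #Sᶜ = j := by
      rw [card_compl, hS.2, Fintype.card_fin]
      omega
    let σ : Equiv.Perm (Fin (i + j)) := finSumFinEquiv.symm.trans (finSumEquivOfFinset hS.2 hSc)
    have hl : ∀ p : Fin i, σ (Fin.castAdd j p) = S.orderEmbOfFin hS.2 p := fun p => by
      simp [σ]
    have hr : ∀ p : Fin j, σ (Fin.natAdd i p) = Sᶜ.orderEmbOfFin hSc p := fun p => by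
      simp [σ]
    refine ⟨σ, ?_, ?_⟩
    · simp only [unshuffles, mem_filter, mem_univ, true_and]
      constructor
      · intro p q hpq hor
        induction p using Fin.addCases with
        | left p =>
          induction q using Fin.addCases with
          | left q => rw [hl, hl]; exact (S.orderEmbOfFin hS.2).strictMono (Fin.lt_def.2 (Fin.lt_def.1 hpq))
          | right q => simp at hor; omega
        | right p =>
          induction q using Fin.addCases with
          | left q => rw [Fin.lt_def] at hpq; simp at hpq; omega
          | right q => rw [hr, hr]; exact (Sᶜ.orderEmbOfFin hSc).strictMono (by simpa using hpq)
      · intro p hp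
        induction p using Fin.addCases with
        | left p => rw [hl]; exact hS.1 (orderEmbOfFin_mem _ _ _)
        | right p => simp at hp
    · simp only [hl]
      ext x
      rw [← mem_coe (s := S), ← range_orderEmbOfFin S hS.2]
      simp

theorem card_unshuffles {n i : ℕ} (h : i ≤ n) : #(unshuffles n i) = n.choose i := by
  have := card_unshuffles_subset h univ
  rw [filter_true_of_mem (fun _ _ _ _ => mem_univ _)] at this
  simpa using this

/-- The least value must stand at the head of one of the two increasing blocks. -/
theorem symm_zero_of_mem_unshuffles {n i : ℕ} {σ : Equiv.Perm (Fin (n + 1))}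
    (hσ : σ ∈ unshuffles (n + 1) i) : (σ.symm 0 : ℕ) = 0 ∨ (σ.symm 0 : ℕ) = i := by
  simp only [unshuffles, mem_filter, mem_univ, true_and] at hσ
  by_contra! h
  have hσ0 : σ (σ.symm 0) = 0 := σ.apply_symm_apply 0
  rcases lt_or_gt_of_ne h.2 with hlt | hgt
  · have := hσ 0 (σ.symm 0) (Fin.pos_of_ne_zero fun h0 => h.1 (by rw [h0]; rfl)) (Or.inl hlt)
    rw [hσ0] at this
    exact absurd this (Fin.not_lt_zero _)
  · have hi : i < n + 1 := hgt.trans (σ.symm 0).2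
    have := hσ ⟨i, hi⟩ (σ.symm 0) hgt (Or.inr le_rfl)
    rw [hσ0] at this
    exact absurd this (Fin.not_lt_zero _)

/-- When one argument is special and all others are equal, a summand depends only on the block
holding the special one. The two binomial coefficients count the first blocks with and without it.
-/
theorem sum_unshuffles {n i : ℕ} (h : i ≤ n) {M : Type*} [AddCommMonoid M]
    {g : Equiv.Perm (Fin (n + 1)) → M} {x y : M}
    (hx : ∀ σ ∈ unshuffles (n + 1) (i + 1), (σ.symm 0 : ℕ) = 0 → g σ = x)
    (hy : ∀ σ ∈ unshuffles (n + 1) (i + 1), (σ.symm 0 : ℕ) = i + 1 → g σ = y) :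
    ∑ σ ∈ unshuffles (n + 1) (i + 1), g σ = n.choose i • x + n.choose (i + 1) • y := by
  rw [← sum_filter_add_sum_filter_not _ (fun σ => (σ.symm 0 : ℕ) = 0)]
  have h2 : #{σ ∈ unshuffles (n + 1) (i + 1) | ¬(σ.symm 0 : ℕ) = 0} = n.choose (i + 1) := by
    have := card_unshuffles_subset (Nat.succ_le_succ h) (univ.erase (0 : Fin (n + 1)))
    rw [card_erase_of_mem (mem_univ _), card_univ, Fintype.card_fin] at this
    refine Eq.trans ?_ this
    congr 1
    refine filter_congr fun σ hσ => ?_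
    simp only [mem_erase, mem_univ, and_true]
    constructor
    · intro h0 p hp hp0
      have hs := (symm_zero_of_mem_unshuffles hσ).resolve_left h0
      rw [← hp0, σ.symm_apply_apply] at hs
      omega
    · intro hall h0
      exact hall (σ.symm 0) (by omega) (σ.apply_symm_apply 0)
  have h1 : #{σ ∈ unshuffles (n + 1) (i + 1) | (σ.symm 0 : ℕ) = 0} = n.choose i := by
    have := card_filter_add_card_filter_not (s := unshuffles (n + 1) (i + 1))
      (fun σ => (σ.symm 0 : ℕ) = 0)
    rw [h2, card_unshuffles (Nat.succ_le_succ h), Nat.choose_succ_succ] at this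
    exact Nat.add_right_cancel this
  rw [sum_congr rfl (g := fun _ => x) fun σ hσ => hx σ (mem_filter.1 hσ).1 (mem_filter.1 hσ).2,
    sum_congr rfl (g := fun _ => y) fun σ hσ => hy σ (mem_filter.1 hσ).1
      ((symm_zero_of_mem_unshuffles (mem_filter.1 hσ).1).resolve_left (mem_filter.1 hσ).2),
    sum_const, sum_const, h1, h2]

/-! ### Signs -/

theorem skewKoszulSign_eq_prod {n : ℕ} (a : Fin n → ℤ) (σ : Equiv.Perm (Fin n)) :
    skewKoszulSign a σ = ∏ p : Fin n × Fin n with p.1 < p.2 ∧ σ p.2 < σ p.1,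
      -(a (σ p.1) * a (σ p.2)).negOnePow := by
  have h : Equiv.Perm.sign σ = ∏ p : Fin n × Fin n with p.1 < p.2 ∧ σ p.2 < σ p.1, (-1 : ℤˣ) := by
    rw [σ.sign_eq_prod_prod_Iio, prod_filter, ← univ_product_univ, prod_product_right]
    refine prod_congr rfl fun j _ => ?_
    rw [← filter_gt_eq_Iio, prod_filter]
    refine prod_congr rfl fun i _ => ?_
    by_cases hij : i < j
    · rcases lt_or_gt_of_ne (σ.injective.ne hij.ne) with h | h
      · simp [h, h.not_gt, hij]
      · simp [h, h.not_gt, hij]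
    · simp [hij]
  rw [skewKoszulSign, koszulSign, h, ← prod_mul_distrib]
  simp

theorem skewKoszulSign_one {n : ℕ} (σ : Equiv.Perm (Fin n)) :
    skewKoszulSign (fun _ => 1) σ = 1 := by
  rw [skewKoszulSign_eq_prod]
  simp

/-- The family `(u, s, s, …)`. -/
def headTail {X : Type*} (u s : X) (n : ℕ) : Fin n → X := fun p => if (p : ℕ) = 0 then u else s

/-- An inversion of two degree 1 elements contributes +1, and one involving the degree 0 element
contributes -1. The latter are counted by the position to which that element is moved. -/
theorem skewKoszulSign_headTail {n : ℕ} (σ : Equiv.Perm (Fin (n + 1))) :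
    skewKoszulSign (headTail (0 : ℤ) 1 (n + 1)) σ = (-1) ^ (σ.symm 0 : ℕ) := by
  rw [skewKoszulSign_eq_prod]
  have h1 : ∀ p ∈ ({p | p.1 < p.2 ∧ σ p.2 < σ p.1} : Finset (Fin (n + 1) × Fin (n + 1))),
      -(headTail (0 : ℤ) 1 (n + 1) (σ p.1) * headTail (0 : ℤ) 1 (n + 1) (σ p.2)).negOnePow
        = if σ p.2 = 0 then (-1 : ℤˣ) else 1 := by
    intro p hp
    rw [mem_filter] at hp
    have h0 : ((σ p.1 : Fin (n + 1)) : ℕ) ≠ 0 := by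
      have := Fin.lt_def.1 hp.2.2
      omega
    have h2 : σ p.2 = 0 ↔ ((σ p.2 : Fin (n + 1)) : ℕ) = 0 := Fin.ext_iff
    simp only [headTail, if_neg h0, h2]
    split_ifs <;> simp
  rw [prod_congr rfl h1, ← prod_filter, prod_const]
  congr 1
  rw [filter_filter]
  have : ({p | (p.1 < p.2 ∧ σ p.2 < σ p.1) ∧ σ p.2 = 0} : Finset (Fin (n + 1) × Fin (n + 1)))
      = (Iio (σ.symm 0)).map ⟨fun p => (p, σ.symm 0), fun p q h => (Prod.ext_iff.1 h).1⟩ := by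
    ext ⟨p, q⟩
    simp only [mem_filter, mem_univ, true_and, mem_map, mem_Iio]
    constructor
    · rintro ⟨⟨hpq, -⟩, hq⟩
      obtain rfl : q = σ.symm 0 := by rw [← hq, σ.symm_apply_apply]
      exact ⟨p, hpq, rfl⟩
    · rintro ⟨p', hp, h⟩
      obtain ⟨rfl, rfl⟩ := Prod.ext_iff.1 h
      change (p' < σ.symm 0 ∧ σ (σ.symm 0) < σ p') ∧ σ (σ.symm 0) = 0
      rw [σ.apply_symm_apply]
      refine ⟨⟨hp, Fin.pos_of_ne_zero fun h0 => hp.ne ?_⟩, rfl⟩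
      rw [← h0, σ.symm_apply_apply]
  rw [this, card_map, Fin.card_Iio]

theorem headTail_perm {X : Type*} (u s : X) {n : ℕ} (σ : Equiv.Perm (Fin (n + 1)))
    (q : Fin (n + 1)) :
    headTail u s (n + 1) (σ q) = if (q : ℕ) = (σ.symm 0 : ℕ) then u else s := by
  have : ((σ q : Fin (n + 1)) : ℕ) = 0 ↔ (q : ℕ) = (σ.symm 0 : ℕ) := by
    rw [← Fin.ext_iff, Equiv.eq_symm_apply, Fin.ext_iff]
    rfl
  simp only [headTail, this]

theorem cons_const {X : Type*} (u s : X) (n : ℕ) :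
    (Fin.cons u (fun _ => s) : Fin (n + 1) → X) = headTail u s (n + 1) := by
  ext p
  refine Fin.cases ?_ (fun p => ?_) p <;> simp [headTail]

theorem natCast_negOnePow_smul {k M : Type*} [Field k] [AddCommGroup M] [Module k M] (n : ℕ)
    (x : M) : (n : ℤ).negOnePow • x = ((-1 : k) ^ n) • x := by
  rw [Int.negOnePow_def, zpow_natCast]
  induction n with
  | zero => simp
  | succ n ih =>
    rw [pow_succ', pow_succ', mul_smul, mul_smul, ih]
    simp

/-- The family `(u, w, s, s, …)`. -/
def headTail₂ {X : Type*} (u w s : X) (n : ℕ) : Fin n → X :=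
  fun p => if (p : ℕ) = 0 then u else if (p : ℕ) = 1 then w else s

theorem headTail_mem {k V : Type*} [Field k] [AddCommGroup V] [Module k V] {L : DGLA k V} {α s : V} (hα : α ∈ L.gr 0) (hs : s ∈ L.gr 1) {n : ℕ} (i : Fin n) :
    headTail α s n i ∈ L.gr (headTail (0 : ℤ) 1 n i) := by
  simp only [headTail]
  split_ifs
  exacts [hα, hs]

/-! ### The L∞ relations for the arguments (s, …, s) and (α, s, …, s). -/

namespace LInftyMorphism

variable {k V V' : Type*} [Field k] [AddCommGroup V] [Module k V]
    [AddCommGroup V'] [Module k V'] {L : DGLA k V} {L' : DGLA k V'} (F : LInftyMorphism L L')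

/-- The relation for equal arguments of degree `1`. -/
theorem rel_const (m : ℕ) {s : V} (hs : s ∈ L.gr 1) :
    L'.d (F.f (m + 2) fun _ => s)
      + (2⁻¹ : k) • ∑ c ∈ antidiagonal m, ((m + 2).choose (c.1 + 1) : k) •
          L'.bracket (F.f (c.1 + 1) fun _ => s) (F.f (c.2 + 1) fun _ => s)
    = ((-1 : k) ^ (m + 1) * (m + 2 : ℕ)) • F.f (m + 2) (headTail (L.d s) s (m + 2))
      + ((-1 : k) ^ m * (m + 2).choose 2) •
          F.f (m + 1) (headTail (L.bracket s s) s (m + 1)) := by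
  have h := F.rel m (fun _ => 1) (fun _ => s) (fun _ => hs)
  simp only [skewKoszulSign_one, sub_self, sum_const_zero, mul_zero, Int.negOnePow_zero, mul_one,
    one_smul, cons_const, sum_const] at h
  rw [card_unshuffles (by omega), card_unshuffles (by omega)] at h
  have e := fun i : Fin (m + 1) => card_unshuffles (n := m + 2) (i := i + 1) (by omega)
  simp only [e] at h
  rw [Fin.sum_univ_eq_sum_range (fun i => (m + 2).choose (i + 1) •
    L'.bracket (F.f (i + 1) fun _ => s) (F.f (m + 1 - i) fun _ => s))] at h
  rw [Finset.Nat.sum_antidiagonal_eq_sum_range_succ (fun i j => ((m + 2).choose (i + 1) : k) •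
          L'.bracket (F.f (i + 1) fun _ => s) (F.f (j + 1) fun _ => s))]
  have h1 : ((m : ℤ) + 1) = ((m + 1 : ℕ) : ℤ) := by push_cast; rfl
  rw [h1, natCast_negOnePow_smul (k := k), natCast_negOnePow_smul (k := k),
    ← Nat.cast_smul_eq_nsmul k, ← Nat.cast_smul_eq_nsmul k, smul_smul, smul_smul,
    Nat.choose_one_right] at h
  rw [← h]
  congr 2
  refine sum_congr rfl fun i hi => ?_
  have hi' : m + 1 - i = m - i + 1 := by
    have := mem_range.1 hi
    omega
  rw [hi', Nat.cast_smul_eq_nsmul]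

theorem sum_headTail_degree (n : ℕ) : ∑ p, headTail (0 : ℤ) 1 (n + 1) p = n := by
  rw [Fin.sum_univ_succ]
  simp [headTail]

theorem f_headTail_mem {α s : V} (hα : α ∈ L.gr 0) (hs : s ∈ L.gr 1) (n : ℕ) :
    F.f (n + 1) (headTail α s (n + 1)) ∈ L'.gr 0 := by
  have := F.degree (n + 1) _ _ (headTail_mem hα hs)
  rwa [sum_headTail_degree, show (n : ℤ) + (1 - ((n + 1 : ℕ) : ℤ)) = 0 by push_cast; ring] at this

theorem f_const_mem {s : V} (hs : s ∈ L.gr 1) (n : ℕ) : (F.f n fun _ => s) ∈ L'.gr 1 := by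
  have := F.degree n (fun _ => 1) (fun _ => s) fun _ => hs
  rwa [sum_const, card_univ, Fintype.card_fin, nsmul_eq_mul, mul_one, add_sub_cancel] at this

/-- The relation for one argument of degree `0` and equal arguments of degree `1`. -/
theorem rel_headTail [CharZero k] (m : ℕ) {α s : V} (hα : α ∈ L.gr 0) (hs : s ∈ L.gr 1) :
    L'.d (F.f (m + 2) (headTail α s (m + 2)))
      + ∑ c ∈ antidiagonal m, ((-1 : k) ^ c.2 * (m + 1).choose c.1) •
          L'.bracket (F.f (c.1 + 1) (headTail α s (c.1 + 1))) (F.f (c.2 + 1) fun _ => s)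
    = (-1 : k) ^ (m + 1) • (F.f (m + 2) (headTail (L.d α) s (m + 2))
          - ((m + 1 : ℕ) : k) • F.f (m + 2) (headTail₂ (L.d s) α s (m + 2)))
      + (-1 : k) ^ m • (((m + 1 : ℕ) : k) • F.f (m + 1) (headTail (L.bracket α s) s (m + 1))
          + ((m + 1).choose 2 : k) •
              F.f (m + 1) (headTail₂ (L.bracket s s) α s (m + 1))) := by
  have h := F.rel m _ _ (fun i => headTail_mem hα hs i)
  have h1 : ((m : ℤ) + 1) = ((m + 1 : ℕ) : ℤ) := by push_cast; rfl
  rw [h1, natCast_negOnePow_smul (k := k), natCast_negOnePow_smul (k := k)] at h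
  have pos : ∀ σ : Equiv.Perm (Fin (m + 2)), ∀ q : Fin (m + 2),
      headTail α s (m + 2) (σ q) = if (q : ℕ) = (σ.symm 0 : ℕ) then α else s := fun σ q =>
    headTail_perm α s σ q
  have t1 := sum_unshuffles (n := m + 1) (i := 0) (Nat.zero_le _)
    (g := fun σ => skewKoszulSign (headTail (0 : ℤ) 1 (m + 2)) σ • F.f (m + 2)
      (Fin.cons (L.d (headTail α s (m + 2) (σ 0)))
        fun p : Fin (m + 1) => headTail α s (m + 2) (σ p.succ)))
    (x := F.f (m + 2) (headTail (L.d α) s (m + 2)))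
    (y := - F.f (m + 2) (headTail₂ (L.d s) α s (m + 2)))
    (by
      intro σ _ h0
      rw [skewKoszulSign_headTail, h0, pow_zero, one_smul]
      congr 1
      simp only [pos, h0]
      ext p
      refine Fin.cases ?_ (fun p => ?_) p <;> simp [headTail])
    (by
      intro σ _ h0
      rw [skewKoszulSign_headTail, h0, zero_add, pow_one, Units.neg_smul, one_smul]
      congr 2
      simp only [pos, h0]
      ext p
      refine Fin.cases ?_ (fun p => ?_) p <;> simp [headTail₂])
  have t2 := sum_unshuffles (n := m + 1) (i := 1) (by omega)
    (g := fun σ => skewKoszulSign (headTail (0 : ℤ) 1 (m + 2)) σ • F.f (m + 1)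
      (Fin.cons (L.bracket (headTail α s (m + 2) (σ 0)) (headTail α s (m + 2) (σ 1)))
        fun p : Fin m => headTail α s (m + 2) (σ p.succ.succ)))
    (x := F.f (m + 1) (headTail (L.bracket α s) s (m + 1)))
    (y := F.f (m + 1) (headTail₂ (L.bracket s s) α s (m + 1)))
    (by
      intro σ _ h0
      rw [skewKoszulSign_headTail, h0, pow_zero, one_smul]
      congr 1
      simp only [pos, h0]
      ext p
      refine Fin.cases ?_ (fun p => ?_) p <;> simp [headTail])
    (by
      intro σ _ h0
      rw [skewKoszulSign_headTail, h0, show ((-1 : ℤˣ) ^ (1 + 1)) = 1 from rfl, one_smul]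
      congr 1
      simp only [pos, h0]
      ext p
      refine Fin.cases ?_ (fun p => ?_) p <;> simp [headTail₂])
  simp only [zero_add, one_add_one_eq_two] at t1 t2
  rw [t1, t2] at h
  -- When α falls in the second block, skewness of the bracket moves its factor to the front, so
  -- that both classes take the same shape.
  have t3 : ∀ i : Fin (m + 1), ∑ σ ∈ unshuffles (m + 2) (i + 1),
          (skewKoszulSign (headTail (0 : ℤ) 1 (m + 2)) σ *
            (((m - i : ℕ) : ℤ) * ∑ p : Fin (i + 1),
              (headTail (0 : ℤ) 1 (m + 2) (σ (p.castLE (by omega))) - 1)).negOnePow) •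
          L'.bracket (F.f (i + 1) fun p => headTail α s (m + 2) (σ (p.castLE (by omega))))
            (F.f (m + 1 - i) fun p => headTail α s (m + 2) (σ ⟨i + 1 + p, by omega⟩)) =
      (m + 1).choose i • ((-1 : k) ^ (m - i : ℕ) •
          L'.bracket (F.f (i + 1) (headTail α s (i + 1))) (F.f (m + 1 - i) fun _ => s))
      + (m + 1).choose (i + 1) • ((-1 : k) ^ (i : ℕ) • L'.bracket
          (F.f (m + 1 - i) (headTail α s (m + 1 - i))) (F.f (i + 1) fun _ => s)) := by
    intro i
    have posd : ∀ σ : Equiv.Perm (Fin (m + 2)), ∀ q : Fin (m + 2),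
      headTail (0 : ℤ) 1 (m + 2) (σ q) = if (q : ℕ) = (σ.symm 0 : ℕ) then 0 else 1 := fun σ q =>
        headTail_perm 0 1 σ q
    refine sum_unshuffles (n := m + 1) (i := i) (by omega) ?_ ?_
    · intro σ _ h0
      have e1 : ∑ p : Fin (i + 1), (headTail (0 : ℤ) 1 (m + 2) (σ (p.castLE (by omega))) - 1)
          = -1 := by
        rw [Fin.sum_univ_succ]
        simp [posd, h0]
      rw [e1, skewKoszulSign_headTail, h0, pow_zero, one_mul, mul_neg_one, Int.negOnePow_neg,
        natCast_negOnePow_smul (k := k)]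
      simp only [pos, h0]
      congr 4
      ext p
      simp
    · intro σ _ h0
      have e1 : ∑ p : Fin (i + 1), (headTail (0 : ℤ) 1 (m + 2) (σ (p.castLE (by omega))) - 1)
          = 0 := by
        refine sum_eq_zero fun p _ => ?_
        rw [posd, h0, if_neg (by simp; omega), sub_self]
      have e2 : L'.bracket (F.f (i + 1) fun _ => s) (F.f (m + 1 - i) (headTail α s (m + 1 - i)))
          = -L'.bracket (F.f (m + 1 - i) (headTail α s (m + 1 - i))) (F.f (i + 1) fun _ => s) := by
        obtain ⟨j, hj⟩ : ∃ j, m + 1 - i = j + 1 := ⟨m - i, by omega⟩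
        rw [hj]
        simpa using L'.skew (F.f_const_mem hs (i + 1)) (F.f_headTail_mem hα hs j)
      have f1 : (fun p : Fin (i + 1) => headTail α s (m + 2) (σ (p.castLE (by omega))))
          = fun _ => s := by
        ext p
        rw [pos, h0, if_neg (by simp; omega)]
      have f2 : (fun p : Fin (m + 1 - i) => headTail α s (m + 2) (σ ⟨i + 1 + p, by omega⟩))
          = headTail α s (m + 1 - i) := by
        ext p
        rw [pos, h0]
        simp [headTail]
      rw [e1, f1, f2, e2, mul_zero, Int.negOnePow_zero, mul_one, skewKoszulSign_headTail, h0,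
        pow_succ, mul_neg_one, Units.neg_smul, smul_neg, neg_neg, ← natCast_negOnePow_smul,
        Int.negOnePow_def, zpow_natCast]
  rw [sum_congr rfl fun i _ => t3 i] at h
  rw [sum_add_distrib] at h
  rw [Fin.sum_univ_eq_sum_range (fun i => (m + 1).choose i • ((-1 : k) ^ (m - i : ℕ) •
          L'.bracket (F.f (i + 1) (headTail α s (i + 1))) (F.f (m + 1 - i) fun _ => s))),
    Fin.sum_univ_eq_sum_range (fun i => (m + 1).choose (i + 1) • ((-1 : k) ^ (i : ℕ) • L'.bracket
          (F.f (m + 1 - i) (headTail α s (m + 1 - i))) (F.f (i + 1) fun _ => s)))] at h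
  set E : ℕ → ℕ → V' := fun i j => ((-1 : k) ^ j * (m + 1).choose i) •
          L'.bracket (F.f (i + 1) (headTail α s (i + 1))) (F.f (j + 1) fun _ => s) with hE
  -- Both classes give the same sum over the antidiagonal, which absorbs the factor ½ of the
  -- relation.
  have s1 : ∑ i ∈ range (m + 1), (m + 1).choose i • ((-1 : k) ^ (m - i : ℕ) •
          L'.bracket (F.f (i + 1) (headTail α s (i + 1))) (F.f (m + 1 - i) fun _ => s))
      = ∑ c ∈ antidiagonal m, E c.1 c.2 := by
    rw [Finset.Nat.sum_antidiagonal_eq_sum_range_succ E]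
    refine sum_congr rfl fun i hi => ?_
    have hi' : m + 1 - i = m - i + 1 := by
      have := mem_range.1 hi
      omega
    rw [hi', ← Nat.cast_smul_eq_nsmul k, smul_smul, mul_comm]
  have s2 : ∑ i ∈ range (m + 1), (m + 1).choose (i + 1) • ((-1 : k) ^ (i : ℕ) • L'.bracket
          (F.f (m + 1 - i) (headTail α s (m + 1 - i))) (F.f (i + 1) fun _ => s))
      = ∑ c ∈ antidiagonal m, E c.1 c.2 := by
    rw [← Finset.Nat.sum_antidiagonal_swap]
    simp only [Prod.fst_swap, Prod.snd_swap]
    rw [Finset.Nat.sum_antidiagonal_eq_sum_range_succ (fun i j => E j i)]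
    refine sum_congr rfl fun i hi => ?_
    have hi'' := mem_range.1 hi
    have hi' : m + 1 - i = m - i + 1 := by omega
    have hc : (m + 1).choose (i + 1) = (m + 1).choose (m - i) :=
      Nat.choose_symm_of_eq_add (by omega)
    rw [hi', ← Nat.cast_smul_eq_nsmul k, smul_smul, mul_comm, hc]
  rw [s1, s2, ← two_smul k, inv_smul_smul₀ two_ne_zero] at h
  rw [h]
  simp only [Nat.choose_zero_right, Nat.choose_one_right, one_smul, ← Nat.cast_smul_eq_nsmul k,
    smul_neg, Nat.cast_one, sub_eq_add_neg]

end LInftyMorphism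

/-! ### Multilinear maps extended to series. -/

section SeriesExt

variable {k V W : Type*} [Field k] [AddCommGroup V] [Module k V] [AddCommGroup W] [Module k W]

theorem seriesExt_eq_zero {n : ℕ} (f : MultilinearMap k (fun _ : Fin n => V) W) {x : Fin n → ℕ → V}
    (o : Fin n → ℕ) (hx : ∀ a, ∀ j < o a, x a j = 0) {m : ℕ} (hm : m < ∑ a, o a) :
    seriesExt f x m = 0 := by
  refine sum_eq_zero fun c hc => ?_
  rw [Finset.Nat.mem_antidiagonalTuple] at hc
  obtain ⟨a, ha⟩ : ∃ a, c a < o a := by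
    by_contra! h
    exact absurd (sum_le_sum fun a (_ : a ∈ univ) => h a) (by omega)
  exact f.map_coord_zero a (hx a _ ha)

/-- With at least two arguments, none having a constant term, no argument can contribute its
coefficient of index m to ħ^m. -/
theorem seriesExt_congr {n : ℕ} (f : MultilinearMap k (fun _ : Fin (n + 2) => V) W)
    {x y : Fin (n + 2) → ℕ → V} (hx : ∀ a, x a 0 = 0) (hy : ∀ a, y a 0 = 0) {m : ℕ}
    (h : ∀ a, ∀ j < m, x a j = y a j) {j : ℕ} (hj : j ≤ m) :
    seriesExt f x j = seriesExt f y j := by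
  refine sum_congr rfl fun c hc => ?_
  rw [Finset.Nat.mem_antidiagonalTuple] at hc
  by_cases h0 : ∃ a, c a = 0
  · obtain ⟨a, ha⟩ := h0
    rw [f.map_coord_zero a (by rw [ha, hx]), f.map_coord_zero a (by rw [ha, hy])]
  · push Not at h0
    congr 1
    funext a
    refine h a _ ?_
    obtain ⟨b, hb⟩ := exists_ne a
    have h1 : c a + c b ≤ ∑ a, c a := by
      rw [← add_sum_erase _ _ (mem_univ a)]
      exact Nat.add_le_add_left (single_le_sum (f := c) (fun _ _ => Nat.zero_le _)
        (mem_erase.2 ⟨hb, mem_univ b⟩)) _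
    have := h0 b
    omega

theorem seriesExt_one (f : MultilinearMap k (fun _ : Fin 1 => V) W) (x : Fin 1 → ℕ → V) (m : ℕ) :
    seriesExt f x m = f fun a => x a m := by
  rw [seriesExt, Finset.Nat.antidiagonalTuple_one, sum_singleton]
  congr 1
  ext a
  rw [Subsingleton.elim a 0]
  rfl

theorem seriesExt_mem {n : ℕ} {f : MultilinearMap k (fun _ : Fin n => V) W} {x : Fin n → ℕ → V}
    {S : Submodule k W} (h : ∀ c : Fin n → ℕ, (f fun a => x a (c a)) ∈ S) (m : ℕ) :
    seriesExt f x m ∈ S :=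
  S.sum_mem fun c _ => h c

/-- `seriesExt` as a linear map in the first variable. -/
def consExt {n : ℕ} (f : MultilinearMap k (fun _ : Fin (n + 1) => V) W) (x : Fin n → ℕ → V) :
    (ℕ → V) →ₗ[k] ℕ → W where
  toFun u := seriesExt f (Fin.cons u x : Fin (n + 1) → ℕ → V)
  map_add' u v := by
    ext m
    rw [Pi.add_apply, seriesExt, seriesExt, seriesExt, ← sum_add_distrib]
    refine sum_congr rfl fun c _ => ?_
    have e : ∀ u : ℕ → V, (fun p => (Fin.cons u x : Fin (n + 1) → ℕ → V) p (c p))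
        = Fin.cons (u (c 0)) fun p => x p (c p.succ) := by
      intro u; ext p; refine Fin.cases ?_ (fun p => ?_) p <;> simp
    simp only [e, Pi.add_apply, f.cons_add]
  map_smul' a u := by
    ext m
    rw [Pi.smul_apply, seriesExt, seriesExt, smul_sum]
    refine sum_congr rfl fun c _ => ?_
    have e : ∀ u : ℕ → V, (fun p => (Fin.cons u x : Fin (n + 1) → ℕ → V) p (c p))
        = Fin.cons (u (c 0)) fun p => x p (c p.succ) := by
      intro u; ext p; refine Fin.cases ?_ (fun p => ?_) p <;> simp
    simp only [e, Pi.smul_apply, f.cons_smul, RingHom.id_apply]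

theorem consExt_eq_zero {n : ℕ} (f : MultilinearMap k (fun _ : Fin (n + 1) => V) W)
    {x : Fin n → ℕ → V} {u : ℕ → V} (hx : ∀ a, x a 0 = 0) {M : ℕ} (hu : ∀ j < M, u j = 0) {m : ℕ}
    (hm : m < M + n) : consExt f x u m = 0 := by
  refine seriesExt_eq_zero f (Fin.cons M fun _ => 1) (fun a => ?_) (by simpa [Fin.sum_univ_succ])
  refine Fin.cases ?_ (fun a => ?_) a
  · simpa using hu
  · simpa using hx a

theorem cons_eq_headTail {X : Type*} (u s : X) (n : ℕ) :
    (Fin.cons u (fun _ => s) : Fin (n + 1) → X) = headTail u s (n + 1) := cons_const u s n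

theorem cons_headTail {X : Type*} (u w s : X) (n : ℕ) :
    (Fin.cons u (headTail w s n) : Fin (n + 1) → X) = headTail₂ u w s (n + 1) := by
  ext p
  refine Fin.cases ?_ (fun p => ?_) p <;> simp [headTail, headTail₂]

theorem IsRep.multilinear_headTail {N : ℕ} {p q : k → V} {x y : ℕ → V} (hx : IsRep N p x) (hy : IsRep N q y)
    {n : ℕ} (f : MultilinearMap k (fun _ : Fin (n + 1) => V) W) :
    IsRep N (fun t => f (headTail (p t) (q t) (n + 1))) (consExt f (fun _ => y) x) := by
  have h := IsRep.multilinear (N := N) f (p := headTail p q (n + 1))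
    (x := headTail x y (n + 1)) (fun a => by simp only [headTail]; split_ifs; exacts [hx, hy])
  rw [← cons_eq_headTail x] at h
  convert h using 4 with t a
  · simp only [headTail]
    split_ifs <;> rfl
  · rfl

theorem IsRep.multilinear_headTail₂ {N : ℕ} {p r q : k → V} {x z y : ℕ → V} (hx : IsRep N p x)
    (hz : IsRep N r z) (hy : IsRep N q y)
    {n : ℕ} (f : MultilinearMap k (fun _ : Fin (n + 1) => V) W) :
    IsRep N (fun t => f (headTail₂ (p t) (r t) (q t) (n + 1)))
      (consExt f (headTail z y n) x) := by
  have h := IsRep.multilinear (N := N) f (p := headTail₂ p r q (n + 1))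
    (x := headTail₂ x z y (n + 1))
    (fun a => by simp only [headTail₂]; split_ifs; exacts [hx, hz, hy])
  rw [← cons_headTail x] at h
  convert h using 4 with t a
  · simp only [headTail₂]
    split_ifs <;> rfl
  · rfl

theorem HasEulerS.seriesExt {n : ℕ} (f : MultilinearMap k (fun _ : Fin n => V) W)
    {p q : Fin n → k → ℕ → V} (h : ∀ a, HasEulerS (p a) (q a)) :
    HasEulerS (fun t => seriesExt f fun a => p a t)
      fun t => ∑ a, seriesExt f (Function.update (fun b => p b t) a (q a t)) := by
  intro m
  refine (HasEuler.sum fun c _ => HasEuler.multilinear f (p := fun a t => p a t (c a))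
    (q := fun a t => q a t (c a)) fun a => h a (c a)).congr (fun _ => rfl) fun t => ?_
  beta_reduce
  rw [Finset.sum_apply, sum_comm]
  refine sum_congr rfl fun a _ => sum_congr rfl fun c _ => ?_
  congr 1
  ext b
  by_cases hb : b = a
  · subst hb; simp
  · simp [hb]

end SeriesExt

namespace LInftyMorphism

variable {k V V' : Type*} [Field k] [AddCommGroup V] [Module k V]
    [AddCommGroup V'] [Module k V'] {L : DGLA k V} {L' : DGLA k V'} (F : LInftyMorphism L L')

/-! ### The relations for series -/

/-- Elements of degree 1 have trivial skew Koszul signs, so `f_n` is symmetric on them. -/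
theorem seriesExt_perm {n : ℕ} {x : Fin n → ℕ → V} (hx : ∀ a, x a ∈ L.hSeries 1)
    (σ : Equiv.Perm (Fin n)) :
    seriesExt (F.f n) (fun a => x (σ a)) = seriesExt (F.f n) x := by
  ext m
  refine sum_equiv (σ.arrowCongr (Equiv.refl ℕ)) (fun c => ?_) fun c _ => ?_
  · rw [Finset.Nat.mem_antidiagonalTuple, Finset.Nat.mem_antidiagonalTuple]
    simp [Equiv.sum_comp σ.symm c]
  · have := F.skew n (fun _ => 1) (fun a => x a (c (σ.symm a))) (fun a => (hx a).2 _) σ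
    rw [skewKoszulSign_one, one_smul] at this
    simpa using this

theorem rel_const_series [CharZero k] (m : ℕ) {s : ℕ → V} (hs : s ∈ L.hSeries 1) :
    L'.dS (seriesExt (F.f (m + 2)) fun _ => s)
      + (2⁻¹ : k) • ∑ c ∈ antidiagonal m, ((m + 2).choose (c.1 + 1) : k) •
          L'.ad (seriesExt (F.f (c.1 + 1)) fun _ => s) (seriesExt (F.f (c.2 + 1)) fun _ => s)
    = ((-1 : k) ^ (m + 1) * (m + 2 : ℕ)) • consExt (F.f (m + 2)) (fun _ => s) (L.dS s)
      + ((-1 : k) ^ m * (m + 2).choose 2) • consExt (F.f (m + 1)) (fun _ => s) (L.ad s s) := by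
  ext N
  have r := isRep_truncation (k := k) N s
  have rf : ∀ n, IsRep N _ (seriesExt (F.f n) fun _ => s) := fun n =>
    IsRep.multilinear (F.f n) fun _ => r
  refine IsRep.eq_coeff (((rf (m + 2)).map L'.d).add ((IsRep.sum fun c (_ : c ∈ antidiagonal m) =>
    ((rf (c.1 + 1)).map₂ (rf (c.2 + 1)) L'.bracket).smul ((m + 2).choose (c.1 + 1) : k)).smul
      (2⁻¹ : k))) ?_ le_rfl
  convert! (((r.map L.d).multilinear_headTail r (F.f (m + 2))).smul ((-1 : k) ^ (m + 1) * (m + 2 : ℕ))).add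
    (((r.map₂ r L.bracket).multilinear_headTail r (F.f (m + 1))).smul ((-1 : k) ^ m * (m + 2).choose 2)) using 1
  funext t
  exact F.rel_const m (DGLA.truncation_mem hs N t)

theorem rel_headTail_series [CharZero k] (m : ℕ) {α s : ℕ → V} (hα : α ∈ L.hSeries 0)
    (hs : s ∈ L.hSeries 1) :
    L'.dS (consExt (F.f (m + 2)) (fun _ => s) α)
      + ∑ c ∈ antidiagonal m, ((-1 : k) ^ c.2 * (m + 1).choose c.1) •
          L'.ad (consExt (F.f (c.1 + 1)) (fun _ => s) α) (seriesExt (F.f (c.2 + 1)) fun _ => s)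
    = (-1 : k) ^ (m + 1) • (consExt (F.f (m + 2)) (fun _ => s) (L.dS α)
          + (-1 : k) • ((m + 1 : ℕ) : k) • consExt (F.f (m + 2)) (headTail α s (m + 1)) (L.dS s))
      + (-1 : k) ^ m • (((m + 1 : ℕ) : k) • consExt (F.f (m + 1)) (fun _ => s) (L.ad α s)
          + ((m + 1).choose 2 : k) •
              consExt (F.f (m + 1)) (headTail α s m) (L.ad s s)) := by
  ext N
  have r := isRep_truncation (k := k) N s
  have ra := isRep_truncation (k := k) N α
  have rf : ∀ n, IsRep N _ (seriesExt (F.f n) fun _ => s) := fun n =>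
    IsRep.multilinear (F.f n) fun _ => r
  refine IsRep.eq_coeff (((ra.multilinear_headTail r (F.f (m + 2))).map L'.d).add
    (IsRep.sum fun c (_ : c ∈ antidiagonal m) => ((ra.multilinear_headTail r (F.f (c.1 + 1))).map₂
      (rf (c.2 + 1)) L'.bracket).smul ((-1 : k) ^ c.2 * (m + 1).choose c.1))) ?_ le_rfl
  convert! ((((ra.map L.d).multilinear_headTail r (F.f (m + 2))).add ((((r.map L.d).multilinear_headTail₂ ra r
    (F.f (m + 2))).smul ((m + 1 : ℕ) : k)).smul (-1 : k))).smul ((-1 : k) ^ (m + 1))).add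
    (((((ra.map₂ r L.bracket).multilinear_headTail r (F.f (m + 1))).smul ((m + 1 : ℕ) : k)).add
    (((r.map₂ r L.bracket).multilinear_headTail₂ ra r (F.f (m + 1))).smul
      ((m + 1).choose 2 : k))).smul ((-1 : k) ^ m)) using 1
  funext t
  have := F.rel_headTail m (DGLA.truncation_mem hα N t) (DGLA.truncation_mem hs N t)
  rw [sub_eq_add_neg, ← neg_one_smul k (((m + 1 : ℕ) : k) • _)] at this
  exact this

end LInftyMorphism

theorem inv_factorial_mul_choose (k : Type*) [Field k] [CharZero k] {n i j : ℕ} (h : i + j = n) :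
    ((n.factorial : k))⁻¹ * (n.choose i : k) = (i.factorial : k)⁻¹ * (j.factorial : k)⁻¹ := by
  subst h
  have h1 : ((i + j).choose i : k) * i.factorial * j.factorial = (i + j).factorial := by
    rw [Nat.choose_symm_add]
    exact_mod_cast Nat.add_choose_mul_factorial_mul_factorial i j
  have hi : (i.factorial : k) ≠ 0 := by exact_mod_cast i.factorial_ne_zero
  have hj : (j.factorial : k) ≠ 0 := by exact_mod_cast j.factorial_ne_zero
  have hij : ((i + j).factorial : k) ≠ 0 := by exact_mod_cast (i + j).factorial_ne_zero
  field_simp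
  linear_combination h1

theorem inv_factorial_succ_mul (k : Type*) [Field k] [CharZero k] (n : ℕ) :
    (((n + 1).factorial : k))⁻¹ * ((n + 1 : ℕ) : k) = (n.factorial : k)⁻¹ := by
  have hn : (n.factorial : k) ≠ 0 := by exact_mod_cast n.factorial_ne_zero
  have hn' : ((n + 1 : ℕ) : k) ≠ 0 := by exact_mod_cast n.succ_ne_zero
  rw [Nat.factorial_succ, Nat.cast_mul]
  field_simp

theorem inv_factorial_mul_choose_two (k : Type*) [Field k] [CharZero k] (n : ℕ) :
    (((n + 2).factorial : k))⁻¹ * ((n + 2).choose 2 : k) = 2⁻¹ * (n.factorial : k)⁻¹ := by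
  simpa using inv_factorial_mul_choose k (i := 2) (j := n) (n := n + 2) (by omega)

/-! ### The Taylor terms of the map on Maurer–Cartan elements and of its derivative. -/

namespace LInftyMorphism

variable {k V V' : Type*} [Field k] [AddCommGroup V] [Module k V]
    [AddCommGroup V'] [Module k V'] {L : DGLA k V} {L' : DGLA k V'} (F : LInftyMorphism L L')

/-- The term `f_{n+1}(s, …, s) / (n+1)!` of `mcMap`. -/
def mcTerm (n : ℕ) (s : ℕ → V) : ℕ → V' :=
  (((n + 1).factorial : k))⁻¹ • seriesExt (F.f (n + 1)) fun _ => s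

/-- The term `f_{n+1}(u, s, …, s) / n!` of the derivative of `mcMap`. -/
def tangentTerm (n : ℕ) (s u : ℕ → V) : ℕ → V' :=
  ((n.factorial : k))⁻¹ • consExt (F.f (n + 1)) (fun _ => s) u

/-- The term `(-1)^n f_{n+1}(u, s, …, s) / n!`. -/
def signedTerm (n : ℕ) (s u : ℕ → V) : ℕ → V' := (-1 : k) ^ n • F.tangentTerm n s u

/-- The term `f_{n+2}(u, α, s, …, s) / n!`. -/
def tangentTerm₂ (n : ℕ) (α s u : ℕ → V) : ℕ → V' :=
  ((n.factorial : k))⁻¹ • consExt (F.f (n + 2)) (headTail α s (n + 1)) u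

variable {F}

theorem seriesExt_f_one (x : Fin 1 → ℕ → V) (m : ℕ) :
    seriesExt (F.f 1) x m = F.linearPart (x 0 m) := by
  rw [seriesExt_one]
  refine congrArg (F.f 1) (funext fun a => ?_)
  rw [Subsingleton.elim a 0]

theorem tangentTerm_zero_apply (s u : ℕ → V) (m : ℕ) :
    F.tangentTerm 0 s u m = F.linearPart (u m) := by
  rw [tangentTerm, Nat.factorial_zero, Nat.cast_one, inv_one, one_smul]
  exact seriesExt_f_one _ m

theorem mcTerm_zero_apply (s : ℕ → V) (m : ℕ) : F.mcTerm 0 s m = F.linearPart (s m) := by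
  rw [mcTerm, zero_add, Nat.factorial_one, Nat.cast_one, inv_one, one_smul]
  exact seriesExt_f_one _ m

theorem dS_mcTerm_zero (s : ℕ → V) : L'.dS (F.mcTerm 0 s) = F.signedTerm 0 s (L.dS s) := by
  ext m
  rw [DGLA.dS_apply, mcTerm_zero_apply, signedTerm, pow_zero, one_smul, tangentTerm_zero_apply,
    DGLA.dS_apply, linearPart_d]

theorem dS_signedTerm_zero (s α : ℕ → V) :
    L'.dS (F.signedTerm 0 s α) = F.tangentTerm 0 s (L.dS α) := by
  ext m
  rw [DGLA.dS_apply, signedTerm, pow_zero, one_smul, tangentTerm_zero_apply,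
    tangentTerm_zero_apply, DGLA.dS_apply, linearPart_d]

theorem tangentTerm_add (n : ℕ) (s u v : ℕ → V) :
    F.tangentTerm n s (u + v) = F.tangentTerm n s u + F.tangentTerm n s v := by
  simp [tangentTerm]

theorem tangentTerm_smul (n : ℕ) (s : ℕ → V) (a : k) (u : ℕ → V) :
    F.tangentTerm n s (a • u) = a • F.tangentTerm n s u := by
  simp [tangentTerm, smul_comm a]

theorem tangentTerm_zero_right (n : ℕ) (s : ℕ → V) : F.tangentTerm n s 0 = 0 := by
  simp [tangentTerm]

theorem tangentTerm_sub (n : ℕ) (s u v : ℕ → V) :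
    F.tangentTerm n s (u - v) = F.tangentTerm n s u - F.tangentTerm n s v := by
  simp [tangentTerm, smul_sub]

theorem signedTerm_add (n : ℕ) (s u v : ℕ → V) :
    F.signedTerm n s (u + v) = F.signedTerm n s u + F.signedTerm n s v := by
  simp [signedTerm, tangentTerm_add]

theorem signedTerm_smul (n : ℕ) (s : ℕ → V) (a : k) (u : ℕ → V) :
    F.signedTerm n s (a • u) = a • F.signedTerm n s u := by
  simp [signedTerm, tangentTerm_smul, smul_comm a]

theorem tangentTerm_eq_zero {s u : ℕ → V} (hs : s 0 = 0) {M : ℕ} (hu : ∀ j < M, u j = 0) {n m : ℕ}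
    (hm : m < M + n) : F.tangentTerm n s u m = 0 := by
  rw [tangentTerm, Pi.smul_apply, consExt_eq_zero _ (fun _ => hs) hu hm, smul_zero]

theorem signedTerm_eq_zero {s u : ℕ → V} (hs : s 0 = 0) {M : ℕ} (hu : ∀ j < M, u j = 0) {n m : ℕ}
    (hm : m < M + n) : F.signedTerm n s u m = 0 := by
  rw [signedTerm, Pi.smul_apply, tangentTerm_eq_zero hs hu hm, smul_zero]

theorem mcTerm_eq_zero {s : ℕ → V} (hs : s 0 = 0) {n m : ℕ} (hm : m < n + 1) :
    F.mcTerm n s m = 0 := by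
  rw [mcTerm, Pi.smul_apply, seriesExt_eq_zero _ (fun _ => 1) (fun _ => by simpa using hs)
    (by simpa using hm), smul_zero]

/-- This is the relation for (s, …, s) divided by (m + 2)!, which turns the binomial coefficients
into products of inverse factorials. -/
theorem dS_mcTerm_succ [CharZero k] (m : ℕ) {s : ℕ → V} (hs : s ∈ L.hSeries 1) :
    L'.dS (F.mcTerm (m + 1) s)
      + (2⁻¹ : k) • ∑ c ∈ antidiagonal m, L'.ad (F.mcTerm c.1 s) (F.mcTerm c.2 s)
    = F.signedTerm (m + 1) s (L.dS s) + (2⁻¹ : k) • F.signedTerm m s (L.ad s s) := by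
  have h := congrArg ((((m + 2).factorial : k))⁻¹ • ·) (F.rel_const_series m hs)
  simp only [smul_add] at h
  convert h using 2
  · rw [mcTerm, map_smul]
  · rw [smul_comm]
    congr 1
    rw [smul_sum]
    refine sum_congr rfl fun c hc => ?_
    rw [HasAntidiagonal.mem_antidiagonal] at hc
    simp only [mcTerm, map_smul, LinearMap.smul_apply, smul_smul]
    rw [mul_comm, inv_factorial_mul_choose k (i := c.1 + 1) (j := c.2 + 1) (by omega)]
  · rw [signedTerm, tangentTerm, smul_smul, smul_smul, ← inv_factorial_succ_mul k (m + 1)]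
    congr 1
    ring
  · rw [signedTerm, tangentTerm, smul_smul, smul_smul, smul_smul]
    congr 1
    have := inv_factorial_mul_choose_two k m
    linear_combination (-1) ^ m * this.symm

/-- This is the relation for (α, s, …, s) multiplied by (-1)^(m+1) / (m+1)!. The alternating sign in
`signedTerm` is what removes the signs in front of the brackets. -/
theorem dS_signedTerm_succ [CharZero k] (m : ℕ) {α s : ℕ → V} (hα : α ∈ L.hSeries 0)
    (hs : s ∈ L.MC) :
    L'.dS (F.signedTerm (m + 1) s α)
      - ∑ c ∈ antidiagonal m, L'.ad (F.signedTerm c.1 s α) (F.mcTerm c.2 s)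
    = F.tangentTerm (m + 1) s (L.dS α) - F.tangentTerm m s (L.ad α s)
      - (F.tangentTerm₂ m α s (L.dS s)
        + (((m + 1).factorial : k))⁻¹ • ((m + 1).choose 2 : k) •
          consExt (F.f (m + 1)) (headTail α s m) (L.ad s s)) := by
  have h := congrArg (((-1 : k) ^ (m + 1) * (((m + 1).factorial : k))⁻¹) • ·)
    (F.rel_headTail_series m hα hs.1)
  have hsq : (-1 : k) ^ (m + 1) * (-1) ^ (m + 1) = 1 := by
    rw [← mul_pow]; simp
  have hsq' : (-1 : k) ^ (m + 1) * (-1) ^ m = -1 := by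
    rw [pow_succ, mul_right_comm, ← mul_pow]; simp
  simp only [smul_add] at h
  rw [sub_eq_add_neg]
  trans
  · convert h using 2
    · rw [signedTerm, tangentTerm, map_smul, map_smul, smul_smul]
    · rw [← sum_neg_distrib, smul_sum]
      refine sum_congr rfl fun c hc => ?_
      rw [HasAntidiagonal.mem_antidiagonal] at hc
      rw [signedTerm, tangentTerm, mcTerm]
      simp only [map_smul, LinearMap.smul_apply, smul_smul]
      rw [← neg_smul]
      congr 1
      have := inv_factorial_mul_choose k (i := c.1) (j := c.2 + 1) (n := m + 1) (by omega)
      have h2 : (-1 : k) ^ (m + 1) * (-1) ^ c.2 = - (-1) ^ c.1 := by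
        rw [← hc, add_right_comm, pow_add, pow_succ, mul_assoc, ← mul_pow]
        simp
      linear_combination (-1 : k) ^ c.1 * this - (((m + 1).factorial : k))⁻¹ *
        ((m + 1).choose c.1) * h2
  · have key : ∀ (A B C E : ℕ → V') (e e' f g N M : k), e * e = 1 → e * e' = -1 → f * N = g →
        (e * f) • e • A + (e * f) • e • (-1 : k) • N • B
          + ((e * f) • e' • N • C + (e * f) • e' • M • E)
        = f • A - g • C - (g • B + f • M • E) := by
      intro A B C E e e' f g N M h1 h2 h3
      match_scalars
      · linear_combination f * h1
      · linear_combination -f * N * h1 - h3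
      · linear_combination f * N * h2 - h3
      · linear_combination f * M * h2
    exact h.trans (key _ _ _ _ _ _ _ _ _ _ hsq hsq' (inv_factorial_succ_mul k m))

end LInftyMorphism

/-- The bracket of the terms n and n' has order at least n + n' + 2, hence only n + n' < M matters
at ħ^(M+1). -/
theorem DGLA.ad_sum_apply {k V : Type*} [Field k] [AddCommGroup V] [Module k V] {L : DGLA k V}
    {x y : ℕ → ℕ → V} (hx : ∀ n, ∀ j < n + 1, x n j = 0) (hy : ∀ n, ∀ j < n + 1, y n j = 0)
    {X Y : ℕ → V} {M : ℕ} (hX : ∀ j ≤ M + 1, X j = ∑ n ∈ range (M + 1), x n j)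
    (hY : ∀ j ≤ M + 1, Y j = ∑ n ∈ range (M + 1), y n j) :
    L.ad X Y (M + 1) = ∑ l ∈ range M, ∑ c ∈ antidiagonal l, L.ad (x c.1) (y c.2) (M + 1) := by
  rw [sum_antidiagonal_eq_sum_range (fun p q => L.ad (x p) (y q) (M + 1)) (n := M + 1)
    (n' := M + 1) M.le_succ M.le_succ (fun p q hpq => cauchyProd_eq_zero L.bracket (hx p) (hy q)
      (by omega))]
  have e : L.ad X Y (M + 1) = L.ad (∑ n ∈ range (M + 1), x n) (∑ n ∈ range (M + 1), y n) (M + 1) := by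
    rw [ad_def, ad_def]
    refine sum_congr rfl fun c hc => ?_
    rw [HasAntidiagonal.mem_antidiagonal] at hc
    rw [hX c.1 (by omega), hY c.2 (by omega), Finset.sum_apply, Finset.sum_apply]
  rw [e]
  simp only [map_sum, LinearMap.sum_apply, Finset.sum_apply]
  exact sum_comm

/-! ### Curvature and tangent map of the map on Maurer–Cartan elements. -/

namespace LInftyMorphism

variable {k V V' : Type*} [Field k] [AddCommGroup V] [Module k V]
    [AddCommGroup V'] [Module k V'] {L : DGLA k V} {L' : DGLA k V'} {F : LInftyMorphism L L'}

theorem mcMap_eq_sum {s : ℕ → V} (hs : s 0 = 0) {m N : ℕ} (hN : m ≤ N) :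
    F.mcMap s m = ∑ n ∈ range N, F.mcTerm n s m := by
  rw [← sum_subset (range_subset_range.2 hN)]
  · change ∑ n ∈ Icc 1 m, ((Nat.factorial n : k))⁻¹ • seriesExt (F.f n) (fun _ => s) m = _
    rw [show Icc 1 m = Ico 1 (m + 1) from rfl, sum_Ico_eq_sum_range]
    refine sum_congr rfl fun n _ => ?_
    rw [add_comm 1 n]
    rfl
  · intro n _ hn
    exact mcTerm_eq_zero hs (by simp at hn; omega)

theorem mcTerm_apply_mem {s : ℕ → V} (hs : s ∈ L.hSeries 1) (n m : ℕ) :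
    F.mcTerm n s m ∈ L'.gr 1 := by
  refine (L'.gr 1).smul_mem _ (seriesExt_mem (fun c => ?_) m)
  have := F.degree (n + 1) (fun _ => 1) (fun a => s (c a)) fun _ => hs.2 _
  rwa [sum_const, card_univ, Fintype.card_fin, nsmul_eq_mul, mul_one, add_sub_cancel] at this

theorem mcMap_mem {s : ℕ → V} (hs : s ∈ L.hSeries 1) : F.mcMap s ∈ L'.hSeries 1 := by
  constructor
  · rw [mcMap_eq_sum hs.1 le_rfl]
    simp
  · intro m
    rw [mcMap_eq_sum hs.1 le_rfl]
    exact (L'.gr 1).sum_mem fun n _ => mcTerm_apply_mem hs n m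

/-- Summing the relations for (s, …, s) collects `ds` and `½[s, s]` in the same slot, hence into the
curvature. It yields both preservation of Maurer–Cartan elements and the obstruction calculus. -/
theorem curv_mcMap [CharZero k] {s : ℕ → V} (hs : s ∈ L.hSeries 1) (m : ℕ) :
    L'.curv (F.mcMap s) m = ∑ l ∈ range m, F.signedTerm l s (L.curv s) m := by
  rcases m with _ | M
  · rw [(DGLA.curv_mem (mcMap_mem hs)).1, range_zero, sum_empty]
  have h1 : L'.d (F.mcMap s (M + 1)) = ∑ l ∈ range M, L'.dS (F.mcTerm (l + 1) s) (M + 1)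
      + F.signedTerm 0 s (L.dS s) (M + 1) := by
    rw [mcMap_eq_sum hs.1 le_rfl, map_sum, sum_range_succ', ← dS_mcTerm_zero]
    rfl
  have h2 := DGLA.ad_sum_apply (L := L') (x := fun n => F.mcTerm n s) (y := fun n => F.mcTerm n s)
    (fun n j hj => mcTerm_eq_zero hs.1 hj) (fun n j hj => mcTerm_eq_zero hs.1 hj) (M := M)
    (fun j hj => mcMap_eq_sum hs.1 hj) (fun j hj => mcMap_eq_sum hs.1 hj)
  have h3 : ∀ l, L'.dS (F.mcTerm (l + 1) s) (M + 1)
      + (2⁻¹ : k) • ∑ c ∈ antidiagonal l, L'.ad (F.mcTerm c.1 s) (F.mcTerm c.2 s) (M + 1)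
      = F.signedTerm (l + 1) s (L.dS s) (M + 1)
        + (2⁻¹ : k) • F.signedTerm l s (L.ad s s) (M + 1) := by
    intro l
    have := congrFun (dS_mcTerm_succ (F := F) l hs) (M + 1)
    simpa only [Pi.add_apply, Pi.smul_apply, Finset.sum_apply] using this
  -- The bracket terms have one summand more than the relations supply; it vanishes because `[s, s]`
  -- begins at ħ².
  have h4 : F.signedTerm M s (L.ad s s) (M + 1) = 0 :=
    signedTerm_eq_zero hs.1 (M := 2) (fun j hj => cauchyProd_eq_zero (a := 1) (b := 1) L.bracket
      (by simpa using hs.1) (by simpa using hs.1) (by omega)) (by omega)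
  have h5 : ∀ l, F.signedTerm l s (L.curv s) (M + 1) = F.signedTerm l s (L.dS s) (M + 1)
      + (2⁻¹ : k) • F.signedTerm l s (L.ad s s) (M + 1) := by
    intro l
    rw [DGLA.curv, signedTerm_add, signedTerm_smul]
    rfl
  simp only [h5, sum_add_distrib]
  rw [DGLA.curv, Pi.add_apply, Pi.smul_apply, DGLA.dS_apply, h1, h2, smul_sum,
    sum_range_succ (fun l => (2⁻¹ : k) • F.signedTerm l s (L.ad s s) (M + 1)), h4, smul_zero,
    add_zero, sum_range_succ', add_right_comm, ← sum_add_distrib, sum_congr rfl fun l _ => h3 l,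
    sum_add_distrib]
  abel

theorem mcMap_mem_MC [CharZero k] {s : ℕ → V} (hs : s ∈ L.MC) : F.mcMap s ∈ L'.MC := by
  refine ⟨mcMap_mem hs.1, ?_⟩
  ext m
  have h : L.curv s = 0 := hs.2
  have := curv_mcMap (F := F) hs.1 m
  rw [h] at this
  exact this.trans (sum_eq_zero fun l _ => by simp [signedTerm, tangentTerm_zero_right])

theorem curv_mcMap_leading [CharZero k] {s : ℕ → V} (hs : s ∈ L.hSeries 1) {m : ℕ}
    (h : ∀ j < m, L.curv s j = 0) :
    (∀ j < m, L'.curv (F.mcMap s) j = 0) ∧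
      L'.curv (F.mcMap s) m = F.linearPart (L.curv s m) := by
  constructor
  · intro j hj
    rw [curv_mcMap hs]
    exact sum_eq_zero fun l _ => signedTerm_eq_zero hs.1 h (by omega)
  · rw [curv_mcMap hs]
    rcases m with _ | m
    · rw [range_zero, sum_empty, (DGLA.curv_mem hs).1, map_zero]
    · rw [sum_range_succ', sum_eq_zero fun l _ => signedTerm_eq_zero hs.1 h (by omega), zero_add,
        signedTerm, pow_zero, one_smul, tangentTerm_zero_apply]

/-- The components f_n with n ≥ 2 see only coefficients of index below m, so a change at index m
enters through f_1 alone. -/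
theorem mcMap_congr {s s' : ℕ → V} (hs : s 0 = 0) (hs' : s' 0 = 0) {m : ℕ}
    (h : ∀ j < m, s j = s' j) :
    F.mcMap s m = F.mcMap s' m + F.linearPart (s m - s' m) := by
  have h1 : ∀ n, F.mcTerm (n + 1) s m = F.mcTerm (n + 1) s' m := fun n => by
    rw [mcTerm, mcTerm, Pi.smul_apply, Pi.smul_apply,
      seriesExt_congr _ (fun _ => hs) (fun _ => hs') (fun _ => h) le_rfl]
  rw [mcMap_eq_sum hs m.le_succ, mcMap_eq_sum hs' m.le_succ, sum_range_succ', sum_range_succ' _ m]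
  simp only [h1, mcTerm_zero_apply, map_sub]
  abel

theorem mcMap_congr_lt {s s' : ℕ → V} (hs : s 0 = 0) (hs' : s' 0 = 0) {m : ℕ}
    (h : ∀ j < m, s j = s' j) {j : ℕ} (hj : j < m) : F.mcMap s j = F.mcMap s' j := by
  rw [mcMap_congr hs hs' (m := j) fun i hi => h i (hi.trans hj), h j hj, sub_self, map_zero,
    add_zero]

/-! ### The derivative of `mcMap` -/

theorem seriesExt_update [CharZero k] {n : ℕ} {s q : ℕ → V} (hs : s ∈ L.hSeries 1)
    (hq : q ∈ L.hSeries 1) (a : Fin (n + 1)) :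
    seriesExt (F.f (n + 1)) (Function.update (fun _ => s) a q) =
      consExt (F.f (n + 1)) (fun _ => s) q := by
  have h := F.seriesExt_perm (x := Fin.cons q fun _ => s)
    (fun b => by refine Fin.cases ?_ (fun b => ?_) b <;> simp [hq, hs]) (Equiv.swap 0 a)
  refine Eq.trans ?_ h
  congr 1
  ext1 b
  by_cases hb : b = a
  · subst hb
    simp
  · rw [Function.update_of_ne hb]
    have : Equiv.swap 0 a b ≠ 0 := by
      intro h0
      rw [Equiv.swap_apply_eq_iff, Equiv.swap_apply_left] at h0
      exact hb h0
    obtain ⟨c, hc⟩ := Fin.exists_succ_eq.2 this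
    rw [← hc, Fin.cons_succ]

theorem hasEulerS_mcMap [CharZero k] {s q : k → ℕ → V} (h : HasEulerS s q)
    (hs : ∀ t, s t ∈ L.hSeries 1) (hq : ∀ t, q t ∈ L.hSeries 1) :
    HasEulerS (fun t => F.mcMap (s t))
      fun t m => ∑ n ∈ range m, F.tangentTerm n (s t) (q t) m := by
  intro m
  refine (HasEuler.sum (s := range m) fun n _ => ((HasEulerS.seriesExt (F.f (n + 1))
    (fun _ => h) m).smul (((n + 1).factorial : k))⁻¹)).congr
    (fun t => mcMap_eq_sum (hs t).1 le_rfl) fun t => ?_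
  refine sum_congr rfl fun n _ => ?_
  beta_reduce
  rw [Finset.sum_apply]
  simp only [seriesExt_update (hs t) (hq t)]
  rw [sum_const, card_univ, Fintype.card_fin, ← Nat.cast_smul_eq_nsmul k, smul_smul,
    inv_factorial_succ_mul]
  rfl

variable (F) in
/-- The infinitesimal gauge transformation at `mcMap s` induced by `α`. -/
def gaugeParam (α s : ℕ → V) : ℕ → V' := fun m => ∑ n ∈ range m, F.signedTerm n s α m

theorem gaugeParam_eq_sum {α s : ℕ → V} (hα : α 0 = 0) (hs : s 0 = 0) {m N : ℕ} (hN : m ≤ N) :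
    F.gaugeParam α s m = ∑ n ∈ range N, F.signedTerm n s α m := by
  refine sum_subset (range_subset_range.2 hN) fun n _ hn => ?_
  exact signedTerm_eq_zero hs (M := 1) (by simpa using hα) (by simp at hn; omega)

theorem gaugeParam_mem {α s : ℕ → V} (hα : α ∈ L.hSeries 0) (hs : s ∈ L.hSeries 1) :
    F.gaugeParam α s ∈ L'.hSeries 0 := by
  refine ⟨by simp [gaugeParam], fun m => (L'.gr 0).sum_mem fun n _ => ?_⟩
  refine (L'.gr 0).smul_mem _ ((L'.gr 0).smul_mem _ (seriesExt_mem (fun c => ?_) m))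
  have := F.degree (n + 1) (headTail (0 : ℤ) 1 (n + 1))
    (fun a => (Fin.cons α (fun _ => s) : Fin (n + 1) → ℕ → V) a (c a)) (fun a => by
      refine Fin.cases ?_ (fun a => ?_) a
      · simpa [headTail] using hα.2 _
      · simpa [headTail] using hs.2 _)
  rwa [sum_headTail_degree, show (n : ℤ) + (1 - ((n + 1 : ℕ) : ℤ)) = 0 by push_cast; ring] at this

theorem gaugeParam_leading {α s : ℕ → V} (hα0 : α 0 = 0) (hs : s 0 = 0) {m : ℕ}
    (hα : ∀ j < m, α j = 0) :
    (∀ j < m, F.gaugeParam α s j = 0) ∧ F.gaugeParam α s m = F.linearPart (α m) := by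
  constructor
  · intro j hj
    exact sum_eq_zero fun l _ => signedTerm_eq_zero hs hα (by omega)
  · rw [gaugeParam_eq_sum hα0 hs m.le_succ, sum_range_succ',
      sum_eq_zero fun l _ => signedTerm_eq_zero hs hα (by omega), zero_add,
      signedTerm, pow_zero, one_smul, tangentTerm_zero_apply]

theorem isPolyFun_gaugeParam {α s : k → ℕ → V} (hα : ∀ m, IsPolyFun fun t => α t m)
    (hs : ∀ m, IsPolyFun fun t => s t m) (m : ℕ) :
    IsPolyFun fun t => F.gaugeParam (α t) (s t) m := by
  choose α' hα' using fun m => (hα m).exists_hasEuler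
  choose s' hs' using fun m => (hs m).exists_hasEuler
  refine IsPolyFun.sum fun n _ => IsPolyFun.smul (IsPolyFun.smul ?_ _) _
  exact (HasEulerS.seriesExt (F.f (n + 1))
    (p := fun a t => (Fin.cons (α t) (fun _ => s t) : Fin (n + 1) → ℕ → V) a)
    (q := fun a t => (Fin.cons (fun m => α' m t) (fun _ m => s' m t) : Fin (n + 1) → ℕ → V) a)
    (fun a => by refine Fin.cases ?_ (fun a => ?_) a; exacts [hα', hs']) m).isPolyFun

/-- The derivative of f at `s` carries the infinitesimal gauge transformation of `α` to that of
`gaugeParam α s`. This is the sum of the relations for (α, s, …, s); the Maurer–Cartan equation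
makes the remaining terms telescope. -/
theorem dS_gaugeParam [CharZero k] {α s : ℕ → V} (hα : α ∈ L.hSeries 0) (hs : s ∈ L.MC) (m : ℕ) :
    ∑ n ∈ range m, F.tangentTerm n s (L.ad α s - L.dS α) m =
      (L'.ad (F.gaugeParam α s) (F.mcMap s) - L'.dS (F.gaugeParam α s)) m := by
  have hs0 := hs.1.1
  rcases m with _ | M
  · rw [range_zero, sum_empty, Pi.sub_apply, DGLA.dS_apply, (gaugeParam_mem hα hs.1).1,
      (DGLA.ad_mem (gaugeParam_mem hα hs.1) (mcMap_mem (F := F) hs.1)).1]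
    simp
  have hα1 : ∀ j < 1, α j = 0 := by simpa using hα.1
  have hs1 : ∀ j < 1, s j = 0 := by simpa using hs0
  have h1 : L'.d (F.gaugeParam α s (M + 1)) = ∑ l ∈ range M, L'.dS (F.signedTerm (l + 1) s α) (M + 1)
      + F.tangentTerm 0 s (L.dS α) (M + 1) := by
    rw [gaugeParam, map_sum, sum_range_succ', ← dS_signedTerm_zero]
    rfl
  have h2 := DGLA.ad_sum_apply (L := L') (x := fun n => F.signedTerm n s α)
    (y := fun n => F.mcTerm n s)
    (fun n j hj => signedTerm_eq_zero hs0 hα1 (by omega)) (fun n j hj => mcTerm_eq_zero hs0 hj)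
    (M := M) (fun j hj => gaugeParam_eq_sum hα.1 hs0 hj) (fun j hj => mcMap_eq_sum hs0 hj)
  -- `Z l` is the term with `[s, s]` and `α` as arguments. Substituting ds = -½[s, s] turns the term
  -- with `ds` and `α` into `-Z (l + 1)`, so their sum telescopes; both ends vanish.
  let Z : ℕ → V' := fun l => ((((l + 1).factorial : k))⁻¹ • ((l + 1).choose 2 : k) •
          consExt (F.f (l + 1)) (headTail α s l) (L.ad s s)) (M + 1)
  have hZ : ∀ l, F.tangentTerm₂ l α s (L.dS s) (M + 1) = -Z (l + 1) := by
    intro l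
    have hd : L.dS s = -((2⁻¹ : k) • L.ad s s) := eq_neg_of_add_eq_zero_left hs.2
    simp only [Z]
    rw [hd, tangentTerm₂, map_neg, map_smul, smul_neg, Pi.neg_apply, smul_smul, smul_smul,
      inv_factorial_mul_choose_two, mul_comm]
  have hZ0 : Z 0 = 0 := by simp [Z]
  have hhT : ∀ a, headTail α s M a 0 = 0 := by
    intro a
    simp only [headTail]
    split_ifs
    exacts [hα.1, hs0]
  have hZM : Z M = 0 := by
    have h2 : ∀ j < 2, L.ad s s j = 0 := fun j hj => cauchyProd_eq_zero L.bracket hs1 hs1 hj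
    simp only [Z]
    rw [Pi.smul_apply, Pi.smul_apply, consExt_eq_zero _ hhT h2 (by omega), smul_zero, smul_zero]
  have h3 : ∀ l, L'.dS (F.signedTerm (l + 1) s α) (M + 1)
      - ∑ c ∈ antidiagonal l, L'.ad (F.signedTerm c.1 s α) (F.mcTerm c.2 s) (M + 1)
      = F.tangentTerm (l + 1) s (L.dS α) (M + 1) - F.tangentTerm l s (L.ad α s) (M + 1)
        - (Z l - Z (l + 1)) := by
    intro l
    have := congrFun (dS_signedTerm_succ (F := F) l hα hs) (M + 1)
    simp only [Pi.add_apply, Pi.sub_apply, Finset.sum_apply] at this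
    rw [this, hZ]
    simp only [Z]
    abel
  have h4 : F.tangentTerm M s (L.ad α s) (M + 1) = 0 :=
    tangentTerm_eq_zero hs0 (M := 2) (fun j hj => cauchyProd_eq_zero L.bracket hα1 hs1 (by omega))
      (by omega)
  rw [Pi.sub_apply, DGLA.dS_apply, h1, h2]
  have h5 := sum_congr (rfl : range M = range M) fun l _ => h3 l
  rw [sum_sub_distrib, sum_sub_distrib, sum_sub_distrib, sum_range_sub', hZ0, hZM] at h5
  simp only [tangentTerm_sub, Pi.sub_apply, sum_sub_distrib]
  rw [← neg_sub (_ + _), add_sub_right_comm, h5, sum_range_succ, h4, sum_range_succ' (fun n => F.tangentTerm n s (L.dS α) (M + 1))]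
  abel

theorem isGaugePath_mcMap [CharZero k] {b s : k → ℕ → V} (h : L.IsGaugePath b s)
    (hb : ∀ t, b t ∈ L.hSeries 0) (hs : ∀ t, s t ∈ L.MC) :
    L'.IsGaugePath (fun t => F.gaugeParam (b t) (s t)) fun t => F.mcMap (s t) := by
  intro m
  have hq : ∀ t, L.ad (b t) (s t) - L.dS (b t) ∈ L.hSeries 1 := fun t =>
    (L.hSeries 1).sub_mem (by simpa using DGLA.ad_mem (hb t) (hs t).1)
      (by simpa using DGLA.dS_mem (hb t))
  exact (hasEulerS_mcMap h (fun t => (hs t).1) hq m).congr (fun _ => rfl) fun t =>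
    (dS_gaugeParam (hb t) (hs t) m).symm

end LInftyMorphism

/-! ### Sequences of approximations -/

theorem exists_seq_of_succ {X : Type*} (P : ℕ → X → Prop) (Q : ℕ → X → X → Prop)
    (h0 : ∃ x, P 0 x) (h : ∀ m x, P m x → ∃ y, P (m + 1) y ∧ Q m x y) :
    ∃ s : ℕ → X, (∀ m, P m (s m)) ∧ ∀ m, Q m (s m) (s (m + 1)) := by
  choose φ hφ using h
  obtain ⟨x₀, hx₀⟩ := h0
  let s : ∀ m, {x // P m x} := fun m =>
    Nat.rec ⟨x₀, hx₀⟩ (fun m x => ⟨φ m x.1 x.2, (hφ m x.1 x.2).1⟩) m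
  exact ⟨fun m => (s m).1, fun m => (s m).2, fun m => (hφ m (s m).1 (s m).2).2⟩

/-- The diagonal sequence is the coefficientwise limit of the approximations. -/
theorem apply_eq_of_stable {V : Type*} {s : ℕ → ℕ → V}
    (h : ∀ m, ∀ j < m + 1, s (m + 1) j = s m j) {m j : ℕ} (hj : j < m + 1) : s j j = s m j := by
  obtain ⟨n, rfl⟩ := Nat.exists_eq_add_of_le (Nat.lt_succ_iff.1 hj)
  clear hj
  induction n with
  | zero => rfl
  | succ n ih => rw [ih, ← add_assoc, h (j + n) j (by omega)]

namespace DGLA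

variable {k V : Type*} [Field k] [AddCommGroup V] [Module k V] {L : DGLA k V}

theorem single_mem {n : ℤ} {v : V} (hv : v ∈ L.gr n) (m : ℕ) :
    (Pi.single (m + 1) v : ℕ → V) ∈ L.hSeries n := by
  refine ⟨Pi.single_eq_of_ne (by omega) _, fun i => ?_⟩
  by_cases h : i = m + 1
  · subst h
    simpa using hv
  · rw [Pi.single_eq_of_ne h]
    exact (L.gr n).zero_mem

theorem gaugeAct_single {α : ℕ → V} (hα : α 0 = 0) {x : ℕ → V} (hx : x 0 = 0) {m : ℕ}
    (h : ∀ j < m, α j = 0) :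
    (∀ j < m, L.gaugeAct α x j = x j) ∧ L.gaugeAct α x m = x m - L.d (α m) := by
  constructor
  · intro j hj
    have := gaugeAct_congr_lt (L := L) (α' := 0) hα rfl hx hx h (fun _ _ => rfl) hj
    rwa [gaugeAct_zero] at this
  · have := gaugeAct_congr (L := L) (α' := 0) hα rfl hx hx h (fun _ _ => rfl)
    rw [gaugeAct_zero] at this
    simpa using this

/-- For a Maurer–Cartan element `z` the operator `d + [z, -]` has square zero. -/
theorem ad_stabilizer [CharZero k] {z ρ : ℕ → V} (hz : z ∈ L.MC) (hρ : ρ ∈ L.hSeries (-1)) :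
    L.ad (L.dS ρ + L.ad z ρ) z = L.dS (L.dS ρ + L.ad z ρ) := by
  have hz1 := hz.1
  have hd : L.dS z = -((2⁻¹ : k) • L.ad z z) := eq_neg_of_add_eq_zero_left hz.2
  have hdρ : L.dS ρ ∈ L.hSeries 0 := by simpa using dS_mem hρ
  have hzρ : L.ad z ρ ∈ L.hSeries 0 := by simpa using ad_mem hz1 hρ
  have h1 : L.ad (L.dS ρ) z = -L.ad z (L.dS ρ) := by
    rw [ad_anticomm_zero hz1 hdρ, neg_neg]
  have h2 : L.ad (L.ad z ρ) z = -L.ad z (L.ad z ρ) := by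
    rw [ad_anticomm_zero hz1 hzρ, neg_neg]
  have h3 : L.ad ρ z = L.ad z ρ := by
    simpa [Int.negOnePow_neg] using ad_skew hρ hz1
  have h4 : L.ad ρ (L.ad z z) = -L.ad (L.ad z z) ρ := by
    simpa [Int.negOnePow_neg, Int.negOnePow_even 2 even_two] using ad_skew hρ (ad_mem hz1 hz1)
  have h5 := ad_jacobi hz1 hz1 hρ
  rw [h3, h4] at h5
  simp only [mul_one, one_mul, Int.negOnePow_neg, Int.negOnePow_one, Units.neg_smul, one_smul,
    neg_neg] at h5
  have h6 : L.ad z (L.ad z ρ) = (2⁻¹ : k) • L.ad (L.ad z z) ρ := by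
    rw [eq_inv_smul_iff₀ two_ne_zero, two_smul, ← sub_eq_zero, ← neg_eq_zero, ← h5]
    abel
  rw [map_add, LinearMap.add_apply, h1, h2, map_add, dS_dS, dS_ad hz1, hd, h6, map_neg, map_smul,
    LinearMap.neg_apply, LinearMap.smul_apply, Int.negOnePow_one, Units.neg_smul, one_smul]
  abel

end DGLA

/-! ### Lifting along the quasi-isomorphism. -/

namespace LInftyMorphism

variable {k V V' : Type*} [Field k] [AddCommGroup V] [Module k V]
    [AddCommGroup V'] [Module k V'] {L : DGLA k V} {L' : DGLA k V'} {F : LInftyMorphism L L'}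

theorem cohomologyMap_mk {n : ℤ} (z : L.cocycles n) :
    F.cohomologyMap n (Submodule.Quotient.mk z) =
      Submodule.Quotient.mk ⟨F.linearPart z, F.linearPart_cocycles z z.2⟩ := rfl

/-- Injectivity on H^n, in the form used on cochains. -/
theorem IsWeakEquivalence.exists_primitive (hF : F.IsWeakEquivalence) {n m : ℤ} (hnm : n - 1 = m)
    {z : V} (hz : z ∈ L.gr n) (hdz : L.d z = 0) {u' : V'} (hu' : u' ∈ L'.gr m)
    (h : F.linearPart z = L'.d u') : ∃ u ∈ L.gr m, L.d u = z := by
  subst hnm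
  let zc : L.cocycles n := ⟨z, hdz, hz⟩
  have h0 : F.cohomologyMap n (Submodule.Quotient.mk zc) = 0 := by
    rw [cohomologyMap_mk, Submodule.Quotient.mk_eq_zero]
    exact ⟨u', hu', h.symm⟩
  have h1 := (hF n).1 (h0.trans (map_zero _).symm)
  rw [Submodule.Quotient.mk_eq_zero] at h1
  obtain ⟨u, hu, hdu⟩ := h1
  exact ⟨u, hu, hdu⟩

/-- Surjectivity on H^n, in the form used on cochains. -/
theorem IsWeakEquivalence.exists_preimage (hF : F.IsWeakEquivalence) {n m : ℤ} (hnm : n - 1 = m)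
    {z : V'} (hz : z ∈ L'.gr n) (hdz : L'.d z = 0) :
    ∃ c ∈ L.gr n, L.d c = 0 ∧ ∃ v ∈ L'.gr m, z = F.linearPart c + L'.d v := by
  subst hnm
  let zc : L'.cocycles n := ⟨z, hdz, hz⟩
  obtain ⟨q, hq⟩ := (hF n).2 (Submodule.Quotient.mk zc)
  obtain ⟨c, rfl⟩ := Submodule.Quotient.mk_surjective _ q
  rw [cohomologyMap_mk, Submodule.Quotient.eq] at hq
  obtain ⟨v, hv, hdv⟩ := hq
  refine ⟨c, c.2.2, c.2.1, -v, (L'.gr _).neg_mem hv, ?_⟩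
  have hdv' : L'.d v = F.linearPart c - z := hdv
  rw [map_neg, hdv']
  abel

variable [CharZero k]

/-! ### Gauge equivalent elements have gauge equivalent images -/

/-- The image under f of the curve exp(tγ) · x is an integral curve of `gaugeParam`, whose leading
coefficient is t f_1(γ_m). Allowing an initial transformation `β'` lets corrections accumulate. -/
theorem exists_gauge_mcMap {γ : ℕ → V} {β' y : ℕ → V'} {x : ℕ → V} (hγ : γ ∈ L.hSeries 0)
    (hx : x ∈ L.MC) (hβ' : β' ∈ L'.hSeries 0) (hy : y ∈ L'.hSeries 1)
    (h : F.mcMap x = L'.gaugeAct β' y) :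
    ∃ δ ∈ L'.hSeries 0, F.mcMap (L.gaugeAct γ x) = L'.gaugeAct δ y ∧
      ∀ m, (∀ j < m, γ j = 0) → (∀ j < m, δ j = β' j) ∧ δ m = β' m + F.linearPart (γ m) := by
  have hm : ∀ t : k, t • γ ∈ L.hSeries 0 := fun t => (L.hSeries 0).smul_mem t hγ
  have hp := DGLA.isGaugePath_exp hγ hx.1
  have hMC : ∀ t : k, L.gaugeAct (t • γ) x ∈ L.MC := fun t => DGLA.gaugeAct_mem_MC (hm t) hx
  obtain ⟨δ, hδ, h1, h2⟩ := DGLA.exists_gauge_transport (L := L')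
    (b := fun t => F.gaugeParam (t • γ) (L.gaugeAct (t • γ) x))
    (fun t => gaugeParam_mem (hm t) (hMC t).1)
    (by ext m; simp [gaugeParam, signedTerm, tangentTerm_zero_right])
    (isPolyFun_gaugeParam (DGLA.isPolyFun_smul γ) fun m => (hp m).isPolyFun) hβ'
  refine ⟨δ, hδ, ?_, fun m hγm => ?_⟩
  · have := h1 _ y (isGaugePath_mcMap hp hm hMC) hy (by simpa [DGLA.gaugeAct_zero] using h)
    simpa using this
  · have hl := fun t : k => gaugeParam_leading (F := F) (s := L.gaugeAct (t • γ) x) (hm t).1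
      (hMC t).1.1 (m := m) (fun j hj => by simp [hγm j hj])
    exact h2 m _ (fun j hj t => (hl t).1 j hj) fun t => by rw [(hl t).2]; simp

theorem gaugeRel_mcMap {s t : L.MC} (h : L.GaugeRel s t) :
    L'.GaugeRel ⟨F.mcMap s, mcMap_mem_MC s.2⟩ ⟨F.mcMap t, mcMap_mem_MC t.2⟩ := by
  obtain ⟨α, hα, h⟩ := h
  obtain ⟨δ, hδ, h1, -⟩ := exists_gauge_mcMap (F := F) hα s.2 (L'.hSeries 0).zero_mem
    (mcMap_mem s.2.1) (DGLA.gaugeAct_zero _).symm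
  rw [← h] at h1
  exact ⟨δ, hδ, h1⟩

/-! ### Surjectivity -/

theorem IsWeakEquivalence.exists_lift_step (hF : F.IsWeakEquivalence) {y : ℕ → V'} (hy : y ∈ L'.MC)
    {m : ℕ} {x : ℕ → V} {α : ℕ → V'} (hx : x ∈ L.hSeries 1) (hα : α ∈ L'.hSeries 0)
    (hcx : ∀ j < m + 1, L.curv x j = 0)
    (hxy : ∀ j < m + 1, L'.gaugeAct α (F.mcMap x) j = y j) :
    ∃ (x₁ : ℕ → V) (α₁ : ℕ → V'), x₁ ∈ L.hSeries 1 ∧ α₁ ∈ L'.hSeries 0 ∧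
      (∀ j < m + 2, L.curv x₁ j = 0) ∧ (∀ j < m + 2, L'.gaugeAct α₁ (F.mcMap x₁) j = y j) ∧
      (∀ j < m + 1, x₁ j = x j) ∧ ∀ j < m + 1, α₁ j = α j := by
  set M := m + 1 with hM
  have hfx : F.mcMap x ∈ L'.hSeries 1 := mcMap_mem hx
  set z := L'.gaugeAct α (F.mcMap x) with hz
  have hzm : z ∈ L'.hSeries 1 := DGLA.gaugeAct_mem hα hfx
  -- By the Bianchi identity d(curv) = [curv, x], whose order exceeds M.
  have hdo : L.d (L.curv x M) = 0 := by
    have := congrFun (DGLA.dS_curv hx) M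
    rw [DGLA.dS_apply] at this
    rw [this]
    exact cauchyProd_eq_zero (b := 1) L.bracket hcx (by simpa using hx.1) (by omega)
  have hcf := curv_mcMap_leading (F := F) hx hcx
  -- The gauge action keeps the leading curvature f_1(curv x)_M of `F.mcMap x`, while `y` is flat
  -- and agrees with `z` below M.
  have hfo : F.linearPart (L.curv x M) = L'.d (z M - y M) := by
    rw [← DGLA.curv_congr hzm.1 hy.1.1 hxy, (DGLA.curv_gaugeAct hα hfx hcf.1).2, hcf.2,
      show L'.curv y = 0 from hy.2, Pi.zero_apply, sub_zero]
  have hw : z M - y M ∈ L'.gr 1 := (L'.gr 1).sub_mem (hzm.2 M) (hy.1.2 M)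
  obtain ⟨u, hu, hdu⟩ := hF.exists_primitive (n := 2) (m := 1) (by norm_num)
    ((DGLA.curv_mem hx).2 M) hdo hw hfo
  obtain ⟨c, hc, hdc, v, hv, hcv⟩ := hF.exists_preimage (n := 1) (m := 0) (by norm_num)
    (z := z M - y M - F.linearPart u) ((L'.gr 1).sub_mem hw (F.linearPart_mem hu))
    (by rw [map_sub, ← F.linearPart_d, hdu, hfo, sub_self])
  have hxs : x - Pi.single M (u + c) ∈ L.hSeries 1 :=
    (L.hSeries 1).sub_mem hx (DGLA.single_mem ((L.gr 1).add_mem hu hc) m)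
  have hαs : α + Pi.single M v ∈ L'.hSeries 0 :=
    (L'.hSeries 0).add_mem hα (DGLA.single_mem hv m)
  have hxa : ∀ j < M, (x - Pi.single M (u + c) : ℕ → V) j = x j := fun j hj => by
    rw [Pi.sub_apply, Pi.single_eq_of_ne (by omega), sub_zero]
  have hαa : ∀ j < M, (α + Pi.single M v : ℕ → V') j = α j := fun j hj => by
    rw [Pi.add_apply, Pi.single_eq_of_ne (by omega), add_zero]
  refine ⟨_, _, hxs, hαs, fun j hj => ?_, fun j hj => ?_, hxa, hαa⟩
  · rcases Nat.lt_succ_iff_lt_or_eq.1 hj with h | rfl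
    · have := DGLA.curv_congr (L := L) hxs.1 hx.1 (m := j) fun i hi => hxa i (by omega)
      rw [hcx j h, hxa j h, sub_self, map_zero, sub_zero] at this
      exact this
    · have := DGLA.curv_congr (L := L) hxs.1 hx.1 hxa
      refine (sub_eq_iff_eq_add.1 this).trans ?_
      rw [← hdu]
      simp [hdc]
  · have hfa : ∀ j < M, F.mcMap (x - Pi.single M (u + c) : ℕ → V) j = F.mcMap x j := fun j hj =>
      mcMap_congr_lt hxs.1 hx.1 hxa hj
    have hfs : F.mcMap (x - Pi.single M (u + c)) ∈ L'.hSeries 1 := mcMap_mem hxs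
    rcases Nat.lt_succ_iff_lt_or_eq.1 hj with h | rfl
    · rw [DGLA.gaugeAct_congr_lt hαs.1 hα.1 hfs.1 hfx.1 hαa hfa h]
      exact hxy j h
    · rw [DGLA.gaugeAct_congr hαs.1 hα.1 hfs.1 hfx.1 hαa hfa, mcMap_congr hxs.1 hx.1 hxa]
      -- The changes of `x` and `α` lower `z M` by f_1(u + c) and by dv, which leaves `y M`.
      have e : z M = y M + F.linearPart u + F.linearPart c + L'.d v := by
        rw [add_assoc, ← hcv]
        abel
      rw [← hz, e]
      simp
      abel

theorem IsWeakEquivalence.exists_lift (hF : F.IsWeakEquivalence) {y : ℕ → V'} (hy : y ∈ L'.MC) :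
    ∃ x ∈ L.MC, ∃ α ∈ L'.hSeries 0, y = L'.gaugeAct α (F.mcMap x) := by
  obtain ⟨s, hs, hQ⟩ := exists_seq_of_succ
    (P := fun m (s : (ℕ → V) × (ℕ → V')) => s.1 ∈ L.hSeries 1 ∧ s.2 ∈ L'.hSeries 0 ∧
      (∀ j < m + 1, L.curv s.1 j = 0) ∧ ∀ j < m + 1, L'.gaugeAct s.2 (F.mcMap s.1) j = y j)
    (Q := fun m s s' => (∀ j < m + 1, s'.1 j = s.1 j) ∧ ∀ j < m + 1, s'.2 j = s.2 j)
    ⟨0, (L.hSeries 1).zero_mem, (L'.hSeries 0).zero_mem, fun j hj => by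
      obtain rfl : j = 0 := by omega
      exact (DGLA.curv_mem (L.hSeries 1).zero_mem).1, fun j hj => by
      obtain rfl : j = 0 := by omega
      exact (DGLA.gaugeAct_mem (L'.hSeries 0).zero_mem (mcMap_mem (L.hSeries 1).zero_mem)).1.trans
        hy.1.1.symm⟩
    (fun m s ⟨h1, h2, h3, h4⟩ => by
      obtain ⟨x₁, α₁, g1, g2, g3, g4, g5, g6⟩ := hF.exists_lift_step hy h1 h2 h3 h4
      exact ⟨(x₁, α₁), ⟨g1, g2, g3, g4⟩, g5, g6⟩)
  let x : ℕ → V := fun j => (s j).1 j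
  let α : ℕ → V' := fun j => (s j).2 j
  have hxs : ∀ m, ∀ j < m + 1, x j = (s m).1 j := fun m j hj =>
    apply_eq_of_stable (s := fun m => (s m).1) (fun m => (hQ m).1) hj
  have hαs : ∀ m, ∀ j < m + 1, α j = (s m).2 j := fun m j hj =>
    apply_eq_of_stable (s := fun m => (s m).2) (fun m => (hQ m).2) hj
  have hx : x ∈ L.hSeries 1 := ⟨(hs 0).1.1, fun j => (hs j).1.2 j⟩
  have hα : α ∈ L'.hSeries 0 := ⟨(hs 0).2.1.1, fun j => (hs j).2.1.2 j⟩
  refine ⟨x, ⟨hx, ?_⟩, α, hα, ?_⟩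
  · ext m
    have := DGLA.curv_congr (L := L) hx.1 (hs m).1.1 (m := m) fun j hj => hxs m j (by omega)
    rw [hxs m m m.lt_succ_self, sub_self, map_zero, (hs m).2.2.1 m m.lt_succ_self, sub_zero] at this
    exact this
  · ext m
    rw [DGLA.gaugeAct_congr_lt hα.1 (hs m).2.1.1 (mcMap_mem hx).1 (mcMap_mem (hs m).1).1 (hαs m)
      (fun j hj => mcMap_congr_lt hx.1 (hs m).1.1 (hxs m) hj) m.lt_succ_self]
    exact ((hs m).2.2.2 m m.lt_succ_self).symm

/-! ### Injectivity -/

theorem IsWeakEquivalence.exists_gauge_step (hF : F.IsWeakEquivalence) {x₀ x y α : ℕ → V}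
    {β : ℕ → V'} (hx₀ : x₀ ∈ L.MC) (hy : y ∈ L.MC) {m : ℕ} (hα : α ∈ L.hSeries 0)
    (hβ : β ∈ L'.hSeries 0) (hx : x = L.gaugeAct α x₀)
    (hxy : F.mcMap x = L'.gaugeAct β (F.mcMap y)) (hj : ∀ j < m + 1, x j = y j)
    (hβj : ∀ j < m + 1, β j = 0) :
    ∃ (x₁ α₁ : ℕ → V) (β₁ : ℕ → V'), α₁ ∈ L.hSeries 0 ∧ β₁ ∈ L'.hSeries 0 ∧
      x₁ = L.gaugeAct α₁ x₀ ∧ F.mcMap x₁ = L'.gaugeAct β₁ (F.mcMap y) ∧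
      (∀ j < m + 2, x₁ j = y j) ∧ (∀ j < m + 2, β₁ j = 0) ∧ ∀ j < m + 1, α₁ j = α j := by
  set M := m + 1 with hM
  have hxMC : x ∈ L.MC := hx ▸ DGLA.gaugeAct_mem_MC hα hx₀
  have hfy : F.mcMap y ∈ L'.hSeries 1 := mcMap_mem hy.1
  have hdw : L.d (x M - y M) = 0 := by
    rw [← DGLA.curv_congr hxMC.1.1 hy.1.1 hj, show L.curv x = 0 from hxMC.2,
      show L.curv y = 0 from hy.2, sub_self]
  -- As `β` starts at order M, it changes the coefficient M of `F.mcMap y` by exactly -dβ_M.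
  have hfw : F.linearPart (x M - y M) = L'.d (-β M) := by
    have h1 := mcMap_congr (F := F) hxMC.1.1 hy.1.1 hj
    rw [hxy, (DGLA.gaugeAct_single hβ.1 hfy.1 hβj).2] at h1
    rw [map_neg]
    exact (add_left_cancel (by rw [← h1]; abel : F.mcMap y M + -L'.d (β M) = _)).symm
  obtain ⟨u, hu, hdu⟩ := hF.exists_primitive (n := 1) (m := 0) (by norm_num)
    ((L.gr 1).sub_mem (hxMC.1.2 M) (hy.1.2 M)) hdw ((L'.gr 0).neg_mem (hβ.2 M)) hfw
  obtain ⟨c, hc, hdc, v, hv, hcv⟩ := hF.exists_preimage (n := 0) (m := -1) (by norm_num)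
    (z := F.linearPart u + β M) ((L'.gr 0).add_mem (F.linearPart_mem hu) (hβ.2 M))
    (by rw [map_add, ← F.linearPart_d, hdu, hfw, map_neg, neg_add_cancel])
  have hγ : (Pi.single M (u - c) : ℕ → V) ∈ L.hSeries 0 :=
    DGLA.single_mem ((L.gr 0).sub_mem hu hc) m
  have hγj : ∀ j < M, (Pi.single M (u - c) : ℕ → V) j = 0 := fun j hj =>
    Pi.single_eq_of_ne (by omega) _
  set γ : ℕ → V := Pi.single M (u - c) with hγdef
  have hγM : γ M = u - c := Pi.single_eq_same M _
  obtain ⟨α₁, hα₁, hα₁x, hα₁j⟩ := DGLA.exists_gaugeAct_gaugeAct hγ hα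
  obtain ⟨δ, hδ, hδx, hδj⟩ := exists_gauge_mcMap hγ hxMC hβ hfy hxy
  obtain ⟨hδj, hδM⟩ := hδj M hγj
  have hx₁ : L.gaugeAct γ x ∈ L.MC := DGLA.gaugeAct_mem_MC hγ hxMC
  set z := F.mcMap (L.gaugeAct γ x) with hz
  have hzMC : z ∈ L'.MC := mcMap_mem_MC hx₁
  -- After acting by γ, the coefficient M of `δ` is β_M + f_1(u - c) = dv. The choice of ρ makes the
  -- leading coefficient of ω equal to -dv.
  have hρ : (Pi.single M (-v) : ℕ → V') ∈ L'.hSeries (-1) :=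
    DGLA.single_mem ((L'.gr (-1)).neg_mem hv) m
  have hρj : ∀ j < M, (Pi.single M (-v) : ℕ → V') j = 0 := fun j hj =>
    Pi.single_eq_of_ne (by omega) _
  set ρ : ℕ → V' := Pi.single M (-v) with hρdef
  have hω : L'.dS ρ + L'.ad z ρ ∈ L'.hSeries 0 := (L'.hSeries 0).add_mem
    (by simpa using DGLA.dS_mem hρ) (by simpa using DGLA.ad_mem hzMC.1 hρ)
  have hωj : ∀ j ≤ M, (L'.dS ρ + L'.ad z ρ) j = L'.d (ρ j) := fun j hj => by
    rw [Pi.add_apply, DGLA.ad_def, cauchyProd_eq_zero (a := 1) L'.bracket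
      (by simpa using hzMC.1.1) hρj (by omega), add_zero, DGLA.dS_apply]
  set ω := L'.dS ρ + L'.ad z ρ with hωdef
  -- ω lies in the stabilizer of `z`, so the constant path is an integral curve. Transport along it
  -- alters `δ` without moving `z`.
  have hpath : L'.IsGaugePath (fun t => t • ω) fun _ => z := by
    intro n
    refine (HasEulerS.const z n).congr (fun _ => rfl) fun t => ?_
    beta_reduce
    rw [map_smul, LinearMap.smul_apply, map_smul, hωdef, DGLA.ad_stabilizer hzMC hρ, sub_self]
  obtain ⟨β₁, hβ₁, hβ₁x, hβ₁j⟩ := DGLA.exists_gauge_transport (L := L') (b := fun t => t • ω)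
    (fun t => (L'.hSeries 0).smul_mem t hω) (zero_smul k ω) (DGLA.isPolyFun_smul ω) hδ
  obtain ⟨hβ₁j, hβ₁M⟩ := hβ₁j M (ω M)
    (fun j hj t => by rw [Pi.smul_apply, hωj j hj.le, hρj j hj, map_zero, smul_zero]) fun t => rfl
  refine ⟨L.gaugeAct γ x, α₁, β₁, hα₁, hβ₁, by rw [hx, hα₁x x₀ hx₀.1],
    hβ₁x _ _ hpath hfy hδx, fun j hj' => ?_, fun j hj' => ?_, hα₁j M hγj⟩
  · obtain ⟨h1, h2⟩ := DGLA.gaugeAct_single (L := L) hγ.1 hxMC.1.1 hγj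
    rcases Nat.lt_succ_iff_lt_or_eq.1 hj' with h | rfl
    · rw [h1 j h, hj j h]
    · rw [h2, hγM, map_sub, hdu, hdc]
      abel
  · rcases Nat.lt_succ_iff_lt_or_eq.1 hj' with h | rfl
    · rw [hβ₁j j h, hδj j h, hβj j h]
    · rw [hβ₁M, hδM, hωj M le_rfl, hγM, hρdef, Pi.single_eq_same, map_sub, map_neg,
        eq_sub_of_add_eq' hcv.symm]
      abel

theorem IsWeakEquivalence.exists_gauge (hF : F.IsWeakEquivalence) {x₀ y : ℕ → V} (hx₀ : x₀ ∈ L.MC)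
    (hy : y ∈ L.MC) {β : ℕ → V'} (hβ : β ∈ L'.hSeries 0)
    (h : F.mcMap x₀ = L'.gaugeAct β (F.mcMap y)) : ∃ α ∈ L.hSeries 0, y = L.gaugeAct α x₀ := by
  obtain ⟨s, hs, hQ⟩ := exists_seq_of_succ
    (P := fun m (s : (ℕ → V) × (ℕ → V) × (ℕ → V')) => s.2.1 ∈ L.hSeries 0 ∧ s.2.2 ∈ L'.hSeries 0 ∧
      s.1 = L.gaugeAct s.2.1 x₀ ∧ F.mcMap s.1 = L'.gaugeAct s.2.2 (F.mcMap y) ∧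
      (∀ j < m + 1, s.1 j = y j) ∧ ∀ j < m + 1, s.2.2 j = 0)
    (Q := fun m s s' => ∀ j < m + 1, s'.2.1 j = s.2.1 j)
    ⟨(x₀, 0, β), (L.hSeries 0).zero_mem, hβ, (DGLA.gaugeAct_zero x₀).symm, h, fun j hj => by
      obtain rfl : j = 0 := by omega
      exact hx₀.1.1.trans hy.1.1.symm, fun j hj => by
      obtain rfl : j = 0 := by omega
      exact hβ.1⟩
    (fun m s ⟨h1, h2, h3, h4, h5, h6⟩ => by
      obtain ⟨x₁, α₁, β₁, g1, g2, g3, g4, g5, g6, g7⟩ :=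
        hF.exists_gauge_step hx₀ hy h1 h2 h3 h4 h5 h6
      exact ⟨(x₁, α₁, β₁), ⟨g1, g2, g3, g4, g5, g6⟩, g7⟩)
  let α : ℕ → V := fun j => (s j).2.1 j
  have hαs : ∀ m, ∀ j < m + 1, α j = (s m).2.1 j := fun m j hj =>
    apply_eq_of_stable (s := fun m => (s m).2.1) hQ hj
  refine ⟨α, ⟨(hs 0).1.1, fun j => (hs j).1.2 j⟩, ?_⟩
  ext m
  rw [DGLA.gaugeAct_congr_lt (α := α) (hs 0).1.1 (hs m).1.1 hx₀.1.1 hx₀.1.1 (hαs m) (fun _ _ => rfl)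
    m.lt_succ_self, ← (hs m).2.2.1]
  exact ((hs m).2.2.2.2.1 m m.lt_succ_self).symm

end LInftyMorphism

theorem theorem39 {k V V' : Type*} [Field k] [CharZero k]
    [AddCommGroup V] [Module k V] [AddCommGroup V'] [Module k V']
    (L : DGLA k V) (L' : DGLA k V') (F : LInftyMorphism L L') (hF : F.IsWeakEquivalence) :
    ∃ hMC : ∀ s ∈ L.MC, F.mcMap s ∈ L'.MC,
      ∃ DefF : L.Def → L'.Def,
        (∀ s : L.MC,
          DefF (Quot.mk L.GaugeRel s) = Quot.mk L'.GaugeRel ⟨F.mcMap s, hMC s s.2⟩) ∧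
        Function.Bijective DefF := by
  refine ⟨fun s hs => LInftyMorphism.mcMap_mem_MC hs,
    Quot.lift (fun s : L.MC => Quot.mk L'.GaugeRel ⟨F.mcMap s, LInftyMorphism.mcMap_mem_MC s.2⟩)
      fun s t h => Quot.sound (LInftyMorphism.gaugeRel_mcMap h), fun s => rfl, ?_, ?_⟩
  · intro p q hpq
    obtain ⟨s, rfl⟩ := Quot.exists_rep p
    obtain ⟨t, rfl⟩ := Quot.exists_rep q
    -- Equality in the quotient means the generated equivalence relation, which is the gauge
    -- relation itself. Symmetry puts the transformation on the side of `t`, as `exists_gauge`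
    -- expects.
    obtain ⟨β, hβ, h⟩ := DGLA.gaugeRel_equivalence.symm
      (DGLA.gaugeRel_equivalence.eqvGen_iff.1 (Quot.eqvGen_exact hpq))
    obtain ⟨α, hα, h'⟩ := hF.exists_gauge s.2 t.2 hβ h
    exact Quot.sound ⟨α, hα, h'⟩
  · intro q
    obtain ⟨y, rfl⟩ := Quot.exists_rep q
    obtain ⟨x, hx, α, hα, h⟩ := hF.exists_lift y.2
    exact ⟨Quot.mk _ ⟨x, hx⟩, Quot.sound ⟨α, hα, h⟩⟩
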